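/- Let $n\in\mathbb N$, $T>0$, $\alpha\in(0,1)$ be fixed. Let $AC^\alpha$ be the set of all functions $x\colon[0,T]\to\mathbb R^n$ of the form $$x(\tau)=x(0)+\frac1{\Gamma(\alpha)}\int_0^\tau\frac{f(\xi)}{(\tau-\xi)^{1-\alpha}}\,d\xi,\qquad \tau\in[0,T],$$ with $f\colon[0,T]\to\mathbb R^n$ Lebesgue measurable and essentially bounded; such functions are continuous and $AC^\alpha$ is endowed with the uniform metric. For $x\in AC^\alpha$ let $$(^CD^\alpha x)(\tau)=\frac1{\Gamma(1-\alpha)}\frac{d}{d\tau}\int_0^\tau\frac{x(\xi)-x(0)}{(\tau-\xi)^\alpha}\,d\xi$$ be its Caputo derivative, which exists for a.e. $\tau\in[0,T]$. For $(t,x)\in[0,T]\times AC^\alpha$ let $Y(t,x)$ be the set of all $y\in AC^\alpha$ with $y=x$ on $[0,t]$, and let $a(\tau\mid t,x)=x(\tau)$ for $\tau\in[0,t]$ and $$a(\tau\mid t,x)=x(0)+\frac1{\Gamma(\alpha)}\int_0^t\frac{(^CD^\alpha x)(\xi)}{(\tau-\xi)^{1-\alpha}}\,d\xi\qquad\text{for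 }\tau\in(t,T].$$ A functional $\psi\colon[0,T]\times AC^\alpha\to\mathbb R$ is $ci$-differentiable of order $\alpha$ at $(t,x)$, $t<T$, with $ci$-derivatives $\partial_t^\alpha\psi(t,x)\in\mathbb R$ and $\nabla^\alpha\psi(t,x)\in\mathbb R^n$, if for every $y\in Y(t,x)$ $$\psi(\tau,y)-\psi(t,x)=\partial_t^\alpha\psi(t,x)(\tau-t)+\int_t^\tau\langle\nabla^\alpha\psi(t,x),(^CD^\alpha y)(\xi)\rangle\,d\xi+o(\tau-t)\qquad\text{as }\tau\to t^+ ,$$ where the remainder may depend on $t$ and $y$. The functional $\psi$ is $ci$-smooth of order $\alpha$ if it is continuous on $[0,T]\times AC^\alpha$, $ci$-differentiable of order $\alpha$ at every point of $[0,T)\times AC^\alpha$, and $\partial_t^\alpha\psi$ and $\nabla^\alpha\psi$ are continuous on $[0,T)\times AC^\alpha$. Let $H\colon[0,T]\times\mathbb R^n\times\mathbb R^n\to\mathbb R$, let $c_*>0$ be a number, and let $\sigma\colon AC^\alpha\to\mathbb R$. Consider the Cauchy problem $$\partial_t^\alpha\varphi(t,x)+H\bigl(t,x(t),\nabla^\alpha\varphi(t,x)\bigr)=0\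 \text{ on }[0,T)\times AC^\alpha,\qquad \varphi(T,x)=\sigma(x)\ \text{ for all }x\in AC^\alpha.$$ For $k=1,2,\dots$ put $$X_k=\bigl\{x\in AC^\alpha:\ \|x(0)\|\le k,\ \ \|(^CD^\alpha x)(\tau)\|\le k\,c_*(1+\|x(\tau)\|)\text{ for a.e. }\tau\in[0,T]\bigr\}.$$ A functional $\varphi\colon[0,T]\times AC^\alpha\to\mathbb R$ is a viscosity solution of the Cauchy problem if it is continuous, satisfies $\varphi(T,\cdot)=\sigma$, and has the following properties. (L) For every compact set $X\subset AC^\alpha$ there is $\Lambda>0$ such that, for all $t\in[0,T]$ and $x,y\in X$, $$|\varphi(t,x)-\varphi(t,y)|\le\Lambda\Bigl(\|a(T\mid t,x)-a(T\mid t,y)\|+\int_0^T\frac{\|a(\tau\mid t,x)-a(\tau\mid t,y)\|}{(T-\tau)^{1-\alpha}}\,d\tau\Bigr).$$ (V$_+$) For every $ci$-smooth of order $\alpha$ functional $\psi$ and every $k\ge1$, if $\varphi-\psi$ attains its minimum on $[0,T]\times X_k$ at a point $(t,x)\in[0,T)\times X_k$, then $\partial_t^\alpha\psi(t,x)+H(t,x(t),\nabla^\alpha\psi(t,x))\le0$.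 (V$_-$) For every $ci$-smooth of order $\alpha$ functional $\psi$ and every $k\ge1$, if $\varphi-\psi$ attains its maximum on $[0,T]\times X_k$ at a point $(t,x)\in[0,T)\times X_k$, then $\partial_t^\alpha\psi(t,x)+H(t,x(t),\nabla^\alpha\psi(t,x))\ge0$. **Theorem (uniqueness of viscosity solutions).** Suppose that (j) $H$ is continuous; (jj) $|H(t,x,s)-H(t,x,r)|\le c_*(1+\|x\|)\,\|s-r\|$ for all $t\in[0,T]$ and $x,s,r\in\mathbb R^n$. Then the Cauchy problem has at most one viscosity solution. -/

import Mathlib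

open Set Filter Topology MeasureTheory Asymptotics

noncomputable section

namespace FracHJ

/-- `ℝⁿ` with the Euclidean norm and inner product. -/
abbrev Euc (n : ℕ) : Type := EuclideanSpace ℝ (Fin n)

/-- The Riemann--Liouville fractional integral of order `α`,
`(1 / Γ(α)) ∫₀^τ f(ξ) / (τ - ξ)^(1 - α) dξ`. -/
def rlIntegral {n : ℕ} (α : ℝ) (f : ℝ → Euc n) (τ : ℝ) : Euc n :=
  (Real.Gamma α)⁻¹ • ∫ ξ in (0 : ℝ)..τ, ((τ - ξ) ^ (1 - α))⁻¹ • f ξ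

/-- The space `AC^α` of all paths `x : [0, T] → ℝⁿ` representable as
`x(τ) = x(0) + (I^α f)(τ)` for some Lebesgue measurable, essentially bounded `f` on `[0, T]`.
Such paths are continuous, and the space carries the uniform metric inherited from
`C([0, T], ℝⁿ)`. -/
abbrev ACPath (n : ℕ) (T : ℝ) [hT : Fact (0 < T)] (α : ℝ) : Type :=
  {x : C(Icc (0 : ℝ) T, Euc n) //
    ∃ f : ℝ → Euc n, MemLp f ⊤ (volume.restrict (Icc (0 : ℝ) T)) ∧
      ∀ τ : Icc (0 : ℝ) T, x τ = x ⟨0, left_mem_Icc.2 hT.out.le⟩ + rlIntegral α f τ}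

variable {n : ℕ} {T : ℝ} [hT : Fact (0 < T)] {α : ℝ}

/-- The value `x(τ)` of a path. It is used only for `τ ∈ [0, T]`; outside this interval the path
is continued by its values at the end points. -/
def pathAt (x : ACPath n T α) (τ : ℝ) : Euc n :=
  IccExtend hT.out.le x.1 τ

/-- The Caputo derivative of order `α`,
`(1 / Γ(1 - α)) d/dτ ∫₀^τ (x(ξ) - x(0)) / (τ - ξ)^α dξ`.
For a path in `AC^α` the derivative exists at almost every `τ ∈ [0, T]`. -/
def caputo (x : ACPath n T α) (τ : ℝ) : Euc n :=
  (Real.Gamma (1 - α))⁻¹ •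
    deriv (fun s : ℝ => ∫ ξ in (0 : ℝ)..s,
      ((s - ξ) ^ α)⁻¹ • (pathAt x ξ - pathAt x 0)) τ

/-- `Y(t, x)`: the paths that coincide with `x` on `[0, t]`. -/
def continuations (t : Icc (0 : ℝ) T) (x : ACPath n T α) : Set (ACPath n T α) :=
  {y | ∀ τ ∈ Icc (0 : ℝ) t, pathAt y τ = pathAt x τ}

/-- `a` and `p` are the ci-derivatives `∂_t^α φ(t, x)` and `∇^α φ(t, x)` of order `α` of the
functional `φ` at `(t, x)`: along every continuation `y` of `x` after time `t`,
`φ(τ, y) - φ(t, x) = a (τ - t) + ∫_t^τ ⟨p, (D^α y)(ξ)⟩ dξ + o(τ - t)` as `τ → t⁺`. -/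
def HasCiDerivAt (φ : Icc (0 : ℝ) T × ACPath n T α → ℝ)
    (t : Icc (0 : ℝ) T) (x : ACPath n T α) (a : ℝ) (p : Euc n) : Prop :=
  ∀ y ∈ continuations t x,
    (fun τ : Icc (0 : ℝ) T =>
        φ (τ, y) - φ (t, x) - a * ((τ : ℝ) - t)
          - ∫ ξ in (t : ℝ)..τ, inner ℝ p (caputo y ξ))
      =o[𝓝[>] t] (fun τ : Icc (0 : ℝ) T => (τ : ℝ) - t)

/-- `φ` is ci-smooth of order `α`: it is continuous, ci-differentiable at every point of
`[0, T) × AC^α`, and its ci-derivatives are continuous there. -/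
def IsCiSmooth (φ : Icc (0 : ℝ) T × ACPath n T α → ℝ) : Prop :=
  Continuous φ ∧
  ∃ (dt : Icc (0 : ℝ) T × ACPath n T α → ℝ) (grad : Icc (0 : ℝ) T × ACPath n T α → Euc n),
    (∀ (t : Icc (0 : ℝ) T) (x : ACPath n T α), (t : ℝ) < T →
      HasCiDerivAt φ t x (dt (t, x)) (grad (t, x))) ∧
    ContinuousOn dt {z | (z.1 : ℝ) < T} ∧
    ContinuousOn grad {z | (z.1 : ℝ) < T}

/-- The function `a(τ | t, x)`: the continuation of `x` after time `t` whose Caputo derivative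
vanishes on `[t, T]`. -/
def freeContinuation (t : Icc (0 : ℝ) T) (x : ACPath n T α) (τ : ℝ) : Euc n :=
  if τ ≤ t then pathAt x τ
  else pathAt x 0 +
    (Real.Gamma α)⁻¹ • ∫ ξ in (0 : ℝ)..(t : ℝ), ((τ - ξ) ^ (1 - α))⁻¹ • caputo x ξ

/-- The local Lipschitz condition (L) in the path variable. -/
def ConditionL (φ : Icc (0 : ℝ) T × ACPath n T α → ℝ) : Prop :=
  ∀ X : Set (ACPath n T α), IsCompact X → ∃ Λ : ℝ, 0 < Λ ∧
    ∀ t : Icc (0 : ℝ) T, ∀ x ∈ X, ∀ y ∈ X,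
      |φ (t, x) - φ (t, y)| ≤
        Λ * (‖freeContinuation t x T - freeContinuation t y T‖ +
          ∫ τ in (0 : ℝ)..T,
            ‖freeContinuation t x τ - freeContinuation t y τ‖ / (T - τ) ^ (1 - α))

/-- The set `X_k` of paths with `‖x(0)‖ ≤ k` and `‖(D^α x)(τ)‖ ≤ k c (1 + ‖x(τ)‖)` for almost
every `τ ∈ [0, T]`. -/
def boundedPaths (c : ℝ) (k : ℕ) : Set (ACPath n T α) :=
  {x | ‖pathAt x 0‖ ≤ k ∧
    ∀ᵐ τ ∂(volume.restrict (Icc (0 : ℝ) T)),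
      ‖caputo x τ‖ ≤ k * c * (1 + ‖pathAt x τ‖)}

/-- Viscosity solutions of the Cauchy problem
`∂_t^α φ(t, x) + H(t, x(t), ∇^α φ(t, x)) = 0` on `[0, T) × AC^α`, `φ(T, x) = σ(x)`,
where `c` is the constant in the sets `X_k`, `k = 1, 2, …`. The ci-derivatives of a test
functional at a point `(t, x)` with `t < T` are unique, so quantifying over all pairs `(a, p)` with
`HasCiDerivAt ψ t x a p` refers to that single pair. -/
structure IsViscositySolution (c : ℝ) (H : Icc (0 : ℝ) T → Euc n → Euc n → ℝ)
    (σ : ACPath n T α → ℝ) (φ : Icc (0 : ℝ) T × ACPath n T α → ℝ) : Prop where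
  continuous : Continuous φ
  lipschitz : ConditionL φ
  boundary : ∀ x : ACPath n T α, φ (⟨T, right_mem_Icc.2 hT.out.le⟩, x) = σ x
  super : ∀ ψ : Icc (0 : ℝ) T × ACPath n T α → ℝ, IsCiSmooth ψ → ∀ k : ℕ, 1 ≤ k →
    ∀ (t : Icc (0 : ℝ) T) (x : ACPath n T α), (t : ℝ) < T → x ∈ boundedPaths c k →
      IsMinOn (fun z => φ z - ψ z) (univ ×ˢ boundedPaths c k) (t, x) →
      ∀ (a : ℝ) (p : Euc n), HasCiDerivAt ψ t x a p → a + H t (pathAt x t) p ≤ 0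
  sub : ∀ ψ : Icc (0 : ℝ) T × ACPath n T α → ℝ, IsCiSmooth ψ → ∀ k : ℕ, 1 ≤ k →
    ∀ (t : Icc (0 : ℝ) T) (x : ACPath n T α), (t : ℝ) < T → x ∈ boundedPaths c k →
      IsMaxOn (fun z => φ z - ψ z) (univ ×ˢ boundedPaths c k) (t, x) →
      ∀ (a : ℝ) (p : Euc n), HasCiDerivAt ψ t x a p → 0 ≤ a + H t (pathAt x t) p

end FracHJ

end

namespace FracHJ

/-! Variables are doubled through the free continuations `a(· | t, x)` rather than through the paths
themselves. Let `μ = δ_T + (T - τ)^(α - 1) dτ` on `(0, T]` (`weightMeasure`). The right-hand side of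
(L) is `Λ` times the `L¹(μ)` distance `N` of two free continuations. Its smoothing `V_ε = ∫ √(ε² +
‖a(τ | t, x) - a(τ | s, y)‖²) dμ(τ)` is therefore a penalty adapted to (L). With one argument frozen
it is also a ci-smooth test functional (`hasCiDerivAt_potential`): its time derivative is 0, because
the free continuation does not move while the Caputo derivative vanishes, and its ci-gradient
`Γ(α)⁻¹ ∫ (τ - t)_+^(α - 1) v(τ) / √(ε² + ‖v(τ)‖²) dμ(τ)`, where `v` is the difference of the
continuations, is bounded independently of `ε`.

Suppose `φ₁ - φ₂ = θ > 0` somewhere; the path lies in some `X_k`. Maximise `φ₁(t, x) - φ₂(s, y) - M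
V_ε - (t - s)²/ε + η (t + s)` over `([0, T] × X_k)²` with `η = θ/(4T)` and the fixed constant `M = Λ
+ 1`, and let `ε → 0`. The penalty is exact: in the limit `t = s` and `M N ≤ Λ N`, so `N = 0` and
both limit paths have the same value at `t`. The boundary condition excludes `t = T`. The viscosity
inequalities give `2η ≤ H(…) - H(…)`. The two gradients stay in a fixed ball and differ only through
the time in the kernel, so their difference tends to 0 by continuity of the kernel in `L¹(μ)`;
continuity of `H` then yields `2η ≤ 0`, a contradiction.

Two facts support this. The sets `X_k` are compact (`isCompact_boundedPaths`): a fractional Grönwall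
estimate gives equicontinuity, and an integrated form of the bound on the Caputo derivative, stable
under uniform limits, gives closedness (`exists_path_of_caputoBound`). The map `(t, x) ↦ a(· | t,
x)` is continuous in the sup norm (`continuous_freePath`), although the uniform metric does not
control the Caputo derivative: a Poisson type formula expresses `a` after time `t` through the
values of `x` on `[0, t]`, with a positive kernel of mass at most 1. -/

/-- The singular kernel `r ↦ r^(α - 1)` of fractional integration, extended by zero to `r ≤ 0`. -/
noncomputable def fracKernel (α r : ℝ) : ℝ := if 0 < r then r ^ (α - 1) else 0

/-! ### The singular kernel: integrals and moduli of continuity. -/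

section Kernel

variable {α β : ℝ}

lemma fracKernel_of_pos {r : ℝ} (hr : 0 < r) : fracKernel α r = r ^ (α - 1) := if_pos hr

lemma fracKernel_of_nonpos {r : ℝ} (hr : r ≤ 0) : fracKernel α r = 0 := if_neg hr.not_gt

lemma fracKernel_nonneg (α r : ℝ) : 0 ≤ fracKernel α r := by
  unfold fracKernel
  split_ifs with h
  · exact Real.rpow_nonneg h.le _
  · exact le_rfl

@[fun_prop]
lemma measurable_fracKernel (α : ℝ) : Measurable (fracKernel α) :=
  Measurable.ite measurableSet_Ioi (by fun_prop) measurable_const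

lemma inv_rpow_eq_fracKernel (hα : α < 1) {r : ℝ} (hr : 0 ≤ r) :
    (r ^ (1 - α))⁻¹ = fracKernel α r := by
  rcases hr.eq_or_lt with rfl | h
  · rw [Real.zero_rpow (by linarith), inv_zero, fracKernel_of_nonpos le_rfl]
  · rw [fracKernel_of_pos h, ← Real.rpow_neg h.le, neg_sub]

lemma fracKernel_mul {c : ℝ} (hc : 0 < c) (r : ℝ) :
    fracKernel α (c * r) = c ^ (α - 1) * fracKernel α r := by
  rcases lt_or_ge 0 r with h | h
  · rw [fracKernel_of_pos h, fracKernel_of_pos (mul_pos hc h), Real.mul_rpow hc.le h.le]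
  · rw [fracKernel_of_nonpos h, fracKernel_of_nonpos (mul_nonpos_of_nonneg_of_nonpos hc.le h),
      mul_zero]

lemma fracKernel_le_of_le (hα : α ≤ 1) {r s : ℝ} (hr : 0 < r) (h : r ≤ s) :
    fracKernel α s ≤ fracKernel α r := by
  rw [fracKernel_of_pos hr, fracKernel_of_pos (hr.trans_le h)]
  exact Real.rpow_le_rpow_of_nonpos hr h (by linarith)

lemma intervalIntegrable_fracKernel (hα : 0 < α) (a b : ℝ) :
    IntervalIntegrable (fracKernel α) volume a b := by
  have h := intervalIntegral.intervalIntegrable_rpow' (a := a) (b := b)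
    (show -1 < α - 1 by linarith)
  rw [intervalIntegrable_iff] at h ⊢
  exact h.indicator measurableSet_Ioi

lemma integral_fracKernel (hα : 0 < α) (a b : ℝ) :
    ∫ r in a..b, fracKernel α r = max b 0 ^ α / α - max a 0 ^ α / α := by
  have key (q : ℝ) : ∫ r in (0 : ℝ)..q, fracKernel α r = max q 0 ^ α / α := by
    rcases le_total 0 q with hq | hq
    · rw [max_eq_left hq]
      have : ∫ r in (0 : ℝ)..q, fracKernel α r = ∫ r in (0 : ℝ)..q, r ^ (α - 1) := by
        refine intervalIntegral.integral_congr_ae (Eventually.of_forall fun r hr => ?_)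
        rw [uIoc_of_le hq] at hr
        exact fracKernel_of_pos hr.1
      rw [this, integral_rpow (Or.inl (by linarith)), sub_add_cancel, Real.zero_rpow hα.ne',
        sub_zero]
    · rw [max_eq_right hq, Real.zero_rpow hα.ne', zero_div]
      refine intervalIntegral.integral_zero_ae (Eventually.of_forall fun r hr => ?_)
      rw [uIoc_of_ge hq] at hr
      exact fracKernel_of_nonpos hr.2
  rw [← key, ← key, intervalIntegral.integral_interval_sub_left] <;>
    exact intervalIntegrable_fracKernel hα _ _

/-- Subadditivity of `r ↦ r ^ α` for `α ≤ 1`. It makes the integral of the kernel over an interval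
at most a constant times the power `α` of the length, wherever the singularity lies. -/
lemma max_rpow_sub_max_rpow_le (hα : 0 < α) (hα₁ : α ≤ 1) {u v : ℝ} (h : u ≤ v) :
    max v 0 ^ α / α - max u 0 ^ α / α ≤ (v - u) ^ α / α := by
  rw [← sub_div]
  gcongr
  have h1 : max v 0 ≤ max u 0 + (v - u) := by
    rcases le_total 0 v with hv | hv
    · rw [max_eq_left hv]; linarith [le_max_left u 0]
    · rw [max_eq_right hv]; linarith [le_max_right u 0]
  have h2 := Real.rpow_le_rpow (le_max_right v 0) h1 hα.le
  have h3 := Real.rpow_add_le_add_rpow (le_max_right u 0) (sub_nonneg.2 h) hα.le hα₁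
  linarith

lemma integrableOn_fracKernel_sub (hα : 0 < α) (τ a b : ℝ) :
    IntegrableOn (fun ξ => fracKernel α (τ - ξ)) (Ioc a b) := by
  have h := (intervalIntegrable_fracKernel hα (τ - a) (τ - b)).comp_sub_left τ
  simp only [sub_sub_cancel] at h
  exact h.1

lemma setIntegral_fracKernel_sub (hα : 0 < α) (τ : ℝ) {a b : ℝ} (hab : a ≤ b) :
    ∫ ξ in Ioc a b, fracKernel α (τ - ξ) =
      max (τ - a) 0 ^ α / α - max (τ - b) 0 ^ α / α := by
  rw [← intervalIntegral.integral_of_le hab,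
    intervalIntegral.integral_comp_sub_left (fun r => fracKernel α r), integral_fracKernel hα]

lemma setIntegral_fracKernel_sub_le (hα : 0 < α) (hα₁ : α ≤ 1) (τ : ℝ) {a b : ℝ} (hab : a ≤ b) :
    ∫ ξ in Ioc a b, fracKernel α (τ - ξ) ≤ (b - a) ^ α / α := by
  rw [setIntegral_fracKernel_sub hα τ hab]
  refine (max_rpow_sub_max_rpow_le hα hα₁ (by linarith)).trans_eq ?_
  rw [sub_sub_sub_cancel_left]

lemma setIntegral_abs_fracKernel_sub_le (hα : 0 < α) (hα₁ : α ≤ 1) (τ τ' : ℝ) {a b : ℝ}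
    (hab : a ≤ b) :
    ∫ ξ in Ioc a b, |fracKernel α (τ - ξ) - fracKernel α (τ' - ξ)| ≤ 3 * (|τ - τ'| ^ α / α) := by
  wlog h : τ ≤ τ' generalizing τ τ'
  · rw [abs_sub_comm τ]
    simp_rw [abs_sub_comm (fracKernel α (τ - _))]
    exact this τ' τ (le_of_not_ge h)
  have hi := integrableOn_fracKernel_sub hα τ a b
  have hi' := integrableOn_fracKernel_sub hα τ' a b
  have hind : IntegrableOn ((Icc τ τ').indicator fun ξ => fracKernel α (τ' - ξ)) (Ioc a b) :=
    IntegrableOn.indicator hi' measurableSet_Icc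
  have hsub : IntegrableOn (fun ξ => fracKernel α (τ - ξ) - fracKernel α (τ' - ξ)) (Ioc a b) :=
    hi.sub hi'
  -- The kernel decreases on positive arguments, so the difference is negative at most on `[τ, τ']`.
  -- There adding twice the second kernel restores the absolute value. The difference and the
  -- correction contribute one and two copies of `|τ - τ'| ^ α / α`.
  have h1 : ∫ ξ in Ioc a b, |fracKernel α (τ - ξ) - fracKernel α (τ' - ξ)| ≤
      ∫ ξ in Ioc a b, ((fracKernel α (τ - ξ) - fracKernel α (τ' - ξ)) +
        2 * (Icc τ τ').indicator (fun ξ => fracKernel α (τ' - ξ)) ξ) := by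
    refine integral_mono hsub.abs (hsub.add (hind.const_mul 2)) fun ξ => ?_
    dsimp only
    by_cases hξ : ξ ∈ Icc τ τ'
    · rw [indicator_of_mem hξ, fracKernel_of_nonpos (r := τ - ξ) (by linarith [hξ.1]), zero_sub,
        abs_neg, abs_of_nonneg (fracKernel_nonneg _ _)]
      linarith
    · rw [indicator_of_notMem hξ, mul_zero, add_zero, abs_of_nonneg]
      rcases lt_or_ge ξ τ with h2 | h2
      · exact sub_nonneg.2 (fracKernel_le_of_le hα₁ (by linarith) (by linarith))
      · have : τ' < ξ := not_le.1 fun h3 => hξ ⟨h2, h3⟩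
        rw [fracKernel_of_nonpos (by linarith), fracKernel_of_nonpos (by linarith), sub_zero]
  have h2 : ∫ ξ in Ioc a b, (Icc τ τ').indicator (fun ξ => fracKernel α (τ' - ξ)) ξ ≤
      (τ' - τ) ^ α / α := by
    rw [setIntegral_indicator measurableSet_Icc]
    refine le_trans ?_ (setIntegral_fracKernel_sub_le hα hα₁ τ' h)
    rw [← integral_Icc_eq_integral_Ioc]
    exact setIntegral_mono_set
      ((integrableOn_Icc_iff_integrableOn_Ioc).2 (integrableOn_fracKernel_sub hα τ' τ τ'))
      (Eventually.of_forall fun ξ => fracKernel_nonneg _ _)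
      (LE.le.eventuallyLE inter_subset_right)
  rw [integral_add hsub (hind.const_mul 2), integral_sub hi hi', integral_const_mul,
    setIntegral_fracKernel_sub hα τ hab, setIntegral_fracKernel_sub hα τ' hab] at h1
  have h3 := max_rpow_sub_max_rpow_le hα hα₁ (show τ - b ≤ τ' - b by linarith)
  have h4 : max (τ - a) 0 ^ α / α ≤ max (τ' - a) 0 ^ α / α := by gcongr
  rw [sub_sub_sub_cancel_right] at h3
  rw [abs_sub_comm, abs_of_nonneg (sub_nonneg.2 h)]
  linarith

/-! ### Beta integrals. -/

section Beta

open ProbabilityTheory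

/-- The product is the unnormalised density of the beta distribution, so integrability and the value
of the integral follow from that density having total mass 1. -/
lemma fracKernel_mul_fracKernel_one_sub {u v : ℝ} (hu : 0 < u) (hv : 0 < v) (x : ℝ) :
    fracKernel u x * fracKernel v (1 - x) = beta u v * betaPDFReal u v x := by
  unfold betaPDFReal
  split_ifs with h
  · rw [fracKernel_of_pos h.1, fracKernel_of_pos (sub_pos.2 h.2)]
    field_simp [(beta_pos hu hv).ne']
  · rcases le_or_gt x 0 with hx | hx
    · rw [fracKernel_of_nonpos hx, zero_mul, mul_zero]
    · rw [fracKernel_of_nonpos (r := 1 - x) (by linarith [not_lt.1 fun h1 => h ⟨hx, h1⟩]),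
        mul_zero, mul_zero]

lemma betaPDFReal_nonneg {u v : ℝ} (hu : 0 < u) (hv : 0 < v) (x : ℝ) : 0 ≤ betaPDFReal u v x := by
  by_cases h : 0 < x ∧ x < 1
  · exact (betaPDFReal_pos h.1 h.2 hu hv).le
  · exact (if_neg h).ge

lemma integrable_betaPDFReal {u v : ℝ} (hu : 0 < u) (hv : 0 < v) :
    Integrable (betaPDFReal u v) := by
  refine ⟨(measurable_betaPDFReal u v).aestronglyMeasurable, ?_⟩
  rw [hasFiniteIntegral_iff_ofReal (Eventually.of_forall (betaPDFReal_nonneg hu hv))]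
  exact (lintegral_betaPDF_eq_one hu hv).trans_lt ENNReal.one_lt_top

lemma integral_betaPDFReal {u v : ℝ} (hu : 0 < u) (hv : 0 < v) :
    ∫ x, betaPDFReal u v x = 1 := by
  rw [integral_eq_lintegral_of_nonneg_ae (Eventually.of_forall (betaPDFReal_nonneg hu hv))
    (measurable_betaPDFReal u v).aestronglyMeasurable]
  exact congrArg ENNReal.toReal (lintegral_betaPDF_eq_one hu hv)

lemma integrable_fracKernel_unit {u v : ℝ} (hu : 0 < u) (hv : 0 < v) :
    Integrable fun x => fracKernel u x * fracKernel v (1 - x) := by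
  simp_rw [fracKernel_mul_fracKernel_one_sub hu hv]
  exact (integrable_betaPDFReal hu hv).const_mul _

lemma integral_fracKernel_unit {u v : ℝ} (hu : 0 < u) (hv : 0 < v) :
    ∫ x, fracKernel u x * fracKernel v (1 - x) = beta u v := by
  simp_rw [fracKernel_mul_fracKernel_one_sub hu hv]
  rw [integral_const_mul, integral_betaPDFReal hu hv, mul_one]

lemma fracKernel_mul_fracKernel_scaled {u v a b : ℝ} (hab : a < b) (x : ℝ) :
    fracKernel u (a + (b - a) * x - a) * fracKernel v (b - (a + (b - a) * x)) =
      (b - a) ^ (u + v - 2) * (fracKernel u x * fracKernel v (1 - x)) := by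
  have hc : 0 < b - a := sub_pos.2 hab
  rw [show a + (b - a) * x - a = (b - a) * x by ring,
    show b - (a + (b - a) * x) = (b - a) * (1 - x) by ring, fracKernel_mul hc, fracKernel_mul hc,
    show u + v - 2 = (u - 1) + (v - 1) by ring, Real.rpow_add hc]
  ring

lemma integrable_fracKernel_mul_fracKernel {u v : ℝ} (hu : 0 < u) (hv : 0 < v) {a b : ℝ}
    (hab : a < b) : Integrable fun ξ => fracKernel u (ξ - a) * fracKernel v (b - ξ) := by
  have hc : b - a ≠ 0 := (sub_pos.2 hab).ne'
  have h := (integrable_fracKernel_unit hu hv).const_mul ((b - a) ^ (u + v - 2))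
  simp_rw [← fracKernel_mul_fracKernel_scaled hab] at h
  rw [integrable_comp_mul_left_iff
    (fun y => fracKernel u (a + y - a) * fracKernel v (b - (a + y))) hc] at h
  have h2 := h.comp_add_left (-a)
  simpa using h2

lemma integral_fracKernel_mul_fracKernel {u v : ℝ} (hu : 0 < u) (hv : 0 < v) {a b : ℝ}
    (hab : a < b) :
    ∫ ξ, fracKernel u (ξ - a) * fracKernel v (b - ξ) = (b - a) ^ (u + v - 1) * beta u v := by
  have hc : 0 < b - a := sub_pos.2 hab
  have h := integral_fracKernel_unit hu hv
  have h2 : ∫ x, (b - a) ^ (u + v - 2) * (fracKernel u x * fracKernel v (1 - x)) =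
      (b - a) ^ (u + v - 2) * beta u v := by rw [integral_const_mul, h]
  simp_rw [← fracKernel_mul_fracKernel_scaled hab] at h2
  rw [Measure.integral_comp_mul_left
    (fun y => fracKernel u (a + y - a) * fracKernel v (b - (a + y))),
    integral_add_left_eq_self (fun y => fracKernel u (y - a) * fracKernel v (b - y)),
    abs_of_pos (inv_pos.2 hc), smul_eq_mul, inv_mul_eq_iff_eq_mul₀ hc.ne'] at h2
  rw [h2, ← mul_assoc, show u + v - 1 = 1 + (u + v - 2) by ring, Real.rpow_add hc, Real.rpow_one]

end Beta

end Kernel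
-- The Poisson type kernel of free continuation.
section Poisson

open ProbabilityTheory

variable {α : ℝ}

/-- Pointwise algebra for the substitution `v = (ξ - η)(τ - t) / ((t - η)(τ - ξ))`, with `A = ξ -
η`, `B = t - ξ`, `C = τ - ξ`, `h = τ - t`, `L = t - η`, `R = τ - η`. The factor `h R / (L C²)` is
`dv/dξ`. -/
lemma poisson_substitution_aux {A B C h L R : ℝ} (hA : 0 < A) (hB : 0 < B) (hC : 0 < C)
    (hh : 0 < h) (hL : 0 < L) (hR : 0 < R) (hrel : L * C - A * h = B * R) :
    h * R / (L * C ^ 2) * (fracKernel α (A * h / (L * C)) * fracKernel (1 - α) (1 - A * h / (L * C)))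
      = h ^ α * R ^ (1 - α) * (fracKernel α A * fracKernel (1 - α) B * C⁻¹) := by
  have h1 : 1 - A * h / (L * C) = B * R / (L * C) := by
    rw [← hrel]; field_simp
  rw [h1, fracKernel_of_pos (by positivity), fracKernel_of_pos (by positivity),
    fracKernel_of_pos hA, fracKernel_of_pos hB, show 1 - α - 1 = -α by ring,
    Real.div_rpow (by positivity) (by positivity), Real.div_rpow (by positivity) (by positivity),
    Real.mul_rpow hA.le hh.le, Real.mul_rpow hB.le hR.le]
  have hLC : 0 < L * C := by positivity
  rw [Real.rpow_sub_one hLC.ne', Real.rpow_sub_one hh.ne', Real.rpow_sub_one hA.ne',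
    Real.rpow_neg hLC.le, Real.rpow_neg hR.le, Real.rpow_neg hB.le, Real.rpow_sub hR,
    Real.rpow_one]
  have := Real.rpow_pos_of_pos hLC α
  have := Real.rpow_pos_of_pos hh α
  have := Real.rpow_pos_of_pos hR α
  have := Real.rpow_pos_of_pos hA α
  have := Real.rpow_pos_of_pos hB α
  field_simp

/-- The kernel of the operator that continues a path after time `t` with zero Caputo derivative. -/
noncomputable def poissonKernel (α t τ ξ : ℝ) : ℝ :=
  (τ - t) ^ α * (fracKernel (1 - α) (t - ξ) * (τ - ξ)⁻¹)

lemma measurable_poissonKernel (α t τ : ℝ) : Measurable (poissonKernel α t τ) := by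
  unfold poissonKernel
  fun_prop

lemma poissonKernel_nonneg {t τ : ℝ} (h : t < τ) (ξ : ℝ) : 0 ≤ poissonKernel α t τ ξ := by
  unfold poissonKernel
  rcases lt_or_ge ξ t with hξ | hξ
  · have := fracKernel_nonneg (1 - α) (t - ξ)
    have : 0 ≤ (τ - t) ^ α := Real.rpow_nonneg (by linarith) _
    have : 0 ≤ (τ - ξ)⁻¹ := inv_nonneg.2 (by linarith)
    positivity
  · rw [fracKernel_of_nonpos (by linarith), zero_mul, mul_zero]

lemma integrableOn_poissonKernel (hα₁ : α < 1) {t τ : ℝ} (h : t < τ) (a b : ℝ) :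
    IntegrableOn (poissonKernel α t τ) (Ioc a b) := by
  refine Integrable.mono' ((integrableOn_fracKernel_sub (α := 1 - α) (by linarith) t a b).const_mul
    ((τ - t) ^ α * (τ - t)⁻¹)) (measurable_poissonKernel α t τ).aestronglyMeasurable
    (Eventually.of_forall fun ξ => ?_)
  rw [Real.norm_of_nonneg (poissonKernel_nonneg h ξ), poissonKernel]
  rcases lt_or_ge ξ t with hξ | hξ
  · have h1 := fracKernel_nonneg (1 - α) (t - ξ)
    have h2 : 0 ≤ (τ - t) ^ α := Real.rpow_nonneg (by linarith) _
    have h3 : (τ - ξ)⁻¹ ≤ (τ - t)⁻¹ := inv_anti₀ (by linarith) (by linarith)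
    calc _ ≤ (τ - t) ^ α * (fracKernel (1 - α) (t - ξ) * (τ - t)⁻¹) := by gcongr
      _ = _ := by ring
  · rw [fracKernel_of_nonpos (by linarith), zero_mul, mul_zero, mul_zero]

lemma poisson_image {η t τ : ℝ} (h1 : η < t) (h2 : t < τ) :
    (fun ξ => (ξ - η) * (τ - t) / ((t - η) * (τ - ξ))) '' Ioo η t = Ioo 0 1 := by
  have hh : 0 < τ - t := sub_pos.2 h2
  have hL : 0 < t - η := sub_pos.2 h1
  ext v
  constructor
  · rintro ⟨ξ, ⟨hξ1, hξ2⟩, rfl⟩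
    have hA : 0 < ξ - η := sub_pos.2 hξ1
    have hC : 0 < τ - ξ := by linarith
    refine ⟨by positivity, ?_⟩
    rw [div_lt_one (by positivity)]
    nlinarith [mul_pos (sub_pos.2 hξ2) (show 0 < τ - η by linarith)]
  · rintro ⟨hv0, hv1⟩
    have hD : 0 < (τ - t) + v * (t - η) := by positivity
    -- The fractional linear equation for `v`, solved for `ξ`.
    refine ⟨(v * (t - η) * τ + (τ - t) * η) / ((τ - t) + v * (t - η)), ⟨?_, ?_⟩, ?_⟩
    · rw [lt_div_iff₀ hD]
      nlinarith [mul_pos (mul_pos hv0 hL) (show 0 < τ - η by linarith)]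
    · rw [div_lt_iff₀ hD]
      nlinarith [mul_pos (mul_pos (sub_pos.2 hv1) hL) hh]
    · have hR : 0 < τ - η := by linarith
      have e1 : (v * (t - η) * τ + (τ - t) * η) / ((τ - t) + v * (t - η)) - η =
          v * (t - η) * (τ - η) / ((τ - t) + v * (t - η)) := by field_simp; ring
      have e2 : τ - (v * (t - η) * τ + (τ - t) * η) / ((τ - t) + v * (t - η)) =
          (τ - t) * (τ - η) / ((τ - t) + v * (t - η)) := by field_simp; ring
      change _ * (τ - t) / ((t - η) * _) = v
      rw [e1, e2]
      field_simp

lemma poisson_injOn {η t τ : ℝ} (h1 : η < t) (h2 : t < τ) :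
    InjOn (fun ξ => (ξ - η) * (τ - t) / ((t - η) * (τ - ξ))) (Ioo η t) := by
  intro x hx y hy hxy
  have hh : 0 < τ - t := sub_pos.2 h2
  have hL : 0 < t - η := sub_pos.2 h1
  have hx' : 0 < τ - x := by linarith [hx.2]
  have hy' : 0 < τ - y := by linarith [hy.2]
  simp only at hxy
  rw [div_eq_div_iff (by positivity) (by positivity)] at hxy
  have h3 : (τ - t) * (t - η) * (τ - η) * (x - y) = 0 := by linarith
  have hR : 0 < τ - η := by linarith
  rcases mul_eq_zero.1 h3 with h4 | h4
  · exact absurd h4 (by positivity)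
  · linarith

/-- A fractional linear substitution carries `(η, t)` onto `(0, 1)` and the integrand to a Beta
integrand. Thus, up to the factor `B(α, 1 - α)`, the kernel continues each elementary profile `(· -
η)_+^(α - 1)` past `t` from its values before `t`; superposition extends this to all fractional
integrals stopped at `t`. -/
lemma integral_poissonKernel_mul_fracKernel (hα : 0 < α) (hα₁ : α < 1) {η t τ : ℝ} (h1 : η < t)
    (h2 : t < τ) :
    ∫ ξ in Ioo η t, poissonKernel α t τ ξ * fracKernel α (ξ - η) =
      beta α (1 - α) * fracKernel α (τ - η) := by
  have hh : 0 < τ - t := sub_pos.2 h2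
  have hL : 0 < t - η := sub_pos.2 h1
  have hR : 0 < τ - η := by linarith
  have key := integral_image_eq_integral_abs_deriv_smul (s := Ioo η t)
    (f := fun ξ => (ξ - η) * (τ - t) / ((t - η) * (τ - ξ)))
    (f' := fun ξ => (τ - t) * (τ - η) / ((t - η) * (τ - ξ) ^ 2)) measurableSet_Ioo
    (fun ξ hξ => ?_) (poisson_injOn h1 h2)
    (fun v => fracKernel α v * fracKernel (1 - α) (1 - v))
  · rw [poisson_image h1 h2] at key
    have hleft : ∫ v in Ioo (0 : ℝ) 1, fracKernel α v * fracKernel (1 - α) (1 - v) =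
        beta α (1 - α) := by
      rw [← integral_fracKernel_unit hα (sub_pos.2 hα₁)]
      refine setIntegral_eq_integral_of_forall_compl_eq_zero fun x hx => ?_
      rcases le_or_gt x 0 with h | h
      · rw [fracKernel_of_nonpos h, zero_mul]
      · rw [fracKernel_of_nonpos (r := 1 - x)
          (by linarith [not_lt.1 fun h1 => hx ⟨h, h1⟩]), mul_zero]
    have hright : ∫ ξ in Ioo η t, |(τ - t) * (τ - η) / ((t - η) * (τ - ξ) ^ 2)| •
        (fracKernel α ((ξ - η) * (τ - t) / ((t - η) * (τ - ξ))) *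
          fracKernel (1 - α) (1 - (ξ - η) * (τ - t) / ((t - η) * (τ - ξ)))) =
        ∫ ξ in Ioo η t, (τ - η) ^ (1 - α) *
          (poissonKernel α t τ ξ * fracKernel α (ξ - η)) := by
      refine setIntegral_congr_fun measurableSet_Ioo fun ξ hξ => ?_
      have hC : 0 < τ - ξ := by linarith [hξ.2]
      rw [abs_of_pos (by positivity), smul_eq_mul,
        poisson_substitution_aux (sub_pos.2 hξ.1) (sub_pos.2 hξ.2) hC hh hL hR (by ring),
        poissonKernel]
      ring
    rw [hleft, hright, integral_const_mul] at key
    rw [key, fracKernel_of_pos hR, mul_comm _ ((τ - η) ^ (α - 1)), ← mul_assoc,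
      ← Real.rpow_add hR]
    simp
  · have hC : τ - ξ ≠ 0 := by linarith [hξ.2]
    have d1 : HasDerivAt (fun ξ => (ξ - η) * (τ - t)) (1 * (τ - t)) ξ :=
      ((hasDerivAt_id ξ).sub_const η).mul_const _
    have d2 : HasDerivAt (fun ξ => (t - η) * (τ - ξ)) ((t - η) * (-1)) ξ :=
      ((hasDerivAt_id ξ).const_sub τ).const_mul _
    have d := d1.div d2 (mul_ne_zero hL.ne' hC)
    refine (d.congr_deriv ?_).hasDerivWithinAt
    field_simp
    ring

/-- The reproducing identity is tested on the profile with `η = 0`. The profile is decreasing, so it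
is at least its value at `t` on `(0, t)` and at most that value at `τ`. -/
lemma integral_poissonKernel_le (hα : 0 < α) (hα₁ : α < 1) {t τ : ℝ} (h1 : 0 ≤ t) (h2 : t < τ) :
    ∫ ξ in Ioc 0 t, poissonKernel α t τ ξ ≤ beta α (1 - α) := by
  rcases h1.eq_or_lt with rfl | h1
  · simpa using (beta_pos hα (sub_pos.2 hα₁)).le
  have hk : 0 < fracKernel α t := by
    rw [fracKernel_of_pos h1]; exact Real.rpow_pos_of_pos h1 _
  have hb := beta_pos hα (sub_pos.2 hα₁)
  rw [integral_Ioc_eq_integral_Ioo]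
  have h3 := integral_poissonKernel_mul_fracKernel hα hα₁ h1 h2
  have hint : IntegrableOn (fun ξ => poissonKernel α t τ ξ * fracKernel α (ξ - 0)) (Ioo 0 t) := by
    -- A non-integrable function has integral 0 by convention, whereas the value in `h3` is
    -- positive.
    by_contra hne
    rw [integral_undef hne, fracKernel_of_pos (by linarith)] at h3
    have := Real.rpow_pos_of_pos (show 0 < τ - 0 by linarith) (α - 1)
    exact absurd h3 (by positivity)
  have h4 : ∫ ξ in Ioo 0 t, poissonKernel α t τ ξ * fracKernel α t ≤
      ∫ ξ in Ioo 0 t, poissonKernel α t τ ξ * fracKernel α (ξ - 0) := by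
    refine setIntegral_mono_on
      (((integrableOn_poissonKernel hα₁ h2 0 t).mono_set Ioo_subset_Ioc_self).mul_const _) hint
      measurableSet_Ioo fun ξ hξ => ?_
    exact mul_le_mul_of_nonneg_left (fracKernel_le_of_le hα₁.le (by linarith [hξ.1])
      (by linarith [hξ.2])) (poissonKernel_nonneg h2 ξ)
  rw [h3, integral_mul_const] at h4
  refine le_of_mul_le_mul_right (h4.trans ?_) hk
  exact mul_le_mul_of_nonneg_left (fracKernel_le_of_le hα₁.le h1 (by linarith)) hb.le

end Poisson

/-! ### Exchanging integrals against the singular kernel. -/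

section Fubini

variable {α : ℝ} {E : Type*} [NormedAddCommGroup E]

/-- The inner integral of the kernel is bounded uniformly in `τ`, so integrability of `p` is enough.
Every use of Fubini with the kernel rests on this. -/
lemma integrable_prod_fracKernel (hα : 0 < α) (hα₁ : α ≤ 1) {ν : Measure ℝ} [SFinite ν]
    {p : ℝ → ℝ} (hp : Integrable p ν) {a b : ℝ} (hab : a ≤ b) :
    Integrable (fun z : ℝ × ℝ => p z.1 * fracKernel α (z.1 - z.2))
      (ν.prod (volume.restrict (Ioc a b))) := by
  have hm : AEStronglyMeasurable (fun z : ℝ × ℝ => p z.1 * fracKernel α (z.1 - z.2))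
      (ν.prod (volume.restrict (Ioc a b))) :=
    hp.aestronglyMeasurable.comp_fst.mul (Measurable.aestronglyMeasurable (by fun_prop))
  rw [integrable_prod_iff hm]
  refine ⟨Eventually.of_forall fun τ => (integrableOn_fracKernel_sub hα τ a b).const_mul (p τ), ?_⟩
  refine (hp.norm.mul_const ((b - a) ^ α / α)).mono' hm.norm.integral_prod_right'
    (Eventually.of_forall fun τ => ?_)
  rw [Real.norm_of_nonneg (by positivity)]
  simp_rw [norm_mul]
  rw [integral_const_mul]
  gcongr
  simp_rw [Real.norm_of_nonneg (fracKernel_nonneg α _)]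
  exact setIntegral_fracKernel_sub_le hα hα₁ τ hab

lemma integrableOn_fracKernel_smul [NormedSpace ℝ E] (hα : 0 < α) {a b K : ℝ} {f : ℝ → E}
    (hf : AEStronglyMeasurable f (volume.restrict (Ioc a b)))
    (hK : ∀ᵐ ξ ∂(volume.restrict (Ioc a b)), ‖f ξ‖ ≤ K) (τ : ℝ) :
    IntegrableOn (fun ξ => fracKernel α (τ - ξ) • f ξ) (Ioc a b) := by
  refine ((integrableOn_fracKernel_sub hα τ a b).mul_const K).mono'
    ((Measurable.aestronglyMeasurable (by fun_prop)).smul hf) ?_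
  filter_upwards [hK] with ξ h
  rw [norm_smul, Real.norm_of_nonneg (fracKernel_nonneg _ _)]
  exact mul_le_mul_of_nonneg_left h (fracKernel_nonneg _ _)

lemma norm_integral_fracKernel_smul_le [NormedSpace ℝ E] (hα : 0 < α) {a b K : ℝ} {f : ℝ → E}
    (hK : ∀ᵐ ξ ∂(volume.restrict (Ioc a b)), ‖f ξ‖ ≤ K) (τ : ℝ) :
    ‖∫ ξ in Ioc a b, fracKernel α (τ - ξ) • f ξ‖ ≤
      (∫ ξ in Ioc a b, fracKernel α (τ - ξ)) * K := by
  rw [← integral_mul_const]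
  refine norm_integral_le_of_norm_le ((integrableOn_fracKernel_sub hα τ a b).mul_const K) ?_
  filter_upwards [hK] with ξ h
  rw [norm_smul, Real.norm_of_nonneg (fracKernel_nonneg _ _)]
  exact mul_le_mul_of_nonneg_left h (fracKernel_nonneg _ _)

lemma integral_smul_integral_fracKernel_smul [NormedSpace ℝ E] [CompleteSpace E] (hα : 0 < α)
    (hα₁ : α ≤ 1)
    {ν : Measure ℝ} [SFinite ν] {p : ℝ → ℝ} (hp : Integrable p ν) {a b K : ℝ} (hab : a ≤ b)
    {f : ℝ → E} (hf : AEStronglyMeasurable f (volume.restrict (Ioc a b)))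
    (hK : ∀ᵐ ξ ∂(volume.restrict (Ioc a b)), ‖f ξ‖ ≤ K) :
    ∫ τ, p τ • (∫ ξ in Ioc a b, fracKernel α (τ - ξ) • f ξ) ∂ν =
      ∫ ξ in Ioc a b, (∫ τ, p τ * fracKernel α (τ - ξ) ∂ν) • f ξ := by
  have hprod := integrable_prod_fracKernel hα hα₁ hp hab
  have hint : Integrable (fun z : ℝ × ℝ => (p z.1 * fracKernel α (z.1 - z.2)) • f z.2)
      (ν.prod (volume.restrict (Ioc a b))) := by
    refine (hprod.norm.mul_const K).mono' (hprod.aestronglyMeasurable.smul hf.comp_snd) ?_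
    filter_upwards [Measure.quasiMeasurePreserving_snd.ae hK] with z hz
    rw [norm_smul]
    exact mul_le_mul_of_nonneg_left hz (norm_nonneg _)
  simp_rw [← integral_smul, smul_smul, ← integral_smul_const]
  exact integral_integral_swap hint

lemma integral_inner_integral_fracKernel_smul [InnerProductSpace ℝ E] [CompleteSpace E]
    (hα : 0 < α) (hα₁ : α ≤ 1) {ν : Measure ℝ} [SFinite ν] {p : ℝ → E} (hp : Integrable p ν)
    {a b K : ℝ} (hab : a ≤ b) {f : ℝ → E}
    (hf : AEStronglyMeasurable f (volume.restrict (Ioc a b)))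
    (hK : ∀ᵐ ξ ∂(volume.restrict (Ioc a b)), ‖f ξ‖ ≤ K) :
    ∫ τ, inner ℝ (p τ) (∫ ξ in Ioc a b, fracKernel α (τ - ξ) • f ξ) ∂ν =
      ∫ ξ in Ioc a b, inner ℝ (∫ τ, fracKernel α (τ - ξ) • p τ ∂ν) (f ξ) := by
  have hprod := integrable_prod_fracKernel hα hα₁ hp.norm hab
  have hint : Integrable (fun z : ℝ × ℝ => fracKernel α (z.1 - z.2) * inner ℝ (p z.1) (f z.2))
      (ν.prod (volume.restrict (Ioc a b))) := by
    refine (hprod.mul_const K).mono' ((Measurable.aestronglyMeasurable (by fun_prop)).mul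
      (hp.aestronglyMeasurable.comp_fst.inner hf.comp_snd)) ?_
    filter_upwards [Measure.quasiMeasurePreserving_snd.ae hK] with z hz
    have h1 := fracKernel_nonneg α (z.1 - z.2)
    rw [norm_mul, Real.norm_of_nonneg h1]
    calc _ ≤ fracKernel α (z.1 - z.2) * (‖p z.1‖ * ‖f z.2‖) := by
          gcongr; exact norm_inner_le_norm _ _
      _ ≤ fracKernel α (z.1 - z.2) * (‖p z.1‖ * K) := by gcongr
      _ = _ := by ring
  have hvec : Integrable (fun z : ℝ × ℝ => fracKernel α (z.1 - z.2) • p z.1)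
      (ν.prod (volume.restrict (Ioc a b))) := by
    refine hprod.mono' ((Measurable.aestronglyMeasurable (by fun_prop)).smul
      hp.aestronglyMeasurable.comp_fst) (Eventually.of_forall fun z => ?_)
    rw [norm_smul, Real.norm_of_nonneg (fracKernel_nonneg _ _), mul_comm]
  calc _ = ∫ τ, (∫ ξ in Ioc a b, fracKernel α (τ - ξ) * inner ℝ (p τ) (f ξ)) ∂ν := by
        refine integral_congr_ae (Eventually.of_forall fun τ => ?_)
        simp only
        rw [← integral_inner (integrableOn_fracKernel_smul hα hf hK τ)]
        simp_rw [real_inner_smul_right]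
    _ = ∫ ξ in Ioc a b, ∫ τ, fracKernel α (τ - ξ) * inner ℝ (p τ) (f ξ) ∂ν :=
        integral_integral_swap hint
    _ = _ := by
        refine integral_congr_ae ?_
        filter_upwards [hvec.prod_left_ae] with ξ hξ
        rw [real_inner_comm, ← integral_inner hξ]
        simp_rw [real_inner_smul_right, real_inner_comm (f ξ)]

end Fubini
-- Fractional integrals, the semigroup identity and the maximum principle.
section FracInt

open ProbabilityTheory

variable {α : ℝ} {E : Type*} [NormedAddCommGroup E] [NormedSpace ℝ E]

lemma beta_one_sub (α : ℝ) : beta α (1 - α) = Real.Gamma α * Real.Gamma (1 - α) := by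
  simp [beta]

/-- `(1 / Γ(α)) ∫_0^b (τ - ξ)_+^(α - 1) f(ξ) dξ`. For `τ ≤ b` this is the fractional integral of `f`
at `τ`; for `τ > b` the integration stops at time `b`. -/
noncomputable def stoppedFracInt (α b : ℝ) (f : ℝ → E) (τ : ℝ) : E :=
  (Real.Gamma α)⁻¹ • ∫ ξ in Ioc 0 b, fracKernel α (τ - ξ) • f ξ

lemma stoppedFracInt_congr {b : ℝ} {f g : ℝ → E} (h : f =ᵐ[volume.restrict (Ioc 0 b)] g) (τ : ℝ) :
    stoppedFracInt α b f τ = stoppedFracInt α b g τ := by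
  unfold stoppedFracInt
  congr 1
  refine integral_congr_ae ?_
  filter_upwards [h] with ξ hξ
  rw [hξ]

lemma stoppedFracInt_of_nonpos {b τ : ℝ} (f : ℝ → E) (hτ : τ ≤ 0) :
    stoppedFracInt α b f τ = 0 := by
  unfold stoppedFracInt
  rw [setIntegral_eq_zero_of_forall_eq_zero, smul_zero]
  intro ξ hξ
  rw [fracKernel_of_nonpos (by linarith [hξ.1]), zero_smul]

lemma stoppedFracInt_eq_of_le {b b' τ : ℝ} (f : ℝ → E) (hτ : τ ≤ b) (hb : b ≤ b') :
    stoppedFracInt α b' f τ = stoppedFracInt α b f τ := by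
  unfold stoppedFracInt
  congr 1
  refine setIntegral_eq_of_subset_of_forall_sdiff_eq_zero measurableSet_Ioc
    (Ioc_subset_Ioc_right hb) fun ξ hξ => ?_
  have : b < ξ := not_le.1 fun h => hξ.2 ⟨hξ.1.1, h⟩
  rw [fracKernel_of_nonpos (by linarith), zero_smul]

lemma rlIntegral_eq_stoppedFracInt {n : ℕ} (hα₁ : α < 1) (f : ℝ → Euc n) {τ b : ℝ} (h0 : 0 ≤ τ)
    (hb : τ ≤ b) : rlIntegral α f τ = stoppedFracInt α b f τ := by
  rw [stoppedFracInt_eq_of_le f le_rfl hb, rlIntegral, stoppedFracInt,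
    intervalIntegral.integral_of_le h0]
  congr 1
  refine setIntegral_congr_fun measurableSet_Ioc fun ξ hξ => ?_
  rw [inv_rpow_eq_fracKernel hα₁ (by linarith [hξ.2])]

lemma norm_stoppedFracInt_le (hα : 0 < α) (hα₁ : α ≤ 1) {b K : ℝ} (hb : 0 ≤ b) (hK0 : 0 ≤ K)
    {f : ℝ → E} (hK : ∀ᵐ ξ ∂(volume.restrict (Ioc 0 b)), ‖f ξ‖ ≤ K) (τ : ℝ) :
    ‖stoppedFracInt α b f τ‖ ≤ (Real.Gamma α)⁻¹ * (b ^ α / α * K) := by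
  have hΓ := Real.Gamma_pos_of_pos hα
  rw [stoppedFracInt, norm_smul, norm_inv, Real.norm_of_nonneg hΓ.le]
  gcongr
  refine (norm_integral_fracKernel_smul_le hα hK τ).trans ?_
  gcongr
  simpa using setIntegral_fracKernel_sub_le hα hα₁ τ hb

lemma norm_stoppedFracInt_sub_le (hα : 0 < α) (hα₁ : α ≤ 1) {b K : ℝ} (hb : 0 ≤ b) (hK0 : 0 ≤ K)
    {f : ℝ → E} (hf : AEStronglyMeasurable f (volume.restrict (Ioc 0 b)))
    (hK : ∀ᵐ ξ ∂(volume.restrict (Ioc 0 b)), ‖f ξ‖ ≤ K) (τ τ' : ℝ) :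
    ‖stoppedFracInt α b f τ - stoppedFracInt α b f τ'‖ ≤
      (Real.Gamma α)⁻¹ * (3 * (|τ - τ'| ^ α / α) * K) := by
  have hΓ := Real.Gamma_pos_of_pos hα
  rw [stoppedFracInt, stoppedFracInt, ← smul_sub, norm_smul, norm_inv, Real.norm_of_nonneg hΓ.le,
    ← integral_sub (integrableOn_fracKernel_smul hα hf hK τ)
      (integrableOn_fracKernel_smul hα hf hK τ')]
  gcongr
  refine le_trans ?_ (mul_le_mul_of_nonneg_right
    (setIntegral_abs_fracKernel_sub_le hα hα₁ τ τ' hb) hK0)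
  rw [← integral_mul_const]
  refine norm_integral_le_of_norm_le (((integrableOn_fracKernel_sub hα τ 0 b).sub
    (integrableOn_fracKernel_sub hα τ' 0 b)).abs.mul_const K) ?_
  filter_upwards [hK] with ξ h
  rw [← sub_smul, norm_smul, Real.norm_eq_abs]
  exact mul_le_mul_of_nonneg_left h (abs_nonneg _)

lemma continuous_stoppedFracInt (hα : 0 < α) (hα₁ : α ≤ 1) {b K : ℝ} (hb : 0 ≤ b)
    {f : ℝ → E} (hf : AEStronglyMeasurable f (volume.restrict (Ioc 0 b)))
    (hK : ∀ᵐ ξ ∂(volume.restrict (Ioc 0 b)), ‖f ξ‖ ≤ K) :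
    Continuous (stoppedFracInt α b f) := by
  have hK' : ∀ᵐ ξ ∂(volume.restrict (Ioc 0 b)), ‖f ξ‖ ≤ |K| := by
    filter_upwards [hK] with ξ h using h.trans (le_abs_self K)
  rw [continuous_iff_continuousAt]
  intro τ
  rw [ContinuousAt, tendsto_iff_norm_sub_tendsto_zero]
  refine squeeze_zero (fun _ => norm_nonneg _)
    (fun τ' => norm_stoppedFracInt_sub_le hα hα₁ hb (abs_nonneg K) hf hK' τ' τ) ?_
  have : Continuous fun τ' : ℝ => (Real.Gamma α)⁻¹ * (3 * (|τ' - τ| ^ α / α) * |K|) := by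
    have : Continuous fun τ' : ℝ => |τ' - τ| ^ α :=
      (by fun_prop : Continuous fun τ' : ℝ => |τ' - τ|).rpow_const fun _ => Or.inr hα.le
    fun_prop
  refine (this.tendsto τ).trans_eq ?_
  simp [Real.zero_rpow hα.ne']

lemma stoppedFracInt_sub_eq (hα : 0 < α) {b b' K : ℝ} (hb : 0 ≤ b) (hbb : b ≤ b')
    {f : ℝ → E} (hf : AEStronglyMeasurable f (volume.restrict (Ioc 0 b')))
    (hK : ∀ᵐ ξ ∂(volume.restrict (Ioc 0 b')), ‖f ξ‖ ≤ K) (τ : ℝ) :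
    stoppedFracInt α b' f τ - stoppedFracInt α b f τ =
      (Real.Gamma α)⁻¹ • ∫ ξ in Ioc b b', fracKernel α (τ - ξ) • f ξ := by
  rw [stoppedFracInt, stoppedFracInt, ← smul_sub]
  congr 1
  have hi := integrableOn_fracKernel_smul hα hf hK τ
  rw [← Ioc_union_Ioc_eq_Ioc hb hbb, setIntegral_union (Ioc_disjoint_Ioc_of_le le_rfl)
    measurableSet_Ioc (hi.mono_set (Ioc_subset_Ioc_right hbb))
    (hi.mono_set (Ioc_subset_Ioc_left hb)), add_sub_cancel_left]

lemma stoppedFracInt_sub (hα : 0 < α) {b K L : ℝ} {f g : ℝ → E}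
    (hf : AEStronglyMeasurable f (volume.restrict (Ioc 0 b)))
    (hK : ∀ᵐ ξ ∂(volume.restrict (Ioc 0 b)), ‖f ξ‖ ≤ K)
    (hg : AEStronglyMeasurable g (volume.restrict (Ioc 0 b)))
    (hL : ∀ᵐ ξ ∂(volume.restrict (Ioc 0 b)), ‖g ξ‖ ≤ L) (τ : ℝ) :
    stoppedFracInt α b (fun ξ => f ξ - g ξ) τ =
      stoppedFracInt α b f τ - stoppedFracInt α b g τ := by
  rw [stoppedFracInt, stoppedFracInt, stoppedFracInt, ← smul_sub,
    ← integral_sub (integrableOn_fracKernel_smul hα hf hK τ)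
      (integrableOn_fracKernel_smul hα hg hL τ)]
  simp_rw [smul_sub]

variable [CompleteSpace E]

/-- The semigroup identity `I^(1 - α) I^α = I^1`. After Fubini the inner integral is the Beta
integral `B(α, 1 - α) = Γ(α) Γ(1 - α)`, which does not depend on the end points. -/
lemma integral_fracKernel_smul_stoppedFracInt (hα : 0 < α) (hα₁ : α < 1) {b s K : ℝ} (hs : 0 ≤ s)
    (hsb : s ≤ b) {f : ℝ → E} (hf : AEStronglyMeasurable f (volume.restrict (Ioc 0 b)))
    (hK : ∀ᵐ ξ ∂(volume.restrict (Ioc 0 b)), ‖f ξ‖ ≤ K) :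
    ∫ ξ in Ioc 0 s, fracKernel (1 - α) (s - ξ) • stoppedFracInt α b f ξ =
      Real.Gamma (1 - α) • ∫ ξ in Ioc 0 s, f ξ := by
  have hα₂ : 0 < 1 - α := sub_pos.2 hα₁
  have hΓ := Real.Gamma_pos_of_pos hα
  have hsub : Ioc 0 s ⊆ Ioc 0 b := Ioc_subset_Ioc_right hsb
  have hK' := ae_restrict_of_ae_restrict_of_subset hsub hK
  have hf' := hf.mono_measure (Measure.restrict_mono_set volume hsub)
  have h1 : ∫ ξ in Ioc 0 s, fracKernel (1 - α) (s - ξ) • stoppedFracInt α b f ξ =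
      (Real.Gamma α)⁻¹ • ∫ ξ in Ioc 0 s, fracKernel (1 - α) (s - ξ) •
        ∫ η in Ioc 0 s, fracKernel α (ξ - η) • f η := by
    rw [← integral_smul]
    refine setIntegral_congr_fun measurableSet_Ioc fun ξ hξ => ?_
    rw [stoppedFracInt_eq_of_le f hξ.2 hsb, stoppedFracInt, smul_comm]
  have h2 : ∫ η in Ioc 0 s, (∫ ξ in Ioc 0 s, fracKernel (1 - α) (s - ξ) * fracKernel α (ξ - η)) •
      f η = ∫ η in Ioc 0 s, beta α (1 - α) • f η := by
    rw [integral_Ioc_eq_integral_Ioo (μ := volume), integral_Ioc_eq_integral_Ioo]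
    refine setIntegral_congr_fun measurableSet_Ioo fun η hη => ?_
    congr 1
    have h3 := integral_fracKernel_mul_fracKernel hα hα₂ hη.2
    rw [show α + (1 - α) - 1 = 0 by ring, Real.rpow_zero, one_mul] at h3
    rw [← h3]
    simp_rw [mul_comm (fracKernel (1 - α) _)]
    refine setIntegral_eq_integral_of_forall_compl_eq_zero fun ξ hξ => ?_
    rcases le_or_gt ξ 0 with h | h
    · rw [fracKernel_of_nonpos (by linarith [hη.1]), zero_mul]
    · rw [fracKernel_of_nonpos (r := s - ξ) (by linarith [not_le.1 fun h4 => hξ ⟨h, h4⟩]),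
        mul_zero]
  rw [h1, integral_smul_integral_fracKernel_smul hα hα₁.le
    (integrableOn_fracKernel_sub hα₂ s 0 s) hs hf' hK', h2, integral_smul, beta_one_sub, smul_smul,
    inv_mul_cancel_left₀ hΓ.ne']

/-- A superposition over `η` of the reproducing identity. The density `f` enters the right-hand side
only through the values of its fractional integral up to time `t`. -/
lemma stoppedFracInt_eq_integral_poissonKernel (hα : 0 < α) (hα₁ : α < 1) {t τ K : ℝ} (ht : 0 ≤ t)
    (htτ : t < τ) {f : ℝ → E} (hf : AEStronglyMeasurable f (volume.restrict (Ioc 0 t)))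
    (hK : ∀ᵐ ξ ∂(volume.restrict (Ioc 0 t)), ‖f ξ‖ ≤ K) :
    stoppedFracInt α t f τ =
      (beta α (1 - α))⁻¹ • ∫ ξ in Ioc 0 t, poissonKernel α t τ ξ • stoppedFracInt α t f ξ := by
  have hb := beta_pos hα (sub_pos.2 hα₁)
  have h1 : ∫ ξ in Ioc 0 t, poissonKernel α t τ ξ • stoppedFracInt α t f ξ =
      (Real.Gamma α)⁻¹ • ∫ ξ in Ioc 0 t, poissonKernel α t τ ξ •
        ∫ η in Ioc 0 t, fracKernel α (ξ - η) • f η := by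
    rw [← integral_smul]
    simp_rw [stoppedFracInt, smul_comm (Real.Gamma α)⁻¹]
  have h2 : ∫ η in Ioc 0 t, (∫ ξ in Ioc 0 t, poissonKernel α t τ ξ * fracKernel α (ξ - η)) •
      f η = ∫ η in Ioc 0 t, beta α (1 - α) • fracKernel α (τ - η) • f η := by
    rw [integral_Ioc_eq_integral_Ioo (μ := volume), integral_Ioc_eq_integral_Ioo]
    refine setIntegral_congr_fun measurableSet_Ioo fun η hη => ?_
    rw [smul_smul]
    congr 1
    rw [← integral_poissonKernel_mul_fracKernel hα hα₁ hη.2 htτ, ← integral_Ioc_eq_integral_Ioo]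
    refine setIntegral_eq_of_subset_of_forall_sdiff_eq_zero measurableSet_Ioc
      (Ioc_subset_Ioc_left hη.1.le) fun ξ hξ => ?_
    have : ξ ≤ η := not_lt.1 fun h => hξ.2 ⟨h, hξ.1.2⟩
    rw [fracKernel_of_nonpos (by linarith), mul_zero]
  rw [h1, integral_smul_integral_fracKernel_smul hα hα₁.le
    (integrableOn_poissonKernel hα₁ htτ 0 t) ht hf hK, h2, integral_smul, stoppedFracInt,
    smul_comm _ (Real.Gamma α)⁻¹, inv_smul_smul₀ hb.ne']

/-- A maximum principle: the normalised kernel is nonnegative with mass at most 1, so the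
continuation is no larger than the past. -/
lemma norm_stoppedFracInt_le_of_bound (hα : 0 < α) (hα₁ : α < 1) {t τ K R : ℝ} (ht : 0 ≤ t)
    (htτ : t < τ) {f : ℝ → E} (hf : AEStronglyMeasurable f (volume.restrict (Ioc 0 t)))
    (hK : ∀ᵐ ξ ∂(volume.restrict (Ioc 0 t)), ‖f ξ‖ ≤ K) (hR0 : 0 ≤ R)
    (hR : ∀ ξ ∈ Ioc 0 t, ‖stoppedFracInt α t f ξ‖ ≤ R) :
    ‖stoppedFracInt α t f τ‖ ≤ R := by
  have hb := beta_pos hα (sub_pos.2 hα₁)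
  rw [stoppedFracInt_eq_integral_poissonKernel hα hα₁ ht htτ hf hK, norm_smul, norm_inv,
    Real.norm_of_nonneg hb.le, inv_mul_le_iff₀ hb]
  refine le_trans ?_ (mul_le_mul_of_nonneg_right (integral_poissonKernel_le hα hα₁ ht htτ) hR0)
  rw [← integral_mul_const]
  refine norm_integral_le_of_norm_le ((integrableOn_poissonKernel hα₁ htτ 0 t).mul_const R) ?_
  refine (ae_restrict_iff' measurableSet_Ioc).2 (Eventually.of_forall fun ξ hξ => ?_)
  rw [norm_smul, Real.norm_of_nonneg (poissonKernel_nonneg htτ ξ)]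
  exact mul_le_mul_of_nonneg_left (hR ξ hξ) (poissonKernel_nonneg htτ ξ)

end FracInt
-- Caputo derivatives of paths and continuity of the free continuation.
section Paths

variable {n : ℕ} {T : ℝ} {α : ℝ}

/-- The integral whose derivative is, up to a factor, the Caputo derivative. -/
noncomputable def caputoPrimitive (α : ℝ) (x : ℝ → Euc n) (s : ℝ) : Euc n :=
  ∫ ξ in (0 : ℝ)..s, ((s - ξ) ^ α)⁻¹ • (x ξ - x 0)

lemma caputoPrimitive_eq (hα : 0 < α) (x : ℝ → Euc n) {s : ℝ} (hs : 0 ≤ s) :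
    caputoPrimitive α x s = ∫ ξ in Ioc 0 s, fracKernel (1 - α) (s - ξ) • (x ξ - x 0) := by
  rw [caputoPrimitive, intervalIntegral.integral_of_le hs]
  refine setIntegral_congr_fun measurableSet_Ioc fun ξ hξ => ?_
  rw [← inv_rpow_eq_fracKernel (by linarith) (by linarith [hξ.2] : 0 ≤ s - ξ), sub_sub_cancel]

lemma caputoPrimitive_eq_integral (hα : 0 < α) (hα₁ : α < 1) {x f : ℝ → Euc n} {K : ℝ}
    (hf : AEStronglyMeasurable f (volume.restrict (Ioc 0 T)))
    (hK : ∀ᵐ ξ ∂(volume.restrict (Ioc 0 T)), ‖f ξ‖ ≤ K)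
    (hx : ∀ τ ∈ Icc 0 T, x τ = x 0 + stoppedFracInt α T f τ) {s : ℝ} (hs : s ∈ Icc 0 T) :
    caputoPrimitive α x s = Real.Gamma (1 - α) • ∫ ξ in Ioc 0 s, f ξ := by
  rw [caputoPrimitive_eq hα x hs.1, ← integral_fracKernel_smul_stoppedFracInt hα hα₁ hs.1 hs.2 hf hK]
  refine setIntegral_congr_fun measurableSet_Ioc fun ξ hξ => ?_
  rw [hx ξ ⟨hξ.1.le, hξ.2.trans hs.2⟩, add_sub_cancel_left]

lemma integrableOn_of_bound {f : ℝ → Euc n} {K b : ℝ}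
    (hf : AEStronglyMeasurable f (volume.restrict (Ioc 0 b)))
    (hK : ∀ᵐ ξ ∂(volume.restrict (Ioc 0 b)), ‖f ξ‖ ≤ K) : IntegrableOn f (Ioc 0 b) :=
  Integrable.of_bound hf K hK

variable [hT : Fact (0 < T)]

lemma pathAt_of_mem (x : ACPath n T α) {τ : ℝ} (hτ : τ ∈ Icc 0 T) : pathAt x τ = x.1 ⟨τ, hτ⟩ :=
  IccExtend_of_mem _ _ hτ

lemma pathAt_of_nonpos (x : ACPath n T α) {τ : ℝ} (hτ : τ ≤ 0) : pathAt x τ = pathAt x 0 := by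
  unfold pathAt
  rw [IccExtend_of_le_left _ _ hτ, IccExtend_left]

lemma continuous_pathAt (x : ACPath n T α) : Continuous (pathAt x) :=
  x.1.continuous.Icc_extend'

lemma norm_pathAt_sub_le (x y : ACPath n T α) (τ : ℝ) :
    ‖pathAt x τ - pathAt y τ‖ ≤ dist x y := by
  rw [← dist_eq_norm]
  exact ContinuousMap.dist_apply_le_dist (f := x.1) (g := y.1) _

lemma exists_stoppedFracInt_eq (hα₁ : α < 1) (x : ACPath n T α) :
    ∃ (f : ℝ → Euc n) (K : ℝ), 0 ≤ K ∧ AEStronglyMeasurable f (volume.restrict (Ioc 0 T)) ∧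
      (∀ᵐ ξ ∂(volume.restrict (Ioc 0 T)), ‖f ξ‖ ≤ K) ∧
      ∀ τ ∈ Icc 0 T, pathAt x τ = pathAt x 0 + stoppedFracInt α T f τ := by
  obtain ⟨f, hf, hx⟩ := x.2
  rw [← restrict_Ioc_eq_restrict_Icc] at hf
  refine ⟨f, (eLpNormEssSup f (volume.restrict (Ioc 0 T))).toReal, ENNReal.toReal_nonneg,
    hf.aestronglyMeasurable, ?_, fun τ hτ => ?_⟩
  · have hfin : eLpNormEssSup f (volume.restrict (Ioc 0 T)) ≠ ⊤ := by
      simpa using hf.eLpNorm_ne_top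
    filter_upwards [ae_le_eLpNormEssSup (f := f) (μ := volume.restrict (Ioc 0 T))] with ξ hξ
    rw [← toReal_enorm]
    exact ENNReal.toReal_mono hfin hξ
  · rw [pathAt_of_mem x hτ, pathAt_of_mem x (left_mem_Icc.2 hT.out.le), hx ⟨τ, hτ⟩,
      rlIntegral_eq_stoppedFracInt hα₁ f hτ.1 hτ.2]

/-- By the semigroup identity the function differentiated in `caputo` is `Γ(1 - α)` times a
primitive of `f`; Lebesgue's differentiation theorem recovers `f`. -/
lemma caputo_ae_eq (hα : 0 < α) (hα₁ : α < 1) {x : ACPath n T α} {f : ℝ → Euc n} {K : ℝ}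
    (hf : AEStronglyMeasurable f (volume.restrict (Ioc 0 T)))
    (hK : ∀ᵐ ξ ∂(volume.restrict (Ioc 0 T)), ‖f ξ‖ ≤ K)
    (hx : ∀ τ ∈ Icc 0 T, pathAt x τ = pathAt x 0 + stoppedFracInt α T f τ) :
    caputo x =ᵐ[volume.restrict (Ioc 0 T)] f := by
  have hΓ := Real.Gamma_pos_of_pos (sub_pos.2 hα₁)
  have hT0 : (0 : ℝ) ≤ T := hT.out.le
  have hint : IntervalIntegrable f volume 0 T :=
    (intervalIntegrable_iff_integrableOn_Ioc_of_le hT0).2 (integrableOn_of_bound hf hK)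
  have hd := hint.ae_hasDerivAt_integral
  -- The primitive is identified only on `[0, T]`, so a two-sided derivative needs an interior
  -- point.
  rw [← restrict_Ioo_eq_restrict_Ioc]
  rw [EventuallyEq, ae_restrict_iff' measurableSet_Ioo]
  filter_upwards [hd] with s hs hsT
  rw [uIcc_of_le hT0] at hs
  have h1 := (hs (Ioo_subset_Icc_self hsT) 0 (left_mem_Icc.2 hT0)).const_smul (Real.Gamma (1 - α))
  have h2 : caputoPrimitive α (pathAt x) =ᶠ[𝓝 s]
      fun r => Real.Gamma (1 - α) • ∫ ξ in (0 : ℝ)..r, f ξ := by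
    filter_upwards [Ioo_mem_nhds hsT.1 hsT.2] with r hr
    rw [caputoPrimitive_eq_integral hα hα₁ hf hK hx (Ioo_subset_Icc_self hr),
      intervalIntegral.integral_of_le hr.1.le]
  have h3 := (h1.congr_of_eventuallyEq h2).deriv
  change (Real.Gamma (1 - α))⁻¹ • deriv (caputoPrimitive α (pathAt x)) s = f s
  rw [h3, inv_smul_smul₀ hΓ.ne']

lemma aestronglyMeasurable_caputo (hα : 0 < α) (hα₁ : α < 1) (x : ACPath n T α) :
    AEStronglyMeasurable (caputo x) (volume.restrict (Ioc 0 T)) := by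
  obtain ⟨f, K, -, hf, hK, hx⟩ := exists_stoppedFracInt_eq hα₁ x
  exact hf.congr (caputo_ae_eq hα hα₁ hf hK hx).symm

lemma exists_caputo_bound (hα : 0 < α) (hα₁ : α < 1) (x : ACPath n T α) :
    ∃ K, 0 ≤ K ∧ ∀ᵐ ξ ∂(volume.restrict (Ioc 0 T)), ‖caputo x ξ‖ ≤ K := by
  obtain ⟨f, K, hK0, hf, hK, hx⟩ := exists_stoppedFracInt_eq hα₁ x
  refine ⟨K, hK0, ?_⟩
  filter_upwards [hK, caputo_ae_eq hα hα₁ hf hK hx] with ξ h1 h2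
  rwa [h2]

lemma pathAt_eq_stoppedFracInt (hα : 0 < α) (hα₁ : α < 1) (x : ACPath n T α) {τ : ℝ}
    (hτ : τ ∈ Icc 0 T) : pathAt x τ = pathAt x 0 + stoppedFracInt α T (caputo x) τ := by
  obtain ⟨f, K, hK0, hf, hK, hx⟩ := exists_stoppedFracInt_eq hα₁ x
  rw [hx τ hτ, stoppedFracInt_congr (caputo_ae_eq hα hα₁ hf hK hx)]

lemma caputoPrimitive_pathAt (hα : 0 < α) (hα₁ : α < 1) (x : ACPath n T α) {s : ℝ}
    (hs : s ∈ Icc 0 T) :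
    caputoPrimitive α (pathAt x) s = Real.Gamma (1 - α) • ∫ ξ in Ioc 0 s, caputo x ξ := by
  obtain ⟨K, hK0, hK⟩ := exists_caputo_bound hα hα₁ x
  exact caputoPrimitive_eq_integral hα hα₁ (aestronglyMeasurable_caputo hα hα₁ x) hK
    (fun τ hτ => pathAt_eq_stoppedFracInt hα hα₁ x hτ) hs

lemma caputo_eq_of_continuation {t : Icc (0 : ℝ) T} {x y : ACPath n T α}
    (hy : y ∈ continuations t x) {s : ℝ} (hs : s ∈ Ioo 0 (t : ℝ)) : caputo y s = caputo x s := by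
  unfold caputo
  congr 1
  refine EventuallyEq.deriv_eq ?_
  filter_upwards [Ioo_mem_nhds hs.1 hs.2] with r hr
  refine intervalIntegral.integral_congr fun ξ hξ => ?_
  rw [uIcc_of_le hr.1.le] at hξ
  rw [hy ξ ⟨hξ.1, hξ.2.trans hr.2.le⟩, hy 0 ⟨le_rfl, hr.1.le.trans hr.2.le⟩]

/-- The kernel vanishes for `ξ ≥ τ`, so stopping the integral at `t` also represents the path itself
when `τ ≤ t`. Both branches of the definition become one formula. -/
lemma freeContinuation_eq (hα : 0 < α) (hα₁ : α < 1) (t : Icc (0 : ℝ) T) (x : ACPath n T α)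
    (τ : ℝ) : freeContinuation t x τ = pathAt x 0 + stoppedFracInt α t (caputo x) τ := by
  unfold freeContinuation
  split_ifs with h
  · rcases le_total τ 0 with h0 | h0
    · rw [stoppedFracInt_of_nonpos _ h0, add_zero, pathAt_of_nonpos x h0]
    · rw [pathAt_eq_stoppedFracInt hα hα₁ x ⟨h0, h.trans t.2.2⟩,
        stoppedFracInt_eq_of_le _ h t.2.2]
  · rw [stoppedFracInt, intervalIntegral.integral_of_le t.2.1]
    congr 2
    refine setIntegral_congr_fun measurableSet_Ioc fun ξ hξ => ?_
    rw [inv_rpow_eq_fracKernel hα₁ (by linarith [hξ.2, not_le.1 h])]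

lemma freeContinuation_of_le {t : Icc (0 : ℝ) T} {x : ACPath n T α} {τ : ℝ} (h : τ ≤ t) :
    freeContinuation t x τ = pathAt x τ := if_pos h

lemma aestronglyMeasurable_caputo_Ioc (hα : 0 < α) (hα₁ : α < 1) (x : ACPath n T α) {t : ℝ}
    (ht : t ≤ T) : AEStronglyMeasurable (caputo x) (volume.restrict (Ioc 0 t)) :=
  (aestronglyMeasurable_caputo hα hα₁ x).mono_measure
    (Measure.restrict_mono_set volume (Ioc_subset_Ioc_right ht))

/-- Closeness of paths gives no bound on the difference of their Caputo derivatives, so the maximum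
principle is applied instead. On `[0, t]` the stopped integral of the difference equals the
difference of the paths minus its initial value, at most twice the distance; the initial value adds
one more. -/
lemma norm_freeContinuation_sub_le (hα : 0 < α) (hα₁ : α < 1) (t : Icc (0 : ℝ) T)
    (x y : ACPath n T α) (τ : ℝ) :
    ‖freeContinuation t x τ - freeContinuation t y τ‖ ≤ 3 * dist x y := by
  have hd := dist_nonneg (x := x) (y := y)
  rcases le_or_gt τ t with h | h
  · rw [freeContinuation_of_le h, freeContinuation_of_le h]
    linarith [norm_pathAt_sub_le x y τ]
  · obtain ⟨K, hK0, hK⟩ := exists_caputo_bound hα hα₁ x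
    obtain ⟨L, hL0, hL⟩ := exists_caputo_bound hα hα₁ y
    have hsub : Ioc 0 (t : ℝ) ⊆ Ioc 0 T := Ioc_subset_Ioc_right t.2.2
    replace hK := ae_restrict_of_ae_restrict_of_subset hsub hK
    replace hL := ae_restrict_of_ae_restrict_of_subset hsub hL
    have hx := aestronglyMeasurable_caputo_Ioc hα hα₁ x t.2.2
    have hy := aestronglyMeasurable_caputo_Ioc hα hα₁ y t.2.2
    have hKL : ∀ᵐ ξ ∂(volume.restrict (Ioc 0 (t : ℝ))), ‖caputo x ξ - caputo y ξ‖ ≤ K + L := by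
      filter_upwards [hK, hL] with ξ h1 h2
      exact (norm_sub_le _ _).trans (add_le_add h1 h2)
    have key := norm_stoppedFracInt_le_of_bound (R := 2 * dist x y) hα hα₁ t.2.1 h (hx.sub hy) hKL
      (by positivity) fun ξ hξ => by
        change ‖stoppedFracInt α t (fun ξ => caputo x ξ - caputo y ξ) ξ‖ ≤ _
        rw [stoppedFracInt_sub hα hx hK hy hL]
        have e (z : ACPath n T α) : stoppedFracInt α t (caputo z) ξ = pathAt z ξ - pathAt z 0 := by
          rw [← freeContinuation_of_le hξ.2, freeContinuation_eq hα hα₁, add_sub_cancel_left]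
        rw [e, e, sub_sub_sub_comm]
        linarith [norm_sub_le (pathAt x ξ - pathAt y ξ) (pathAt x 0 - pathAt y 0),
          norm_pathAt_sub_le x y ξ, norm_pathAt_sub_le x y 0]
    change ‖stoppedFracInt α t (fun ξ => caputo x ξ - caputo y ξ) τ‖ ≤ _ at key
    rw [stoppedFracInt_sub hα hx hK hy hL] at key
    rw [freeContinuation_eq hα hα₁, freeContinuation_eq hα hα₁, add_sub_add_comm]
    linarith [norm_add_le (pathAt x 0 - pathAt y 0)
      (stoppedFracInt α t (caputo x) τ - stoppedFracInt α t (caputo y) τ),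
      norm_pathAt_sub_le x y 0]

lemma freeContinuation_sub_eq (hα : 0 < α) (hα₁ : α < 1) {s t : Icc (0 : ℝ) T} (hst : s ≤ t)
    (x : ACPath n T α) (τ : ℝ) :
    freeContinuation t x τ - freeContinuation s x τ =
      (Real.Gamma α)⁻¹ • ∫ ξ in Ioc (s : ℝ) t, fracKernel α (τ - ξ) • caputo x ξ := by
  obtain ⟨K, hK0, hK⟩ := exists_caputo_bound hα hα₁ x
  rw [freeContinuation_eq hα hα₁, freeContinuation_eq hα hα₁, add_sub_add_left_eq_sub]
  exact stoppedFracInt_sub_eq hα s.2.1 hst (aestronglyMeasurable_caputo_Ioc hα hα₁ x t.2.2)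
    (ae_restrict_of_ae_restrict_of_subset (Ioc_subset_Ioc_right t.2.2) hK) τ

/-- Moving the stopping time adds only the integral between the two times: a Hölder bound of
exponent `α`, uniform in `τ`. -/
lemma norm_freeContinuation_sub_time_le (hα : 0 < α) (hα₁ : α < 1) {x : ACPath n T α} {K : ℝ}
    (hK0 : 0 ≤ K) (hK : ∀ᵐ ξ ∂(volume.restrict (Ioc 0 T)), ‖caputo x ξ‖ ≤ K)
    (s t : Icc (0 : ℝ) T) (τ : ℝ) :
    ‖freeContinuation t x τ - freeContinuation s x τ‖ ≤
      (Real.Gamma α)⁻¹ * (|(t : ℝ) - s| ^ α / α * K) := by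
  wlog hst : s ≤ t generalizing s t
  · rw [norm_sub_rev, abs_sub_comm]
    exact this t s (le_of_not_ge hst)
  have hΓ := Real.Gamma_pos_of_pos hα
  have hst' : (s : ℝ) ≤ t := hst
  rw [freeContinuation_sub_eq hα hα₁ hst, norm_smul, norm_inv, Real.norm_of_nonneg hΓ.le,
    abs_of_nonneg (sub_nonneg.2 hst')]
  gcongr
  refine (norm_integral_fracKernel_smul_le hα
    (ae_restrict_of_ae_restrict_of_subset (Ioc_subset_Ioc s.2.1 t.2.2) hK) τ).trans ?_
  gcongr
  exact setIntegral_fracKernel_sub_le hα hα₁.le τ hst'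

lemma continuous_freeContinuation (hα : 0 < α) (hα₁ : α < 1) (t : Icc (0 : ℝ) T)
    (x : ACPath n T α) : Continuous (freeContinuation t x) := by
  obtain ⟨K, hK0, hK⟩ := exists_caputo_bound hα hα₁ x
  rw [show freeContinuation t x = _ from funext (freeContinuation_eq hα hα₁ t x)]
  exact continuous_const.add (continuous_stoppedFracInt hα hα₁.le t.2.1
    (aestronglyMeasurable_caputo_Ioc hα hα₁ x t.2.2)
    (ae_restrict_of_ae_restrict_of_subset (Ioc_subset_Ioc_right t.2.2) hK))

lemma exists_norm_freeContinuation_le (hα : 0 < α) (hα₁ : α < 1) (t : Icc (0 : ℝ) T)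
    (x : ACPath n T α) : ∃ C, ∀ τ, ‖freeContinuation t x τ‖ ≤ C := by
  obtain ⟨K, hK0, hK⟩ := exists_caputo_bound hα hα₁ x
  refine ⟨‖pathAt x 0‖ + (Real.Gamma α)⁻¹ * ((t : ℝ) ^ α / α * K), fun τ => ?_⟩
  rw [freeContinuation_eq hα hα₁]
  exact (norm_add_le _ _).trans (add_le_add_right (norm_stoppedFracInt_le hα hα₁.le t.2.1 hK0
    (ae_restrict_of_ae_restrict_of_subset (Ioc_subset_Ioc_right t.2.2) hK) τ) _)

open BoundedContinuousFunction in
/-- The path `a(· | t, x)` as an element of the space of bounded continuous functions. -/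
noncomputable def freePath (hα : 0 < α) (hα₁ : α < 1) (z : Icc (0 : ℝ) T × ACPath n T α) :
    ℝ →ᵇ Euc n :=
  BoundedContinuousFunction.ofNormedAddCommGroup (freeContinuation z.1 z.2)
    (continuous_freeContinuation hα hα₁ z.1 z.2)
    (exists_norm_freeContinuation_le hα hα₁ z.1 z.2).choose
    (exists_norm_freeContinuation_le hα hα₁ z.1 z.2).choose_spec

@[simp]
lemma freePath_apply (hα : 0 < α) (hα₁ : α < 1) (z : Icc (0 : ℝ) T × ACPath n T α) (τ : ℝ) :
    freePath hα hα₁ z τ = freeContinuation z.1 z.2 τ := rfl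

lemma continuous_freePath (hα : 0 < α) (hα₁ : α < 1) :
    Continuous (freePath (n := n) (T := T) hα hα₁) := by
  rw [continuous_iff_continuousAt]
  rintro ⟨t₀, x₀⟩
  obtain ⟨K, hK0, hK⟩ := exists_caputo_bound hα hα₁ x₀
  have hΓ := Real.Gamma_pos_of_pos hα
  rw [ContinuousAt, tendsto_iff_dist_tendsto_zero]
  refine squeeze_zero (g := fun z : Icc (0 : ℝ) T × ACPath n T α => 3 * dist z.2 x₀ +
    (Real.Gamma α)⁻¹ * (|(z.1 : ℝ) - t₀| ^ α / α * K)) (fun _ => dist_nonneg) (fun z => ?_) ?_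
  · refine (BoundedContinuousFunction.dist_le (by positivity)).2 fun τ => ?_
    rw [freePath_apply, freePath_apply, dist_eq_norm]
    refine (norm_sub_le_norm_sub_add_norm_sub _ (freeContinuation z.1 x₀ τ) _).trans
      (add_le_add (norm_freeContinuation_sub_le hα hα₁ z.1 z.2 x₀ τ)
        (norm_freeContinuation_sub_time_le hα hα₁ hK0 hK t₀ z.1 τ))
  · have h1 : Continuous fun z : Icc (0 : ℝ) T × ACPath n T α => |(z.1 : ℝ) - t₀| ^ α :=
      (by fun_prop : Continuous fun z : Icc (0 : ℝ) T × ACPath n T α =>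
        |(z.1 : ℝ) - t₀|).rpow_const fun _ => Or.inr hα.le
    have h2 : Continuous fun z : Icc (0 : ℝ) T × ACPath n T α => 3 * dist z.2 x₀ +
        (Real.Gamma α)⁻¹ * (|(z.1 : ℝ) - t₀| ^ α / α * K) := by fun_prop
    refine (h2.tendsto (t₀, x₀)).trans_eq ?_
    simp [Real.zero_rpow hα.ne']

end Paths
-- Lipschitz functions as integrals of their derivatives.
section Lipschitz

variable {E : Type*} [NormedAddCommGroup E] [NormedSpace ℝ E]

lemma norm_deriv_le_of_norm_sub_le_integral {g : ℝ → E} {w : ℝ → ℝ} (hw : Continuous w) {s b : ℝ}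
    (hsb : s < b) (hd : DifferentiableAt ℝ g s)
    (h : ∀ r ∈ Ioo s b, ‖g r - g s‖ ≤ ∫ ξ in s..r, w ξ) : ‖deriv g s‖ ≤ w s := by
  have h1 := (hasDerivAt_iff_tendsto_slope.1 hd.hasDerivAt).mono_left
    (nhdsWithin_mono s fun r (hr : r ∈ Ioi s) => (ne_of_gt hr : r ≠ s))
  have h2 := (hasDerivAt_iff_tendsto_slope.1 (hw.integral_hasStrictDerivAt s s).hasDerivAt).mono_left
    (nhdsWithin_mono s fun r (hr : r ∈ Ioi s) => (ne_of_gt hr : r ≠ s))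
  refine le_of_tendsto_of_tendsto h1.norm h2 ?_
  filter_upwards [Ioo_mem_nhdsGT hsb] with r hr
  have hrs : 0 < r - s := sub_pos.2 hr.1
  rw [slope_def_module, slope_def_module, norm_smul, intervalIntegral.integral_same, sub_zero,
    norm_inv, Real.norm_of_nonneg hrs.le, smul_eq_mul]
  exact mul_le_mul_of_nonneg_left (h r hr) (inv_nonneg.2 hrs.le)

variable [FiniteDimensional ℝ E]

lemma intervalIntegrable_deriv_of_lipschitz {C : NNReal} {g : ℝ → E} (hg : LipschitzWith C g)
    (a b : ℝ) : IntervalIntegrable (deriv g) volume a b := by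
  have := FiniteDimensional.complete ℝ E
  refine (intervalIntegrable_const (c := (C : ℝ))).mono_fun
    (stronglyMeasurable_deriv g).aestronglyMeasurable (Eventually.of_forall fun s => ?_)
  exact (norm_deriv_le_of_lipschitz hg).trans (le_abs_self _)

/-- The difference of `g` and the integral of its derivative is absolutely continuous with
derivative 0 almost everywhere, hence constant. -/
lemma integral_deriv_eq_sub_of_lipschitz {C : NNReal} {g : ℝ → E} (hg : LipschitzWith C g)
    (a b : ℝ) : ∫ s in a..b, deriv g s = g b - g a := by
  have := FiniteDimensional.complete ℝ E
  have hi := intervalIntegrable_deriv_of_lipschitz hg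
  have hint : LipschitzWith C fun s => ∫ r in a..s, deriv g r := by
    refine LipschitzWith.of_dist_le_mul fun s r => ?_
    rw [dist_eq_norm, intervalIntegral.integral_interval_sub_left (hi _ _) (hi _ _), Real.dist_eq]
    exact intervalIntegral.norm_integral_le_of_norm_le_const fun u _ =>
      norm_deriv_le_of_lipschitz hg
  have hac := ((hg.sub hint).lipschitzOnWith (s := uIcc a b)).absolutelyContinuousOnInterval
  obtain ⟨c, hc⟩ := hac.const_of_ae_hasDerivAt_zero (by
    filter_upwards [hg.ae_differentiableAt, (hi a b).ae_hasDerivAt_integral] with s h1 h2 hs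
    have h3 := h1.hasDerivAt.sub (h2 hs a left_mem_uIcc)
    rw [sub_self] at h3
    exact h3)
  have e1 := hc a left_mem_uIcc
  have e2 := hc b right_mem_uIcc
  simp only [intervalIntegral.integral_same, sub_zero] at e1 e2
  rw [e1, ← e2, sub_sub_cancel]

end Lipschitz

/-! ### Recovering a path from an integrated bound on its Caputo derivative. -/

section Reconstruction

variable {n : ℕ} {T : ℝ} {α : ℝ}

/-- Uniqueness for Abel's equation: applying `I^(1 - α)` to `I^α w = 0` shows that all integrals of
`w` from 0 vanish. -/
lemma eqOn_zero_of_integral_fracKernel_eq_zero (hT : 0 < T) (hα : 0 < α) (hα₁ : α < 1)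
    {w : ℝ → Euc n} (hw : Continuous w)
    (h : ∀ s ∈ Icc 0 T, ∫ ξ in Ioc 0 s, fracKernel α (s - ξ) • w ξ = 0) :
    EqOn w 0 (Icc 0 T) := by
  obtain ⟨K, hK⟩ := (isCompact_Icc (a := (0 : ℝ)) (b := T)).exists_bound_of_continuousOn
    hw.continuousOn
  have hK' : ∀ᵐ ξ ∂(volume.restrict (Ioc 0 T)), ‖w ξ‖ ≤ K :=
    (ae_restrict_iff' measurableSet_Ioc).2
      (Eventually.of_forall fun ξ hξ => hK ξ (Ioc_subset_Icc_self hξ))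
  have hint (s : ℝ) (hs : s ∈ Icc 0 T) : ∫ ξ in Ioc 0 s, w ξ = 0 := by
    have h1 := integral_fracKernel_smul_stoppedFracInt hα hα₁ hs.1 hs.2
      hw.aestronglyMeasurable hK'
    have h2 : ∫ ξ in Ioc 0 s, fracKernel (1 - α) (s - ξ) • stoppedFracInt α T w ξ = 0 := by
      refine setIntegral_eq_zero_of_forall_eq_zero fun ξ hξ => ?_
      have hξT : ξ ≤ T := hξ.2.trans hs.2
      rw [stoppedFracInt_eq_of_le w le_rfl hξT, stoppedFracInt, h ξ ⟨hξ.1.le, hξT⟩, smul_zero,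
        smul_zero]
    rw [h2] at h1
    exact (smul_eq_zero.1 h1.symm).resolve_left (Real.Gamma_pos_of_pos (sub_pos.2 hα₁)).ne'
  have hIoo : EqOn w 0 (Ioo 0 T) := by
    intro s hs
    have h1 := (hw.integral_hasStrictDerivAt 0 s).hasDerivAt
    have h2 : (fun u => ∫ ξ in (0 : ℝ)..u, w ξ) =ᶠ[𝓝 s] fun _ => 0 := by
      filter_upwards [Ioo_mem_nhds hs.1 hs.2] with r hr
      rw [intervalIntegral.integral_of_le hr.1.le, hint r (Ioo_subset_Icc_self hr)]
    exact h1.unique ((hasDerivAt_const s (0 : Euc n)).congr_of_eventuallyEq h2)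
  rw [← closure_Ioo hT.ne]
  exact hIoo.closure hw continuous_zero

variable [hT : Fact (0 < T)]

/-- The inequality `‖J(s) - J(r)‖ ≤ Γ(1 - α) ∫_r^s w` for the primitive `J` of the (unnormalised)
Caputo derivative of `x`. -/
def CaputoBound (α : ℝ) (x : C(Icc (0 : ℝ) T, Euc n)) (w : ℝ → ℝ) : Prop :=
  ∀ r ∈ Icc 0 T, ∀ s ∈ Icc 0 T, r ≤ s →
    ‖caputoPrimitive α (IccExtend hT.out.le x) s - caputoPrimitive α (IccExtend hT.out.le x) r‖ ≤
      Real.Gamma (1 - α) * ∫ ξ in r..s, w ξ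

lemma caputoBound_of_ae_le (hα : 0 < α) (hα₁ : α < 1) {x : ACPath n T α} {w : ℝ → ℝ}
    (hw : Continuous w) (h : ∀ᵐ τ ∂(volume.restrict (Icc 0 T)), ‖caputo x τ‖ ≤ w τ) :
    CaputoBound α x.1 w := by
  intro r hr s hs hrs
  have hΓ := Real.Gamma_pos_of_pos (sub_pos.2 hα₁)
  obtain ⟨K, hK0, hK⟩ := exists_caputo_bound hα hα₁ x
  have hi := integrableOn_of_bound (aestronglyMeasurable_caputo hα hα₁ x) hK
  have h1 := caputoPrimitive_pathAt hα hα₁ x hs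
  have h2 := caputoPrimitive_pathAt hα hα₁ x hr
  unfold pathAt at h1 h2
  rw [h1, h2, ← smul_sub, norm_smul, Real.norm_of_nonneg hΓ.le]
  gcongr
  rw [← Ioc_union_Ioc_eq_Ioc hr.1 hrs, setIntegral_union (Ioc_disjoint_Ioc_of_le le_rfl)
    measurableSet_Ioc (hi.mono_set (Ioc_subset_Ioc_right hr.2))
    (hi.mono_set (Ioc_subset_Ioc hr.1 hs.2)), add_sub_cancel_left,
    intervalIntegral.integral_of_le hrs]
  refine norm_integral_le_of_norm_le (hw.integrableOn_Ioc) ?_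
  exact ae_restrict_of_ae_restrict_of_subset
    (Ioc_subset_Icc_self.trans (Icc_subset_Icc hr.1 hs.2)) h

/-- The integrated bound makes the normalised primitive Lipschitz, and its derivative is the
candidate density. The Abel uniqueness lemma, with exponent `1 - α`, shows that the fractional
integral of this density is `x - x(0)`. The integrated bound makes sense for every continuous `x`,
which is what allows uniform limits of paths to be tested for membership in `X_k`. -/
lemma exists_path_of_caputoBound (hα : 0 < α) (hα₁ : α < 1) {x : C(Icc (0 : ℝ) T, Euc n)}
    {w : ℝ → ℝ} (hw : Continuous w) (hx : CaputoBound α x w) :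
    ∃ y : ACPath n T α, y.1 = x ∧ ∀ᵐ τ ∂(volume.restrict (Icc 0 T)), ‖caputo y τ‖ ≤ w τ := by
  have hT0 : (0 : ℝ) ≤ T := hT.out.le
  have hΓ := Real.Gamma_pos_of_pos (sub_pos.2 hα₁)
  set X := IccExtend hT0 x with hX
  have hXc : Continuous X := x.continuous.Icc_extend'
  obtain ⟨M, hM⟩ := (isCompact_Icc (a := (0 : ℝ)) (b := T)).exists_bound_of_continuousOn
    hw.continuousOn
  obtain ⟨C, rfl⟩ : ∃ C : NNReal, (C : ℝ) = M :=
    ⟨⟨M, (norm_nonneg _).trans (hM 0 (left_mem_Icc.2 hT0))⟩, rfl⟩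
  have hint {r s : ℝ} (hr : r ∈ Icc 0 T) (hs : s ∈ Icc 0 T) (hrs : r ≤ s) :
      ∫ ξ in r..s, w ξ ≤ C * (s - r) := by
    refine (le_abs_self _).trans ?_
    rw [← Real.norm_eq_abs]
    refine (intervalIntegral.norm_integral_le_of_norm_le_const (C := (C : ℝ)) fun u hu => ?_).trans_eq
      (by rw [abs_of_nonneg (sub_nonneg.2 hrs)])
    rw [uIoc_of_le hrs] at hu
    exact hM u ⟨hr.1.trans hu.1.le, hu.2.trans hs.2⟩
  set J : ℝ → Euc n := fun s => (Real.Gamma (1 - α))⁻¹ • caputoPrimitive α X s with hJ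
  have hJle {r s : ℝ} (hr : r ∈ Icc 0 T) (hs : s ∈ Icc 0 T) (hrs : r ≤ s) :
      ‖J s - J r‖ ≤ ∫ ξ in r..s, w ξ := by
    rw [hJ, ← smul_sub, norm_smul, norm_inv, Real.norm_of_nonneg hΓ.le, inv_mul_le_iff₀ hΓ]
    exact hx r hr s hs hrs
  have hJlip : LipschitzOnWith C J (Icc 0 T) := by
    refine LipschitzOnWith.of_dist_le_mul fun s hs r hr => ?_
    rcases le_total r s with hrs | hrs
    · rw [dist_eq_norm, Real.dist_eq, abs_of_nonneg (sub_nonneg.2 hrs)]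
      exact (hJle hr hs hrs).trans (hint hr hs hrs)
    · rw [dist_comm, dist_comm s, dist_eq_norm, Real.dist_eq, abs_of_nonneg (sub_nonneg.2 hrs)]
      exact (hJle hs hr hrs).trans (hint hs hr hrs)
  -- Constant extension outside `[0, T]` makes the primitive Lipschitz on the whole line, so that
  -- its derivative is globally bounded and measurable.
  set g : ℝ → Euc n := fun s => J (projIcc 0 T hT0 s) with hg
  have hglip : LipschitzWith C g := by
    have h : LipschitzWith (C * 1) g := hJlip.to_restrict.comp (LipschitzWith.projIcc hT0)
    rwa [mul_one] at h
  have hgJ {s : ℝ} (hs : s ∈ Icc 0 T) : g s = J s := by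
    simp only [hg, projIcc_of_mem hT0 hs]
  have hg0 : g 0 = 0 := by
    rw [hgJ (left_mem_Icc.2 hT0)]
    simp [hJ, caputoPrimitive]
  set f := deriv g with hf
  have hfm : StronglyMeasurable f := stronglyMeasurable_deriv g
  have hfK (ξ : ℝ) : ‖f ξ‖ ≤ C := norm_deriv_le_of_lipschitz hglip
  have hfK' : ∀ᵐ ξ ∂(volume.restrict (Ioc 0 T)), ‖f ξ‖ ≤ C := Eventually.of_forall hfK
  have hcont := continuous_stoppedFracInt hα hα₁.le hT0 hfm.aestronglyMeasurable hfK'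
  have heq : EqOn (fun τ => X τ - X 0 - stoppedFracInt α T f τ) 0 (Icc 0 T) := by
    refine eqOn_zero_of_integral_fracKernel_eq_zero (α := 1 - α) hT.out (by linarith)
      (by linarith) (by fun_prop) fun s hs => ?_
    obtain ⟨B, hB⟩ := (isCompact_Icc (a := (0 : ℝ)) (b := s)).exists_bound_of_continuousOn
      (f := fun ξ => X ξ - X 0) (by fun_prop)
    obtain ⟨B', hB'⟩ := (isCompact_Icc (a := (0 : ℝ)) (b := s)).exists_bound_of_continuousOn
      hcont.continuousOn
    have i1 := integrableOn_fracKernel_smul (α := 1 - α) (f := fun ξ => X ξ - X 0) (a := 0) (b := s)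
      (K := B) (by linarith) (by fun_prop : Continuous fun ξ => X ξ - X 0).aestronglyMeasurable
      ((ae_restrict_iff' measurableSet_Ioc).2 (Eventually.of_forall fun ξ hξ =>
        hB ξ (Ioc_subset_Icc_self hξ))) s
    have i2 := integrableOn_fracKernel_smul (α := 1 - α) (a := 0) (b := s)
      (K := B') (by linarith) hcont.aestronglyMeasurable
      ((ae_restrict_iff' measurableSet_Ioc).2 (Eventually.of_forall fun ξ hξ =>
        hB' ξ (Ioc_subset_Icc_self hξ))) s
    simp_rw [smul_sub _ (X _ - X 0)]
    rw [integral_sub i1 i2, ← caputoPrimitive_eq hα X hs.1,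
      integral_fracKernel_smul_stoppedFracInt hα hα₁ hs.1 hs.2 hfm.aestronglyMeasurable hfK',
      ← intervalIntegral.integral_of_le hs.1, hf, integral_deriv_eq_sub_of_lipschitz hglip, hg0,
      sub_zero, hgJ hs, hJ, smul_inv_smul₀ hΓ.ne', sub_self]
  have hrep (τ : ℝ) (hτ : τ ∈ Icc 0 T) : X τ = X 0 + stoppedFracInt α T f τ := by
    have := heq hτ
    simp only [Pi.zero_apply] at this
    rw [← sub_eq_zero, ← this]
    abel
  obtain ⟨y, rfl⟩ : ∃ y : ACPath n T α, y.1 = x := by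
    refine ⟨⟨x, f, memLp_top_of_bound hfm.aestronglyMeasurable C (Eventually.of_forall hfK),
      fun τ => ?_⟩, rfl⟩
    have := hrep τ τ.2
    rw [rlIntegral_eq_stoppedFracInt hα₁ f τ.2.1 τ.2.2]
    rwa [hX, IccExtend_val, IccExtend_of_mem _ _ (left_mem_Icc.2 hT0)] at this
  refine ⟨y, rfl, ?_⟩
  have hae := caputo_ae_eq hα hα₁ (x := y) hfm.aestronglyMeasurable hfK' hrep
  rw [← restrict_Ioo_eq_restrict_Ioc] at hae
  rw [← restrict_Ioo_eq_restrict_Icc]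
  filter_upwards [hae, ae_restrict_of_ae hglip.ae_differentiableAt,
    ae_restrict_mem measurableSet_Ioo] with s h1 h2 hs
  rw [h1]
  refine norm_deriv_le_of_norm_sub_le_integral hw hs.2 h2 fun r hr => ?_
  have hr' : r ∈ Icc 0 T := ⟨hs.1.le.trans hr.1.le, hr.2.le⟩
  rw [hgJ hr', hgJ (Ioo_subset_Icc_self hs)]
  exact hJle (Ioo_subset_Icc_self hs) hr' hr.1.le

end Reconstruction
-- Compactness of the sets `X_k`.
section Compactness

variable {n : ℕ} {T : ℝ} {α : ℝ}

/-- Substituting `r = τ - ξ` and extending to the half-line gives a Gamma integral. The gain `l ^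
(-α)` drives the Grönwall argument. -/
lemma setIntegral_fracKernel_mul_exp_le (hα : 0 < α) {l : ℝ} (hl : 0 < l) (τ a b : ℝ) :
    IntegrableOn (fun ξ => fracKernel α (τ - ξ) * Real.exp (l * ξ)) (Ioc a b) ∧
    ∫ ξ in Ioc a b, fracKernel α (τ - ξ) * Real.exp (l * ξ) ≤
      Real.exp (l * τ) * ((1 / l) ^ α * Real.Gamma α) := by
  set h : ℝ → ℝ := (Ioi 0).indicator fun r => r ^ (α - 1) * Real.exp (-(l * r)) with hh
  have hΓ := Real.Gamma_pos_of_pos hα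
  have hval : ∫ r, h r = (1 / l) ^ α * Real.Gamma α := by
    rw [hh, integral_indicator measurableSet_Ioi, Real.integral_rpow_mul_exp_neg_mul_Ioi hα hl]
  have hint : Integrable h := by
    by_contra hne
    rw [integral_undef hne] at hval
    have : 0 < (1 / l) ^ α * Real.Gamma α := by positivity
    exact this.ne hval
  have heq (ξ : ℝ) : fracKernel α (τ - ξ) * Real.exp (l * ξ) = Real.exp (l * τ) * h (τ - ξ) := by
    rcases le_or_gt (τ - ξ) 0 with h0 | h0
    · rw [fracKernel_of_nonpos h0, hh, indicator_of_notMem (by simpa using h0), zero_mul, mul_zero]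
    · rw [fracKernel_of_pos h0, hh, indicator_of_mem (by simpa using h0), mul_left_comm,
        ← Real.exp_add]
      ring_nf
  have hint' : Integrable fun ξ => Real.exp (l * τ) * h (τ - ξ) :=
    (hint.comp_sub_left τ).const_mul _
  simp_rw [heq]
  refine ⟨hint'.integrableOn, (setIntegral_le_integral hint' (Eventually.of_forall fun ξ => ?_)).trans_eq
    ?_⟩
  · exact mul_nonneg (Real.exp_nonneg _) (indicator_nonneg (fun r hr => mul_nonneg
      (Real.rpow_nonneg (le_of_lt hr) _) (Real.exp_nonneg _)) _)
  · rw [integral_const_mul, integral_sub_left_eq_self h volume τ, hval]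

/-- A Grönwall type inequality for fractional integrals. -/
lemma exists_bound_of_le_integral_fracKernel (hα : 0 < α) (hT : 0 ≤ T) {A B : ℝ} (hB : 0 ≤ B) :
    ∃ R, ∀ u : ℝ → ℝ, Continuous u → (∀ τ ∈ Icc 0 T, 0 ≤ u τ ∧
      u τ ≤ A + (Real.Gamma α)⁻¹ * ∫ ξ in Ioc 0 T, fracKernel α (τ - ξ) * (B * u ξ)) →
      ∀ τ ∈ Icc 0 T, u τ ≤ R := by
  have hΓ := Real.Gamma_pos_of_pos hα
  -- With this exponent `B l ^ (-α) = B / (2B + 1) ≤ 1/2`, so the maximum `m` of `exp(-lτ) u(τ)`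
  -- satisfies `m ≤ |A| + m/2`.
  set l : ℝ := (2 * B + 1) ^ (α⁻¹) with hl
  have hl0 : 0 < l := by positivity
  have hlα : (1 / l) ^ α = 1 / (2 * B + 1) := by
    rw [Real.div_rpow zero_le_one hl0.le, Real.one_rpow, hl, Real.rpow_inv_rpow (by positivity)
      hα.ne']
  refine ⟨2 * |A| * Real.exp (l * T), fun u hu h => ?_⟩
  obtain ⟨τ₀, hτ₀, hmax⟩ := (isCompact_Icc (a := (0 : ℝ)) (b := T)).exists_isMaxOn
    (nonempty_Icc.2 hT) (f := fun τ => Real.exp (-(l * τ)) * u τ) (by fun_prop)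
  set m := Real.exp (-(l * τ₀)) * u τ₀ with hm
  have hm0 : 0 ≤ m := mul_nonneg (Real.exp_nonneg _) (h τ₀ hτ₀).1
  have hle (τ : ℝ) (hτ : τ ∈ Icc 0 T) : u τ ≤ Real.exp (l * τ) * m := by
    have h1 : Real.exp (-(l * τ)) * u τ ≤ m := hmax hτ
    rwa [Real.exp_neg, inv_mul_le_iff₀ (Real.exp_pos _)] at h1
  obtain ⟨hi, hexp⟩ := setIntegral_fracKernel_mul_exp_le hα hl0 τ₀ 0 T
  have h1 : ∫ ξ in Ioc 0 T, fracKernel α (τ₀ - ξ) * (B * u ξ) ≤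
      ∫ ξ in Ioc 0 T, fracKernel α (τ₀ - ξ) * Real.exp (l * ξ) * (B * m) := by
    refine integral_mono_of_nonneg ?_ (hi.mul_const _) ?_
    · refine (ae_restrict_iff' measurableSet_Ioc).2 (Eventually.of_forall fun ξ hξ => ?_)
      exact mul_nonneg (fracKernel_nonneg _ _) (mul_nonneg hB (h ξ (Ioc_subset_Icc_self hξ)).1)
    · refine (ae_restrict_iff' measurableSet_Ioc).2 (Eventually.of_forall fun ξ hξ => ?_)
      have h2 := hle ξ (Ioc_subset_Icc_self hξ)
      have h3 := fracKernel_nonneg α (τ₀ - ξ)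
      exact (mul_le_mul_of_nonneg_left (mul_le_mul_of_nonneg_left h2 hB) h3).trans_eq (by ring)
  rw [integral_mul_const] at h1
  have h2 : u τ₀ ≤ A + (Real.Gamma α)⁻¹ *
      (Real.exp (l * τ₀) * ((1 / l) ^ α * Real.Gamma α) * (B * m)) := by
    refine (h τ₀ hτ₀).2.trans ?_
    gcongr
    exact h1.trans (mul_le_mul_of_nonneg_right hexp (by positivity))
  have h3 : m ≤ |A| + m / 2 := by
    have e1 : Real.exp (-(l * τ₀)) ≤ 1 := Real.exp_le_one_iff.2 (by nlinarith [hτ₀.1])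
    calc m ≤ Real.exp (-(l * τ₀)) * (A + (Real.Gamma α)⁻¹ *
          (Real.exp (l * τ₀) * ((1 / l) ^ α * Real.Gamma α) * (B * m))) :=
          mul_le_mul_of_nonneg_left h2 (Real.exp_nonneg _)
      _ = Real.exp (-(l * τ₀)) * A + 1 / (2 * B + 1) * (B * m) := by
        rw [hlα, Real.exp_neg]; field_simp
      _ ≤ |A| + m / 2 := by
        gcongr ?_ + ?_
        · exact (mul_le_mul_of_nonneg_left (le_abs_self A) (Real.exp_nonneg _)).trans
            (mul_le_of_le_one_left (abs_nonneg A) e1)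
        · rw [one_div_mul_eq_div, div_le_div_iff₀ (by positivity) two_pos]
          nlinarith
  intro τ hτ
  calc u τ ≤ Real.exp (l * τ) * m := hle τ hτ
    _ ≤ Real.exp (l * T) * (2 * |A|) := by
      gcongr
      · exact hτ.2
      · linarith
    _ = _ := by ring

variable [hT : Fact (0 < T)]

/-- For `u = 1 + ‖x‖` the growth condition becomes linear, and the Grönwall inequality applies with
`A = 1 + k` and `B = k c`. -/
lemma exists_bound_of_mem_boundedPaths (hα : 0 < α) (hα₁ : α < 1) {c : ℝ} (hc : 0 ≤ c) (k : ℕ) :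
    ∃ R, ∀ x ∈ boundedPaths (n := n) (T := T) (α := α) c k, ∀ τ, ‖pathAt x τ‖ ≤ R := by
  have hΓ := Real.Gamma_pos_of_pos hα
  obtain ⟨R, hR⟩ := exists_bound_of_le_integral_fracKernel (α := α) (T := T) hα hT.out.le
    (A := 1 + k) (B := k * c) (by positivity)
  have hI (x : ACPath n T α) (hx : x ∈ boundedPaths c k) : ∀ τ ∈ Icc 0 T, ‖pathAt x τ‖ ≤ R := by
    intro τ hτ
    have hxc := continuous_pathAt x
    have h1 := hR (fun τ => 1 + ‖pathAt x τ‖) (by fun_prop) (fun τ hτ => ⟨by positivity, ?_⟩) τ hτ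
    · linarith
    · have h2 : ‖stoppedFracInt α T (caputo x) τ‖ ≤ (Real.Gamma α)⁻¹ *
          ∫ ξ in Ioc 0 T, fracKernel α (τ - ξ) * (k * c * (1 + ‖pathAt x ξ‖)) := by
        rw [stoppedFracInt, norm_smul, norm_inv, Real.norm_of_nonneg hΓ.le]
        gcongr
        refine norm_integral_le_of_norm_le ?_ ?_
        · obtain ⟨B, hB⟩ := (isCompact_Icc (a := (0 : ℝ)) (b := T)).exists_bound_of_continuousOn
            (f := fun ξ => k * c * (1 + ‖pathAt x ξ‖)) (by fun_prop)
          exact integrableOn_fracKernel_smul hα (f := fun ξ => k * c * (1 + ‖pathAt x ξ‖))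
            (K := B) (by fun_prop : Continuous fun ξ => k * c * (1 + ‖pathAt x ξ‖)).aestronglyMeasurable
            ((ae_restrict_iff' measurableSet_Ioc).2 (Eventually.of_forall fun ξ hξ =>
              hB ξ (Ioc_subset_Icc_self hξ))) τ
        · rw [restrict_Ioc_eq_restrict_Icc]
          filter_upwards [hx.2] with ξ hξ
          rw [norm_smul, Real.norm_of_nonneg (fracKernel_nonneg _ _)]
          exact mul_le_mul_of_nonneg_left hξ (fracKernel_nonneg _ _)
      rw [pathAt_eq_stoppedFracInt hα hα₁ x hτ]
      linarith [norm_add_le (pathAt x 0) (stoppedFracInt α T (caputo x) τ), hx.1]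
  refine ⟨R, fun x hx τ => ?_⟩
  have h1 := hI x hx (projIcc 0 T hT.out.le τ) (projIcc 0 T hT.out.le τ).2
  unfold pathAt at h1 ⊢
  rwa [IccExtend_val] at h1

/-- The image of `boundedPaths c k` in the space of continuous functions. -/
lemma image_boundedPaths (hα : 0 < α) (hα₁ : α < 1) (c : ℝ) (k : ℕ) :
    Subtype.val '' boundedPaths (n := n) (T := T) (α := α) c k =
      {x : C(Icc (0 : ℝ) T, Euc n) | ‖IccExtend hT.out.le x 0‖ ≤ k ∧
        CaputoBound α x fun τ => k * c * (1 + ‖IccExtend hT.out.le x τ‖)} := by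
  ext x
  have hc (x : C(Icc (0 : ℝ) T, Euc n)) :
      Continuous fun τ => k * c * (1 + ‖IccExtend hT.out.le x τ‖) := by
    have : Continuous (IccExtend hT.out.le x) := x.continuous.Icc_extend'
    fun_prop
  constructor
  · rintro ⟨x, hx, rfl⟩
    exact ⟨hx.1, caputoBound_of_ae_le hα hα₁ (hc x.1) hx.2⟩
  · rintro ⟨h1, h2⟩
    obtain ⟨y, rfl, hy⟩ := exists_path_of_caputoBound hα hα₁ (hc x) h2
    exact ⟨y, ⟨h1, hy⟩, rfl⟩

lemma continuous_IccExtend_apply :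
    Continuous fun p : C(Icc (0 : ℝ) T, Euc n) × ℝ => IccExtend hT.out.le p.1 p.2 := by
  have h : Continuous fun p : C(Icc (0 : ℝ) T, Euc n) × ℝ => p.1 (projIcc 0 T hT.out.le p.2) := by
    have : Continuous (projIcc 0 T hT.out.le) := continuous_projIcc
    fun_prop
  exact h

lemma continuous_caputoPrimitive (hα : 0 < α) (hα₁ : α < 1) {s : ℝ} (hs : s ∈ Icc 0 T) :
    Continuous fun x : C(Icc (0 : ℝ) T, Euc n) => caputoPrimitive α (IccExtend hT.out.le x) s := by
  have hα₂ : 0 < 1 - α := sub_pos.2 hα₁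
  have hb (x : C(Icc (0 : ℝ) T, Euc n)) (ξ : ℝ) :
      ‖IccExtend hT.out.le x ξ - IccExtend hT.out.le x 0‖ ≤ 2 * ‖x‖ := by
    refine (norm_sub_le _ _).trans ?_
    rw [two_mul]
    exact add_le_add (ContinuousMap.norm_coe_le_norm x _) (ContinuousMap.norm_coe_le_norm x _)
  have hm (x : C(Icc (0 : ℝ) T, Euc n)) :
      Continuous fun ξ => IccExtend hT.out.le x ξ - IccExtend hT.out.le x 0 :=
    (x.continuous.Icc_extend' (h := hT.out.le)).sub continuous_const
  have hi (x : C(Icc (0 : ℝ) T, Euc n)) := integrableOn_fracKernel_smul (a := 0) (b := s) hα₂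
    (hm x).aestronglyMeasurable (Eventually.of_forall (hb x)) s
  have hlip : LipschitzWith (Real.toNNReal (s ^ (1 - α) / (1 - α) * 2))
      fun x : C(Icc (0 : ℝ) T, Euc n) => caputoPrimitive α (IccExtend hT.out.le x) s := by
    refine LipschitzWith.of_dist_le_mul fun x y => ?_
    rw [dist_eq_norm, caputoPrimitive_eq hα _ hs.1, caputoPrimitive_eq hα _ hs.1,
      ← integral_sub (hi x) (hi y), Real.coe_toNNReal _
        (mul_nonneg (div_nonneg (Real.rpow_nonneg hs.1 _) hα₂.le) two_pos.le), dist_eq_norm]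
    simp_rw [← smul_sub]
    have h1 := norm_integral_fracKernel_smul_le hα₂ (a := 0) (b := s)
      (Eventually.of_forall (hb (x - y))) s
    have h2 := setIntegral_fracKernel_sub_le hα₂ (by linarith) s hs.1
    rw [sub_zero] at h2
    calc _ = ‖∫ ξ in Ioc 0 s, fracKernel (1 - α) (s - ξ) •
          (IccExtend hT.out.le (x - y) ξ - IccExtend hT.out.le (x - y) 0)‖ := by
          congr 2 with ξ : 1
          congr 1
          exact sub_sub_sub_comm _ _ _ _
      _ ≤ _ := h1
      _ ≤ s ^ (1 - α) / (1 - α) * (2 * ‖x - y‖) := by gcongr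
      _ = _ := by ring
  exact hlip.continuous

/-- The common bound on the paths turns the growth condition into a common bound on Caputo
derivatives, hence a common Hölder modulus. Closedness in the space of continuous functions comes
from `image_boundedPaths`, whose conditions are inequalities between continuous functions of the
path. Arzelà–Ascoli concludes. -/
lemma isCompact_boundedPaths (hα : 0 < α) (hα₁ : α < 1) {c : ℝ} (hc : 0 ≤ c) (k : ℕ) :
    IsCompact (boundedPaths (n := n) (T := T) (α := α) c k) := by
  have hΓ := Real.Gamma_pos_of_pos hα
  rw [Subtype.isCompact_iff]
  have hclosed : IsClosed (Subtype.val '' boundedPaths (n := n) (T := T) (α := α) c k) := by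
    rw [image_boundedPaths hα hα₁]
    have hev (τ : ℝ) : Continuous fun x : C(Icc (0 : ℝ) T, Euc n) => IccExtend hT.out.le x τ :=
      continuous_IccExtend_apply.comp (continuous_id.prodMk continuous_const)
    suffices h : IsClosed {x : C(Icc (0 : ℝ) T, Euc n) |
        CaputoBound α x fun τ => k * c * (1 + ‖IccExtend hT.out.le x τ‖)} from
      (isClosed_le (hev 0).norm continuous_const).inter h
    simp only [CaputoBound, ofPred_forall]
    refine isClosed_iInter fun r => isClosed_iInter fun hr => isClosed_iInter fun s =>
      isClosed_iInter fun hs => isClosed_iInter fun hrs => isClosed_le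
        ((continuous_caputoPrimitive hα hα₁ hs).sub (continuous_caputoPrimitive hα hα₁ hr)).norm ?_
    refine continuous_const.mul (intervalIntegral.continuous_parametric_intervalIntegral_of_continuous'
      ?_ r s)
    exact continuous_const.mul (continuous_const.add continuous_IccExtend_apply.norm)
  obtain ⟨R, hR⟩ := exists_bound_of_mem_boundedPaths (n := n) (T := T) hα hα₁ hc k
  set K : ℝ := k * c * (1 + |R|) with hK
  have hK0 : 0 ≤ K := by positivity
  have hbound (x : ACPath n T α) (hx : x ∈ boundedPaths c k) :
      ∀ᵐ ξ ∂(volume.restrict (Ioc 0 T)), ‖caputo x ξ‖ ≤ K := by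
    rw [restrict_Ioc_eq_restrict_Icc]
    filter_upwards [hx.2] with ξ hξ
    refine hξ.trans ?_
    rw [hK]
    gcongr
    exact (hR x hx ξ).trans (le_abs_self R)
  set e := (ContinuousMap.isometryEquivBoundedOfCompact (Icc (0 : ℝ) T) (Euc n)).toHomeomorph
    with he
  rw [← e.isCompact_image]
  refine BoundedContinuousFunction.arzela_ascoli₂ (Metric.closedBall 0 R)
    (isCompact_closedBall 0 R) _ (e.isClosed_image.2 hclosed) ?_ ?_
  · rintro _ τ ⟨_, ⟨x, hx, rfl⟩, rfl⟩
    rw [mem_closedBall_zero_iff]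
    have := hR x hx τ
    rwa [pathAt_of_mem x τ.2] at this
  · refine Metric.equicontinuous_of_continuity_modulus
      (fun d => (Real.Gamma α)⁻¹ * (3 * (d ^ α / α) * K)) ?_ _ ?_
    · have h1 : Continuous fun d : ℝ => (Real.Gamma α)⁻¹ * (3 * (d ^ α / α) * K) := by
        have : Continuous fun d : ℝ => d ^ α := Real.continuous_rpow_const hα.le
        fun_prop
      refine (h1.tendsto 0).trans_eq ?_
      simp [Real.zero_rpow hα.ne']
    · rintro τ τ' ⟨_, _, ⟨x, hx, rfl⟩, rfl⟩
      have e1 (σ : Icc (0 : ℝ) T) : x.1 σ = pathAt x 0 + stoppedFracInt α T (caputo x) σ := by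
        rw [← pathAt_eq_stoppedFracInt hα hα₁ x σ.2, pathAt_of_mem x σ.2]
      change dist (x.1 τ) (x.1 τ') ≤ _
      rw [dist_eq_norm, e1, e1, add_sub_add_left_eq_sub, Subtype.dist_eq, Real.dist_eq]
      exact norm_stoppedFracInt_sub_le hα hα₁.le hT.out.le hK0
        (aestronglyMeasurable_caputo hα hα₁ x) (hbound x hx) τ τ'

lemma exists_mem_boundedPaths (hα : 0 < α) (hα₁ : α < 1) {c : ℝ} (hc : 0 < c)
    (x : ACPath n T α) : ∃ k : ℕ, 1 ≤ k ∧ x ∈ boundedPaths c k := by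
  obtain ⟨K, hK0, hK⟩ := exists_caputo_bound hα hα₁ x
  obtain ⟨k, hk⟩ := exists_nat_ge (max 1 (max ‖pathAt x 0‖ (K / c)))
  have h1 : (1 : ℝ) ≤ k := (le_max_left _ _).trans hk
  have h2 : ‖pathAt x 0‖ ≤ k := ((le_max_left _ _).trans (le_max_right _ _)).trans hk
  have h3 : K / c ≤ k := ((le_max_right _ _).trans (le_max_right _ _)).trans hk
  refine ⟨k, by exact_mod_cast h1, h2, ?_⟩
  rw [← restrict_Ioc_eq_restrict_Icc]
  filter_upwards [hK] with τ hτ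
  rw [div_le_iff₀ hc] at h3
  refine hτ.trans (h3.trans (le_mul_of_one_le_right (by positivity) ?_))
  linarith [norm_nonneg (pathAt x τ)]

end Compactness
-- The weight measure and continuity of the kernel in its `L¹` space.
section WeightMeasure

variable {α T : ℝ}

lemma continuousAt_fracKernel {r : ℝ} (hr : r ≠ 0) : ContinuousAt (fracKernel α) r := by
  rcases hr.lt_or_gt with h | h
  · refine (continuousAt_const (y := (0 : ℝ))).congr ?_
    filter_upwards [Iio_mem_nhds h] with s hs
    exact (fracKernel_of_nonpos (le_of_lt hs)).symm
  · refine (Real.continuousAt_rpow_const r (α - 1) (Or.inl hr)).congr ?_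
    filter_upwards [Ioi_mem_nhds h] with s hs
    exact (fracKernel_of_pos hs).symm

/-- Scheffé's lemma for a family of nonnegative functions. -/
lemma tendsto_integral_abs_sub_of_tendsto_integral {X ι : Type*} [MeasurableSpace X]
    {μ : Measure X} {l : Filter ι} [l.IsCountablyGenerated] {F : ι → X → ℝ} {f : X → ℝ}
    (hF : ∀ᶠ i in l, Integrable (F i) μ) (hF0 : ∀ i x, 0 ≤ F i x) (hf : Integrable f μ)
    (hlim : ∀ᵐ x ∂μ, Tendsto (fun i => F i x) l (𝓝 (f x)))
    (hint : Tendsto (fun i => ∫ x, F i x ∂μ) l (𝓝 (∫ x, f x ∂μ))) :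
    Tendsto (fun i => ∫ x, |F i x - f x| ∂μ) l (𝓝 0) := by
  -- `|F - f| = (F - f) + 2 (f - F)⁺`. The first integral converges by hypothesis; the positive part
  -- is dominated by `|f|` because `F ≥ 0`.
  have hneg : Tendsto (fun i => ∫ x, max (f x - F i x) 0 ∂μ) l (𝓝 (∫ _, (0 : ℝ) ∂μ)) := by
    refine tendsto_integral_filter_of_dominated_convergence (fun x => |f x|) ?_ ?_ hf.abs ?_
    · filter_upwards [hF] with i hi
      exact ((hf.sub hi).pos_part).aestronglyMeasurable
    · filter_upwards with i
      filter_upwards with x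
      rw [Real.norm_of_nonneg (le_max_right _ _)]
      exact max_le ((sub_le_self _ (hF0 i x)).trans (le_abs_self _)) (abs_nonneg _)
    · filter_upwards [hlim] with x hx
      have h1 : Tendsto (fun i => max (f x - F i x) 0) l (𝓝 (max (f x - f x) 0)) :=
        (tendsto_const_nhds.sub hx).max tendsto_const_nhds
      simpa using h1
  rw [integral_zero] at hneg
  have h2 := (hint.sub_const (∫ x, f x ∂μ)).add (hneg.const_mul 2)
  rw [sub_self, mul_zero, add_zero] at h2
  refine h2.congr' ?_
  filter_upwards [hF] with i hi
  have i1 : Integrable (fun x => F i x - f x) μ := hi.sub hf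
  have i2 : Integrable (fun x => 2 * max (f x - F i x) 0) μ := ((hf.sub hi).pos_part).const_mul 2
  rw [← integral_sub hi hf, ← integral_const_mul, ← integral_add i1 i2]
  refine integral_congr_ae (Eventually.of_forall fun x => ?_)
  change F i x - f x + 2 * max (f x - F i x) 0 = |F i x - f x|
  rcases le_total (f x) (F i x) with h | h
  · rw [max_eq_right (by linarith), abs_of_nonneg (by linarith)]; ring
  · rw [max_eq_left (by linarith), abs_of_nonpos (by linarith)]; ring

/-- The measure `δ_T + (T - τ)^(α - 1) dτ` on `(0, T]`. -/
noncomputable def weightMeasure (α T : ℝ) : Measure ℝ :=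
  Measure.dirac T + (volume.restrict (Ioc 0 T)).withDensity
    fun τ => ((Real.toNNReal (fracKernel α (T - τ)) : NNReal) : ENNReal)

lemma measurable_toNNReal_fracKernel (α T : ℝ) :
    Measurable fun τ => Real.toNNReal (fracKernel α (T - τ)) := by fun_prop

section

variable {E : Type*} [NormedAddCommGroup E] [NormedSpace ℝ E]

lemma toNNReal_fracKernel_smul (τ : ℝ) (v : E) :
    Real.toNNReal (fracKernel α (T - τ)) • v = fracKernel α (T - τ) • v := by
  rw [NNReal.smul_def, Real.coe_toNNReal _ (fracKernel_nonneg _ _)]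

lemma integrable_weightMeasure_iff {g : ℝ → E} (hg : StronglyMeasurable g) :
    Integrable g (weightMeasure α T) ↔
      IntegrableOn (fun τ => fracKernel α (T - τ) • g τ) (Ioc 0 T) := by
  rw [weightMeasure, integrable_add_measure,
    integrable_withDensity_iff_integrable_smul (measurable_toNNReal_fracKernel α T)]
  simp_rw [toNNReal_fracKernel_smul]
  refine and_iff_right ?_
  exact integrable_dirac' hg (by simp)

lemma integral_weightMeasure [CompleteSpace E] {g : ℝ → E} (hg : StronglyMeasurable g)
    (hi : Integrable g (weightMeasure α T)) :
    ∫ τ, g τ ∂(weightMeasure α T) = g T + ∫ τ in Ioc 0 T, fracKernel α (T - τ) • g τ := by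
  have hi' := hi
  rw [weightMeasure, integrable_add_measure] at hi'
  rw [weightMeasure, integral_add_measure hi'.1 hi'.2, integral_dirac' _ _ hg,
    integral_withDensity_eq_integral_smul (measurable_toNNReal_fracKernel α T)]
  simp_rw [toNNReal_fracKernel_smul]

end

lemma isFiniteMeasure_weightMeasure (hα : 0 < α) : IsFiniteMeasure (weightMeasure α T) := by
  have h : Integrable (fun _ : ℝ => (1 : ℝ)) (weightMeasure α T) := by
    rw [integrable_weightMeasure_iff stronglyMeasurable_const]
    simpa using integrableOn_fracKernel_sub hα T 0 T
  rwa [integrable_const_iff_isFiniteMeasure one_ne_zero] at h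

lemma ae_weightMeasure_ne {t : ℝ} (ht : t ≠ T) : ∀ᵐ τ ∂(weightMeasure α T), τ ≠ t := by
  rw [weightMeasure, ae_add_measure_iff]
  constructor
  · exact (ae_dirac_iff (p := fun τ => τ ≠ t) (measurableSet_singleton t).compl).2 ht.symm
  · exact (withDensity_absolutelyContinuous _ _).ae_le (Measure.ae_ne _ t)

lemma stronglyMeasurable_fracKernel_sub (α t : ℝ) :
    StronglyMeasurable fun τ => fracKernel α (τ - t) :=
  Measurable.stronglyMeasurable (by fun_prop)

lemma integrable_fracKernel_weightMeasure (hα : 0 < α) {t : ℝ} (ht : t < T) :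
    Integrable (fun τ => fracKernel α (τ - t)) (weightMeasure α T) := by
  rw [integrable_weightMeasure_iff (stronglyMeasurable_fracKernel_sub α t)]
  refine (integrable_fracKernel_mul_fracKernel hα hα ht).integrableOn.congr ?_
  exact Eventually.of_forall fun τ => mul_comm _ _

/-- The atom at `T` gives the first term and the density a Beta integral over `(t, T)`. The explicit
value is continuous in `t`, as Scheffé's lemma requires. -/
lemma integral_fracKernel_weightMeasure (hα : 0 < α) {t : ℝ} (ht : t ∈ Ico 0 T) :
    ∫ τ, fracKernel α (τ - t) ∂(weightMeasure α T) =
      (T - t) ^ (α - 1) + (T - t) ^ (α + α - 1) * ProbabilityTheory.beta α α := by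
  rw [integral_weightMeasure (stronglyMeasurable_fracKernel_sub α t)
    (integrable_fracKernel_weightMeasure hα ht.2), fracKernel_of_pos (sub_pos.2 ht.2),
    ← integral_fracKernel_mul_fracKernel hα hα ht.2]
  congr 1
  simp_rw [smul_eq_mul, mul_comm (fracKernel α (T - _))]
  refine setIntegral_eq_integral_of_forall_compl_eq_zero fun τ hτ => ?_
  rcases le_or_gt τ 0 with h | h
  · rw [fracKernel_of_nonpos (by linarith [ht.1]), zero_mul]
  · rw [fracKernel_of_nonpos (r := T - τ) (by linarith [not_le.1 fun h1 => hτ ⟨h, h1⟩]), mul_zero]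

/-- Continuity of `t ↦ (· - t)_+^(α - 1)` as a map into `L¹` of the weight measure. -/
lemma tendsto_integral_abs_fracKernel_sub (hα : 0 < α) {t : ℝ} (ht : t ∈ Ico 0 T) :
    Tendsto (fun s => ∫ τ, |fracKernel α (τ - s) - fracKernel α (τ - t)| ∂(weightMeasure α T))
      (𝓝[Ico 0 T] t) (𝓝 0) := by
  -- The singularity moves with `s`, so no common majorant exists and Scheffé's lemma replaces
  -- dominated convergence. Pointwise convergence can fail only at `τ = t`, which is null since `t ≠
  -- T`.
  refine tendsto_integral_abs_sub_of_tendsto_integral ?_ (fun s τ => fracKernel_nonneg _ _)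
    (integrable_fracKernel_weightMeasure hα ht.2) ?_ ?_
  · filter_upwards [self_mem_nhdsWithin] with s hs
    exact integrable_fracKernel_weightMeasure hα hs.2
  · filter_upwards [ae_weightMeasure_ne ht.2.ne] with τ hτ
    have h1 : ContinuousAt (fun s => fracKernel α (τ - s)) t :=
      (continuousAt_fracKernel (sub_ne_zero.2 hτ)).comp (by fun_prop)
    exact h1.tendsto.mono_left nhdsWithin_le_nhds
  · rw [integral_fracKernel_weightMeasure hα ht]
    have h0 : T - t ≠ 0 := (sub_pos.2 ht.2).ne'
    have h1 : ContinuousAt (fun s : ℝ => T - s) t := by fun_prop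
    have h2 : ContinuousAt (fun s => (T - s) ^ (α - 1) +
        (T - s) ^ (α + α - 1) * ProbabilityTheory.beta α α) t :=
      (h1.rpow_const (Or.inl h0)).add ((h1.rpow_const (Or.inl h0)).mul continuousAt_const)
    refine (h2.tendsto.mono_left nhdsWithin_le_nhds).congr' ?_
    filter_upwards [self_mem_nhdsWithin] with s hs
    exact (integral_fracKernel_weightMeasure hα hs).symm

end WeightMeasure

/-! ### The smoothed norm and its gradient. -/

section SmoothNorm

variable {E : Type*} [NormedAddCommGroup E]

/-- The smooth approximation `√(ε² + ‖v‖²)` of the norm. -/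
noncomputable def smoothNorm (ε : ℝ) (v : E) : ℝ := √(ε ^ 2 + ‖v‖ ^ 2)

lemma smoothNorm_sq (ε : ℝ) (v : E) : smoothNorm ε v ^ 2 = ε ^ 2 + ‖v‖ ^ 2 :=
  Real.sq_sqrt (by positivity)

lemma smoothNorm_nonneg (ε : ℝ) (v : E) : 0 ≤ smoothNorm ε v := Real.sqrt_nonneg _

lemma norm_le_smoothNorm (ε : ℝ) (v : E) : ‖v‖ ≤ smoothNorm ε v :=
  Real.le_sqrt_of_sq_le (by nlinarith [sq_nonneg ε])

lemma le_smoothNorm (ε : ℝ) (v : E) : ε ≤ smoothNorm ε v :=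
  Real.le_sqrt_of_sq_le (by nlinarith [sq_nonneg ‖v‖])

@[simp]
lemma smoothNorm_zero {ε : ℝ} (hε : 0 ≤ ε) : smoothNorm ε (0 : E) = ε := by
  simp [smoothNorm, Real.sqrt_sq hε]

lemma smoothNorm_neg (ε : ℝ) (v : E) : smoothNorm ε (-v) = smoothNorm ε v := by
  simp [smoothNorm]

lemma continuous_smoothNorm (ε : ℝ) : Continuous (smoothNorm ε : E → ℝ) := by
  unfold smoothNorm
  fun_prop

lemma abs_smoothNorm_sub_le {ε : ℝ} (hε : 0 < ε) (u v : E) :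
    |smoothNorm ε u - smoothNorm ε v| ≤ ‖u - v‖ := by
  refine le_trans ?_ (abs_norm_sub_norm_le u v)
  have hs : 0 < smoothNorm ε u + smoothNorm ε v := by
    linarith [le_smoothNorm ε u, le_smoothNorm ε v]
  have h1 : (smoothNorm ε u - smoothNorm ε v) * (smoothNorm ε u + smoothNorm ε v) =
      (‖u‖ - ‖v‖) * (‖u‖ + ‖v‖) := by
    linear_combination smoothNorm_sq ε u - smoothNorm_sq ε v
  have h2 := congrArg abs h1
  rw [abs_mul, abs_mul, abs_of_pos hs, abs_of_nonneg (by positivity : 0 ≤ ‖u‖ + ‖v‖)] at h2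
  refine le_of_mul_le_mul_right (h2.trans_le ?_) hs
  exact mul_le_mul_of_nonneg_left (add_le_add (norm_le_smoothNorm ε u) (norm_le_smoothNorm ε v))
    (abs_nonneg _)

variable [InnerProductSpace ℝ E]

/-- The gradient of `smoothNorm`. -/
noncomputable def smoothNormGrad (ε : ℝ) (v : E) : E := (smoothNorm ε v)⁻¹ • v

lemma norm_smoothNormGrad_le {ε : ℝ} (hε : 0 < ε) (v : E) : ‖smoothNormGrad ε v‖ ≤ 1 := by
  have h := hε.trans_le (le_smoothNorm ε v)
  rw [smoothNormGrad, norm_smul, norm_inv, Real.norm_of_nonneg h.le, inv_mul_le_iff₀ h, mul_one]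
  exact norm_le_smoothNorm ε v

lemma smoothNormGrad_neg (ε : ℝ) (v : E) : smoothNormGrad ε (-v) = -smoothNormGrad ε v := by
  rw [smoothNormGrad, smoothNorm_neg, smul_neg, smoothNormGrad]

lemma norm_smoothNormGrad_sub_le {ε : ℝ} (hε : 0 < ε) (u v : E) :
    ‖smoothNormGrad ε u - smoothNormGrad ε v‖ ≤ 2 / ε * ‖u - v‖ := by
  have hu := hε.trans_le (le_smoothNorm ε u)
  have hv := hε.trans_le (le_smoothNorm ε v)
  have h1 : smoothNormGrad ε u - smoothNormGrad ε v =
      (smoothNorm ε u)⁻¹ • (u - v) + ((smoothNorm ε u)⁻¹ - (smoothNorm ε v)⁻¹) • v := by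
    rw [smoothNormGrad, smoothNormGrad, smul_sub, sub_smul]
    abel
  have hui : (smoothNorm ε u)⁻¹ ≤ ε⁻¹ := inv_anti₀ hε (le_smoothNorm ε u)
  have h2 : ‖(smoothNorm ε u)⁻¹ • (u - v)‖ ≤ ε⁻¹ * ‖u - v‖ := by
    rw [norm_smul, norm_inv, Real.norm_of_nonneg hu.le]
    gcongr
  have h3 : ‖((smoothNorm ε u)⁻¹ - (smoothNorm ε v)⁻¹) • v‖ ≤ ε⁻¹ * ‖u - v‖ := by
    rw [norm_smul, inv_sub_inv hu.ne' hv.ne', Real.norm_eq_abs, abs_div, abs_mul, abs_of_pos hu,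
      abs_of_pos hv, abs_sub_comm]
    calc _ ≤ ‖u - v‖ / (smoothNorm ε u * smoothNorm ε v) * smoothNorm ε v := by
          gcongr
          · exact abs_smoothNorm_sub_le hε u v
          · exact norm_le_smoothNorm ε v
      _ = (smoothNorm ε u)⁻¹ * ‖u - v‖ := by field_simp
      _ ≤ _ := by gcongr
  rw [h1]
  refine (norm_add_le _ _).trans ((add_le_add h2 h3).trans_eq ?_)
  ring

lemma continuous_smoothNormGrad {ε : ℝ} (hε : 0 < ε) :
    Continuous (smoothNormGrad ε : E → E) := by
  have h : LipschitzWith (2 / ε).toNNReal (smoothNormGrad ε : E → E) :=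
    LipschitzWith.of_dist_le_mul fun u v => by
      rw [dist_eq_norm, dist_eq_norm, Real.coe_toNNReal _ (by positivity)]
      exact norm_smoothNormGrad_sub_le hε u v
  exact h.continuous

/-- Multiplied by `S' + S ≥ 2ε`, the remainder becomes `‖d‖²` minus the product of the linear term
and `S' - S`; each of these is at most `‖d‖²` in absolute value. -/
lemma abs_smoothNorm_add_sub_le {ε : ℝ} (hε : 0 < ε) (u d : E) :
    |smoothNorm ε (u + d) - smoothNorm ε u - inner ℝ (smoothNormGrad ε u) d| ≤ ‖d‖ ^ 2 / ε := by
  set S := smoothNorm ε u with hS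
  set S' := smoothNorm ε (u + d) with hS'
  have hSε : ε ≤ S := le_smoothNorm ε u
  have hSε' : ε ≤ S' := le_smoothNorm ε (u + d)
  have hS0 : 0 < S := hε.trans_le hSε
  have hS0' : 0 < S' := hε.trans_le hSε'
  have hin : inner ℝ (smoothNormGrad ε u) d = inner ℝ u d / S := by
    rw [smoothNormGrad, real_inner_smul_left, inv_mul_eq_div]
  have hsq : (S' - S) * (S' + S) = 2 * inner ℝ u d + ‖d‖ ^ 2 := by
    have h1 := smoothNorm_sq ε (u + d)
    have h2 := smoothNorm_sq ε u
    rw [norm_add_sq_real] at h1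
    linear_combination h1 - h2
  have hCS : |inner ℝ u d| ≤ S * ‖d‖ :=
    (abs_real_inner_le_norm u d).trans (mul_le_mul_of_nonneg_right (norm_le_smoothNorm ε u)
      (norm_nonneg d))
  have hdiff : |S' - S| ≤ ‖d‖ := by
    have := abs_smoothNorm_sub_le hε (u + d) u
    rwa [add_sub_cancel_left] at this
  have key : (S' - S - inner ℝ u d / S) * (S' + S) =
      ‖d‖ ^ 2 - inner ℝ u d / S * (S' - S) := by
    field_simp
    linear_combination S * hsq
  have h3 : |inner ℝ u d / S * (S' - S)| ≤ ‖d‖ ^ 2 := by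
    rw [abs_mul, abs_div, abs_of_pos hS0, sq]
    gcongr
    rw [div_le_iff₀ hS0, mul_comm]
    exact hCS
  have h4 : |(S' - S - inner ℝ u d / S) * (S' + S)| ≤ 2 * ‖d‖ ^ 2 := by
    rw [key]
    refine (abs_sub _ _).trans ?_
    rw [abs_of_nonneg (sq_nonneg ‖d‖)]
    linarith
  rw [abs_mul, abs_of_pos (by positivity : 0 < S' + S)] at h4
  rw [hin, le_div_iff₀ hε]
  have h5 := mul_le_mul_of_nonneg_left (add_le_add hSε' hSε)
    (abs_nonneg (S' - S - inner ℝ u d / S))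
  linarith

end SmoothNorm
open scoped BoundedContinuousFunction

/-! ### The smoothed distance between free continuations. -/

section Potential

variable {α T : ℝ} {E : Type*} [NormedAddCommGroup E]

/-- The smoothed distance `∫ √(ε² + ‖v‖²) dμ` with respect to the weight measure. -/
noncomputable def potential (α T ε : ℝ) (v : ℝ →ᵇ E) : ℝ :=
  ∫ τ, smoothNorm ε (v τ) ∂(weightMeasure α T)

lemma integrable_norm_weightMeasure (hα : 0 < α) (v : ℝ →ᵇ E) :
    Integrable (fun τ => ‖v τ‖) (weightMeasure α T) := by
  have := isFiniteMeasure_weightMeasure (T := T) hα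
  exact Integrable.of_bound v.continuous.norm.aestronglyMeasurable ‖v‖
    (Eventually.of_forall fun τ => by simpa using v.norm_coe_le_norm τ)

lemma integrable_smoothNorm (hα : 0 < α) {ε : ℝ} (hε : 0 < ε) (v : ℝ →ᵇ E) :
    Integrable (fun τ => smoothNorm ε (v τ)) (weightMeasure α T) := by
  have := isFiniteMeasure_weightMeasure (T := T) hα
  refine Integrable.of_bound ((continuous_smoothNorm ε).comp v.continuous).aestronglyMeasurable
    (ε + ‖v‖) (Eventually.of_forall fun τ => ?_)
  have h1 := abs_smoothNorm_sub_le hε (v τ) 0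
  rw [smoothNorm_zero hε.le, sub_zero] at h1
  rw [Real.norm_of_nonneg (smoothNorm_nonneg _ _)]
  linarith [(abs_le.1 h1).2, v.norm_coe_le_norm τ]

lemma abs_potential_sub_le (hα : 0 < α) {ε : ℝ} (hε : 0 < ε) (u v : ℝ →ᵇ E) :
    |potential α T ε u - potential α T ε v| ≤ ∫ τ, ‖u τ - v τ‖ ∂(weightMeasure α T) := by
  rw [potential, potential, ← integral_sub (integrable_smoothNorm hα hε u)
    (integrable_smoothNorm hα hε v), ← Real.norm_eq_abs]
  exact norm_integral_le_of_norm_le (integrable_norm_weightMeasure hα (u - v))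
    (Eventually.of_forall fun τ => abs_smoothNorm_sub_le hε (u τ) (v τ))

lemma integral_norm_le (hα : 0 < α) (v : ℝ →ᵇ E) :
    ∫ τ, ‖v τ‖ ∂(weightMeasure α T) ≤ (weightMeasure α T).real univ * ‖v‖ := by
  have := isFiniteMeasure_weightMeasure (T := T) hα
  refine (integral_mono (integrable_norm_weightMeasure hα v) (integrable_const ‖v‖)
    fun τ => v.norm_coe_le_norm τ).trans_eq ?_
  rw [integral_const, smul_eq_mul]

lemma continuous_potential (hα : 0 < α) {ε : ℝ} (hε : 0 < ε) :
    Continuous (potential α T ε : (ℝ →ᵇ E) → ℝ) := by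
  have h : LipschitzWith ((weightMeasure α T).real univ).toNNReal
      (potential α T ε : (ℝ →ᵇ E) → ℝ) := LipschitzWith.of_dist_le_mul fun u v => by
    rw [Real.dist_eq, Real.coe_toNNReal _ measureReal_nonneg, dist_eq_norm]
    exact (abs_potential_sub_le hα hε u v).trans (integral_norm_le hα (u - v))
  exact h.continuous

lemma integral_norm_le_potential (hα : 0 < α) {ε : ℝ} (hε : 0 < ε) (v : ℝ →ᵇ E) :
    ∫ τ, ‖v τ‖ ∂(weightMeasure α T) ≤ potential α T ε v :=
  integral_mono (integrable_norm_weightMeasure hα v) (integrable_smoothNorm hα hε v)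
    fun τ => norm_le_smoothNorm ε (v τ)

lemma potential_zero {ε : ℝ} (hε : 0 ≤ ε) :
    potential α T ε (0 : ℝ →ᵇ E) = (weightMeasure α T).real univ * ε := by
  simp [potential, smoothNorm_zero hε]

lemma potential_neg (ε : ℝ) (v : ℝ →ᵇ E) : potential α T ε (-v) = potential α T ε v := by
  simp [potential, smoothNorm_neg]

variable [InnerProductSpace ℝ E]

/-- The ci-gradient of `potential` at time `t`. -/
noncomputable def potentialGrad (α T ε t : ℝ) (v : ℝ →ᵇ E) : E :=
  (Real.Gamma α)⁻¹ • ∫ τ, fracKernel α (τ - t) • smoothNormGrad ε (v τ) ∂(weightMeasure α T)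

lemma aestronglyMeasurable_smoothNormGrad {ε : ℝ} (hε : 0 < ε) (v : ℝ →ᵇ E) {μ : Measure ℝ} :
    AEStronglyMeasurable (fun τ => smoothNormGrad ε (v τ)) μ :=
  ((continuous_smoothNormGrad hε).comp v.continuous).aestronglyMeasurable

lemma integrable_fracKernel_smul_smoothNormGrad (hα : 0 < α) {ε : ℝ} (hε : 0 < ε) {t : ℝ}
    (ht : t < T) (v : ℝ →ᵇ E) :
    Integrable (fun τ => fracKernel α (τ - t) • smoothNormGrad ε (v τ)) (weightMeasure α T) := by
  refine (integrable_fracKernel_weightMeasure hα ht).mono'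
    ((stronglyMeasurable_fracKernel_sub α t).aestronglyMeasurable.smul
      (aestronglyMeasurable_smoothNormGrad hε v)) (Eventually.of_forall fun τ => ?_)
  rw [norm_smul, Real.norm_of_nonneg (fracKernel_nonneg _ _)]
  exact mul_le_of_le_one_right (fracKernel_nonneg _ _) (norm_smoothNormGrad_le hε _)

/-- The bound does not involve `ε` or `v`, since the gradient of the smoothed norm has length at
most 1. This keeps the gradients in a fixed ball as `ε → 0`. -/
lemma norm_potentialGrad_le (hα : 0 < α) {ε : ℝ} (hε : 0 < ε) {t : ℝ} (ht : t < T)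
    (v : ℝ →ᵇ E) : ‖potentialGrad α T ε t v‖ ≤
      (Real.Gamma α)⁻¹ * ∫ τ, fracKernel α (τ - t) ∂(weightMeasure α T) := by
  have hΓ := Real.Gamma_pos_of_pos hα
  rw [potentialGrad, norm_smul, norm_inv, Real.norm_of_nonneg hΓ.le]
  gcongr
  refine norm_integral_le_of_norm_le (integrable_fracKernel_weightMeasure hα ht)
    (Eventually.of_forall fun τ => ?_)
  rw [norm_smul, Real.norm_of_nonneg (fracKernel_nonneg _ _)]
  exact mul_le_of_le_one_right (fracKernel_nonneg _ _) (norm_smoothNormGrad_le hε _)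

/-- Again uniform in `ε`: two gradients with the same `v` at nearby times differ only through the
kernel. -/
lemma norm_potentialGrad_sub_time_le (hα : 0 < α) {ε : ℝ} (hε : 0 < ε) {s t : ℝ} (hs : s < T)
    (ht : t < T) (v : ℝ →ᵇ E) :
    ‖potentialGrad α T ε s v - potentialGrad α T ε t v‖ ≤ (Real.Gamma α)⁻¹ *
      ∫ τ, |fracKernel α (τ - s) - fracKernel α (τ - t)| ∂(weightMeasure α T) := by
  have hΓ := Real.Gamma_pos_of_pos hα
  rw [potentialGrad, potentialGrad, ← smul_sub, norm_smul, norm_inv, Real.norm_of_nonneg hΓ.le,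
    ← integral_sub (integrable_fracKernel_smul_smoothNormGrad hα hε hs v)
      (integrable_fracKernel_smul_smoothNormGrad hα hε ht v)]
  gcongr
  refine norm_integral_le_of_norm_le ((integrable_fracKernel_weightMeasure hα hs).sub
    (integrable_fracKernel_weightMeasure hα ht)).abs (Eventually.of_forall fun τ => ?_)
  rw [← sub_smul, norm_smul, Real.norm_eq_abs]
  exact mul_le_of_le_one_right (abs_nonneg _) (norm_smoothNormGrad_le hε _)

/-- The factor `2 / ε` is harmless: the estimate serves only for continuity of the ci-gradient at
fixed `ε`. -/
lemma norm_potentialGrad_sub_le (hα : 0 < α) {ε : ℝ} (hε : 0 < ε) {t : ℝ} (ht : t < T)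
    (u v : ℝ →ᵇ E) :
    ‖potentialGrad α T ε t u - potentialGrad α T ε t v‖ ≤ (Real.Gamma α)⁻¹ *
      ((∫ τ, fracKernel α (τ - t) ∂(weightMeasure α T)) * (2 / ε * ‖u - v‖)) := by
  have hΓ := Real.Gamma_pos_of_pos hα
  rw [potentialGrad, potentialGrad, ← smul_sub, norm_smul, norm_inv, Real.norm_of_nonneg hΓ.le,
    ← integral_sub (integrable_fracKernel_smul_smoothNormGrad hα hε ht u)
      (integrable_fracKernel_smul_smoothNormGrad hα hε ht v), ← integral_mul_const]
  gcongr
  refine norm_integral_le_of_norm_le ((integrable_fracKernel_weightMeasure hα ht).mul_const _)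
    (Eventually.of_forall fun τ => ?_)
  rw [← smul_sub, norm_smul, Real.norm_of_nonneg (fracKernel_nonneg _ _)]
  refine mul_le_mul_of_nonneg_left ((norm_smoothNormGrad_sub_le hε _ _).trans ?_)
    (fracKernel_nonneg _ _)
  gcongr
  exact (u - v).norm_coe_le_norm τ

lemma potentialGrad_neg (ε t : ℝ) (v : ℝ →ᵇ E) :
    potentialGrad α T ε t (-v) = -potentialGrad α T ε t v := by
  simp [potentialGrad, smoothNormGrad_neg, integral_neg]

lemma tendsto_potentialGrad_sub (hα : 0 < α) {ε : ℝ} (hε : 0 < ε) {ι : Type*} {l : Filter ι}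
    {s : ι → ℝ} {w : ι → ℝ →ᵇ E} {t : ℝ} (ht : t ∈ Ico 0 T) {v : ℝ →ᵇ E}
    (hs : Tendsto s l (𝓝[Ico 0 T] t)) (hw : Tendsto w l (𝓝 v)) :
    Tendsto (fun i => potentialGrad α T ε (s i) (w i)) l (𝓝 (potentialGrad α T ε t v)) := by
  rw [tendsto_iff_norm_sub_tendsto_zero]
  have h1 := ((tendsto_integral_abs_fracKernel_sub hα ht).comp hs).const_mul (Real.Gamma α)⁻¹
  have h2 := ((((tendsto_iff_norm_sub_tendsto_zero.1 hw).const_mul (2 / ε)).const_mul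
    (∫ τ, fracKernel α (τ - t) ∂(weightMeasure α T))).const_mul (Real.Gamma α)⁻¹)
  have h3 := h1.add h2
  simp only [mul_zero, add_zero] at h3
  refine squeeze_zero' (Eventually.of_forall fun _ => norm_nonneg _) ?_ h3
  filter_upwards [hs.eventually self_mem_nhdsWithin] with i hi
  exact (norm_sub_le_norm_sub_add_norm_sub _ (potentialGrad α T ε t (w i)) _).trans
    (add_le_add (norm_potentialGrad_sub_time_le hα hε hi.2 ht.2 _)
      (norm_potentialGrad_sub_le hα hε ht.2 _ _))

end Potential

/-! ### ci-smoothness of the test functionals. -/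

section CiDeriv

variable {n : ℕ} {T : ℝ} [hT : Fact (0 < T)] {α : ℝ}

lemma freeContinuation_eq_of_continuation (hα : 0 < α) (hα₁ : α < 1) {t : Icc (0 : ℝ) T}
    {x y : ACPath n T α} (hy : y ∈ continuations t x) :
    freeContinuation t y = freeContinuation t x := by
  funext τ
  rw [freeContinuation_eq hα hα₁, freeContinuation_eq hα hα₁, hy 0 ⟨le_rfl, t.2.1⟩]
  congr 1
  refine stoppedFracInt_congr ?_ τ
  rw [← restrict_Ioo_eq_restrict_Ioc, EventuallyEq, ae_restrict_iff' measurableSet_Ioo]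
  exact Eventually.of_forall fun s hs => caputo_eq_of_continuation hy hs

/-- The first-order expansion of `potential` along a path with bounded Caputo derivative. -/
lemma abs_potential_sub_sub_integral_le (hα : 0 < α) (hα₁ : α < 1) {ε : ℝ} (hε : 0 < ε)
    {y : ACPath n T α} {K : ℝ} (hK0 : 0 ≤ K)
    (hK : ∀ᵐ ξ ∂(volume.restrict (Ioc 0 T)), ‖caputo y ξ‖ ≤ K) {t s : Icc (0 : ℝ) T}
    (hts : t ≤ s) (hsT : (s : ℝ) < T) (b : ℝ →ᵇ Euc n) {δ m : ℝ}
    (hδ : ∀ ξ ∈ Ioc (t : ℝ) s,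
      ∫ τ, |fracKernel α (τ - ξ) - fracKernel α (τ - t)| ∂(weightMeasure α T) ≤ δ)
    (hm : ∀ ξ ∈ Ioc (t : ℝ) s, ∫ τ, fracKernel α (τ - ξ) ∂(weightMeasure α T) ≤ m) :
    |potential α T ε (freePath hα hα₁ (s, y) - b) - potential α T ε (freePath hα hα₁ (t, y) - b)
      - ∫ ξ in (t : ℝ)..s, inner ℝ (potentialGrad α T ε t (freePath hα hα₁ (t, y) - b))
        (caputo y ξ)| ≤
      (((Real.Gamma α)⁻¹ * K) ^ 2 / ε * (((s : ℝ) - t) ^ α / α) * m +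
        (Real.Gamma α)⁻¹ * K * δ) * ((s : ℝ) - t) := by
  have hΓ := Real.Gamma_pos_of_pos hα
  have hts' : (t : ℝ) ≤ s := hts
  have hfin := isFiniteMeasure_weightMeasure (T := T) hα
  set μ := weightMeasure α T with hμ
  set u := freePath hα hα₁ (t, y) - b with hu
  set f := caputo y with hf
  have hsub : Ioc (t : ℝ) s ⊆ Ioc 0 T := Ioc_subset_Ioc t.2.1 s.2.2
  have hfm : AEStronglyMeasurable f (volume.restrict (Ioc (t : ℝ) s)) :=
    (aestronglyMeasurable_caputo hα hα₁ y).mono_measure (Measure.restrict_mono_set volume hsub)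
  have hfK := ae_restrict_of_ae_restrict_of_subset hsub hK
  set d := freePath hα hα₁ (s, y) - freePath hα hα₁ (t, y) with hd
  have hdval (τ : ℝ) : d τ = (Real.Gamma α)⁻¹ • ∫ ξ in Ioc (t : ℝ) s, fracKernel α (τ - ξ) • f ξ :=
    freeContinuation_sub_eq hα hα₁ hts y τ
  have hdle (τ : ℝ) : ‖d τ‖ ≤ (Real.Gamma α)⁻¹ * K * ∫ ξ in Ioc (t : ℝ) s, fracKernel α (τ - ξ) := by
    rw [hdval, norm_smul, norm_inv, Real.norm_of_nonneg hΓ.le, mul_assoc, mul_comm K]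
    gcongr
    exact norm_integral_fracKernel_smul_le hα hfK τ
  -- The increment `d` is of order `(s - t) ^ α` in the sup norm but of order `s - t` in `L¹(μ)`.
  -- The product of the two bounds controls `∫ ‖d‖² dμ` by `o(s - t)`; squaring the sup bound would
  -- not suffice for `α ≤ 1/2`.
  have hdsup (τ : ℝ) : ‖d τ‖ ≤ (Real.Gamma α)⁻¹ * K * (((s : ℝ) - t) ^ α / α) := by
    refine (hdle τ).trans ?_
    gcongr
    exact setIntegral_fracKernel_sub_le hα hα₁.le τ hts'
  have hdint : ∫ τ, ‖d τ‖ ∂μ ≤ (Real.Gamma α)⁻¹ * K * (m * ((s : ℝ) - t)) := by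
    have hprod := integrable_prod_fracKernel hα hα₁.le (integrable_const (μ := μ) (1 : ℝ)) hts'
    simp only [one_mul] at hprod
    calc ∫ τ, ‖d τ‖ ∂μ ≤ ∫ τ, (Real.Gamma α)⁻¹ * K *
          (∫ ξ in Ioc (t : ℝ) s, fracKernel α (τ - ξ)) ∂μ :=
          integral_mono (integrable_norm_weightMeasure hα d) (hprod.integral_prod_left.const_mul _)
            hdle
      _ = (Real.Gamma α)⁻¹ * K * ∫ ξ in Ioc (t : ℝ) s, ∫ τ, fracKernel α (τ - ξ) ∂μ := by
          rw [integral_const_mul]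
          congr 1
          exact integral_integral_swap (f := fun τ ξ => fracKernel α (τ - ξ)) hprod
      _ ≤ (Real.Gamma α)⁻¹ * K * ∫ ξ in Ioc (t : ℝ) s, m := by
          refine mul_le_mul_of_nonneg_left ?_ (by positivity)
          have i0 : IntegrableOn (fun ξ => ∫ τ, fracKernel α (τ - ξ) ∂μ) (Ioc (t : ℝ) s) :=
            hprod.integral_prod_right
          exact setIntegral_mono_on i0 (integrable_const m) measurableSet_Ioc hm
      _ = _ := by simp [hts', mul_comm m]
  have hsplit : freePath hα hα₁ (s, y) - b = u + d := by rw [hu, hd]; abel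
  have hgi : Integrable (fun τ => smoothNormGrad ε (u τ)) μ :=
    Integrable.of_bound (aestronglyMeasurable_smoothNormGrad hε u) 1
      (Eventually.of_forall fun τ => norm_smoothNormGrad_le hε _)
  have hini : Integrable (fun τ => inner ℝ (smoothNormGrad ε (u τ)) (d τ)) μ := by
    refine (integrable_norm_weightMeasure hα d).mono'
      (hgi.aestronglyMeasurable.inner d.continuous.aestronglyMeasurable)
      (Eventually.of_forall fun τ => (norm_inner_le_norm _ _).trans ?_)
    exact mul_le_of_le_one_left (norm_nonneg _) (norm_smoothNormGrad_le hε _)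
  -- Fubini moves the integral over `μ` onto the kernel and produces the ci-gradient at the running
  -- time `ξ`; replacing `ξ` by `t` in it costs at most the modulus `δ`.
  have h1 : ∫ τ, inner ℝ (smoothNormGrad ε (u τ)) (d τ) ∂μ =
      ∫ ξ in Ioc (t : ℝ) s, inner ℝ (potentialGrad α T ε ξ u) (f ξ) := by
    simp_rw [hdval, real_inner_smul_right, potentialGrad, real_inner_smul_left]
    rw [integral_const_mul, integral_const_mul,
      integral_inner_integral_fracKernel_smul hα hα₁.le hgi hts' hfm hfK]
  have hfirst : |potential α T ε (u + d) - potential α T ε u -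
      ∫ τ, inner ℝ (smoothNormGrad ε (u τ)) (d τ) ∂μ| ≤
      ((Real.Gamma α)⁻¹ * K) ^ 2 / ε * (((s : ℝ) - t) ^ α / α) * m * ((s : ℝ) - t) := by
    have i1 : Integrable (fun τ => smoothNorm ε ((u + d) τ) - smoothNorm ε (u τ)) μ :=
      (integrable_smoothNorm (T := T) hα hε (u + d)).sub (integrable_smoothNorm hα hε u)
    rw [potential, potential, ← integral_sub (integrable_smoothNorm hα hε (u + d))
      (integrable_smoothNorm hα hε u), ← integral_sub i1 hini, ← Real.norm_eq_abs]
    have i2 : Integrable (fun τ => (Real.Gamma α)⁻¹ * K * (((s : ℝ) - t) ^ α / α) / ε * ‖d τ‖) μ :=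
      (integrable_norm_weightMeasure hα d).const_mul _
    refine (norm_integral_le_of_norm_le i2 (Eventually.of_forall fun τ => ?_)).trans ?_
    · refine (abs_smoothNorm_add_sub_le hε (u τ) (d τ)).trans ?_
      rw [sq, div_mul_eq_mul_div]
      gcongr
      exact hdsup τ
    · rw [integral_const_mul]
      have h0 : 0 ≤ ((s : ℝ) - t) ^ α := Real.rpow_nonneg (sub_nonneg.2 hts') _
      calc _ ≤ (Real.Gamma α)⁻¹ * K * (((s : ℝ) - t) ^ α / α) / ε *
            ((Real.Gamma α)⁻¹ * K * (m * ((s : ℝ) - t))) := by gcongr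
        _ = _ := by ring
  have hmem {ξ : ℝ} (hξ : ξ ∈ Ioc (t : ℝ) s) : ξ ∈ Ico 0 T :=
    ⟨t.2.1.trans hξ.1.le, hξ.2.trans_lt hsT⟩
  have hm0 (ξ : ℝ) (hξ : ξ ∈ Ioc (t : ℝ) s) : ‖potentialGrad α T ε ξ u‖ ≤ (Real.Gamma α)⁻¹ * m :=
    (norm_potentialGrad_le hα hε (hmem hξ).2 u).trans
      (mul_le_mul_of_nonneg_left (hm ξ hξ) (inv_nonneg.2 hΓ.le))
  have hgc : ContinuousOn (fun ξ => potentialGrad α T ε ξ u) (Ico 0 T) := fun ξ hξ =>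
    tendsto_potentialGrad_sub hα hε hξ tendsto_id tendsto_const_nhds
  have hgm : Integrable (fun ξ => inner ℝ (potentialGrad α T ε ξ u) (f ξ))
      (volume.restrict (Ioc (t : ℝ) s)) := by
    refine Integrable.of_bound (((hgc.mono fun ξ hξ => hmem hξ).aestronglyMeasurable
      measurableSet_Ioc).inner hfm) ((Real.Gamma α)⁻¹ * m * K) ?_
    filter_upwards [hfK, ae_restrict_mem measurableSet_Ioc] with ξ h2 hξ
    exact (norm_inner_le_norm _ _).trans (mul_le_mul (hm0 ξ hξ) h2 (norm_nonneg _)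
      ((norm_nonneg _).trans (hm0 ξ hξ)))
  have hgm0 : Integrable (fun ξ => inner ℝ (potentialGrad α T ε t u) (f ξ))
      (volume.restrict (Ioc (t : ℝ) s)) :=
    (Integrable.of_bound hfm K hfK).const_inner _
  have hsecond : |(∫ ξ in Ioc (t : ℝ) s, inner ℝ (potentialGrad α T ε ξ u) (f ξ)) -
      ∫ ξ in Ioc (t : ℝ) s, inner ℝ (potentialGrad α T ε t u) (f ξ)| ≤
      (Real.Gamma α)⁻¹ * K * δ * ((s : ℝ) - t) := by
    have i3 : Integrable (fun _ : ℝ => (Real.Gamma α)⁻¹ * δ * K)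
      (volume.restrict (Ioc (t : ℝ) s)) := integrable_const _
    rw [← integral_sub hgm hgm0, ← Real.norm_eq_abs]
    refine (norm_integral_le_of_norm_le i3 ?_).trans_eq ?_
    · filter_upwards [hfK, ae_restrict_mem measurableSet_Ioc] with ξ h2 hξ
      rw [← inner_sub_left]
      have h3 : ‖potentialGrad α T ε ξ u - potentialGrad α T ε t u‖ ≤ (Real.Gamma α)⁻¹ * δ :=
        (norm_potentialGrad_sub_time_le hα hε (hmem hξ).2 (hts'.trans_lt hsT) u).trans
          (mul_le_mul_of_nonneg_left (hδ ξ hξ) (inv_nonneg.2 hΓ.le))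
      exact (norm_inner_le_norm _ _).trans (mul_le_mul h3 h2 (norm_nonneg _)
        ((norm_nonneg _).trans h3))
    · simp only [integral_const, MeasurableSet.univ, measureReal_restrict_apply, univ_inter,
        Real.volume_real_Ioc_of_le hts', smul_eq_mul]
      ring
  rw [intervalIntegral.integral_of_le hts', hsplit]
  rw [h1] at hfirst
  rw [add_mul, ← sub_add_sub_cancel (potential α T ε (u + d) - potential α T ε u)
    (∫ ξ in Ioc (t : ℝ) s, inner ℝ (potentialGrad α T ε ξ u) (f ξ))]
  exact (abs_add_le _ _).trans (add_le_add hfirst hsecond)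

/-- The free continuation of `y` at time `t` is that of `x`, and it changes afterwards only through
the Caputo derivative of `y`. Hence there is no separate time derivative. -/
lemma hasCiDerivAt_potential (hα : 0 < α) (hα₁ : α < 1) {ε : ℝ} (hε : 0 < ε)
    (b : ℝ →ᵇ Euc n) {t : Icc (0 : ℝ) T} (ht : (t : ℝ) < T) (x : ACPath n T α) :
    HasCiDerivAt (fun z => potential α T ε (freePath hα hα₁ z - b)) t x 0
      (potentialGrad α T ε t (freePath hα hα₁ (t, x) - b)) := by
  intro y hy
  have hΓ := Real.Gamma_pos_of_pos hα
  have hfree : freePath hα hα₁ (t, x) = freePath hα hα₁ (t, y) := by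
    ext1 τ
    rw [freePath_apply, freePath_apply, freeContinuation_eq_of_continuation hα hα₁ hy]
  obtain ⟨K, hK0, hK⟩ := exists_caputo_bound hα hα₁ y
  set m₀ := ∫ τ, fracKernel α (τ - t) ∂(weightMeasure α T) with hm₀
  have hm₀0 : 0 ≤ m₀ := integral_nonneg fun τ => fracKernel_nonneg _ _
  set A := ((Real.Gamma α)⁻¹ * K) ^ 2 / ε * (m₀ + 1) + (Real.Gamma α)⁻¹ * K with hA
  have hA0 : 0 ≤ A := by positivity
  rw [isLittleO_iff]
  intro c hc
  -- The total error is at most `A δ (s - t)`, so `δ ≤ c / (A + 1)` is enough; `δ ≤ 1` bounds the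
  -- kernel mass at nearby times by `m₀ + 1`.
  set δ := min 1 (c / (A + 1)) with hδ
  have hδ0 : 0 < δ := lt_min one_pos (by positivity)
  have htI : (t : ℝ) ∈ Ico 0 T := ⟨t.2.1, ht⟩
  obtain ⟨ρ, hρ0, hρ⟩ := Metric.mem_nhdsWithin_iff.1
    ((tendsto_integral_abs_fracKernel_sub hα htI).eventually (gt_mem_nhds hδ0))
  have hpow : ∀ᶠ s : Icc (0 : ℝ) T in 𝓝 t, |(s : ℝ) - t| ^ α / α < δ := by
    have h1 : Continuous fun s : Icc (0 : ℝ) T => |(s : ℝ) - t| ^ α / α :=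
      ((by fun_prop : Continuous fun s : Icc (0 : ℝ) T => |(s : ℝ) - t|).rpow_const
        fun _ => Or.inr hα.le).div_const _
    refine h1.tendsto t |>.eventually (gt_mem_nhds ?_)
    simpa [Real.zero_rpow hα.ne'] using hδ0
  have hclose : ∀ᶠ s : Icc (0 : ℝ) T in 𝓝 t, (s : ℝ) < min T (t + ρ) :=
    continuous_subtype_val.tendsto t |>.eventually
      (gt_mem_nhds (lt_min ht (by linarith)))
  filter_upwards [nhdsWithin_le_nhds hpow, nhdsWithin_le_nhds hclose, self_mem_nhdsWithin]
    with s hs1 hs2 hs3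
  have hts : (t : ℝ) < s := hs3
  have hst0 : 0 < (s : ℝ) - t := sub_pos.2 hts
  have hsT : (s : ℝ) < T := hs2.trans_le (min_le_left _ _)
  have hsρ : (s : ℝ) < t + ρ := hs2.trans_le (min_le_right _ _)
  have hω (ξ : ℝ) (hξ : ξ ∈ Ioc (t : ℝ) s) :
      ∫ τ, |fracKernel α (τ - ξ) - fracKernel α (τ - t)| ∂(weightMeasure α T) ≤ δ := by
    refine le_of_lt (hρ ⟨?_, t.2.1.trans hξ.1.le, hξ.2.trans_lt hsT⟩)
    rw [Metric.mem_ball, Real.dist_eq, abs_of_pos (sub_pos.2 hξ.1)]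
    linarith [hξ.2]
  have hm (ξ : ℝ) (hξ : ξ ∈ Ioc (t : ℝ) s) :
      ∫ τ, fracKernel α (τ - ξ) ∂(weightMeasure α T) ≤ m₀ + 1 := by
    have hξT : ξ < T := hξ.2.trans_lt hsT
    have i1 := integrable_fracKernel_weightMeasure hα hξT
    have i2 := integrable_fracKernel_weightMeasure hα ht
    have h1 : ∫ τ, fracKernel α (τ - ξ) ∂(weightMeasure α T) - m₀ ≤ δ := by
      rw [hm₀, ← integral_sub i1 i2]
      exact (integral_mono (i1.sub i2) (i1.sub i2).abs fun τ => le_abs_self _).trans (hω ξ hξ)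
    linarith [min_le_left 1 (c / (A + 1))]
  have key := abs_potential_sub_sub_integral_le hα hα₁ hε hK0 hK hts.le hsT b hω hm
  simp only [zero_mul, sub_zero, Real.norm_eq_abs]
  rw [abs_of_pos hst0] at hs1 ⊢
  rw [hfree]
  refine key.trans (mul_le_mul_of_nonneg_right ?_ hst0.le)
  calc _ ≤ ((Real.Gamma α)⁻¹ * K) ^ 2 / ε * δ * (m₀ + 1) + (Real.Gamma α)⁻¹ * K * δ := by gcongr
    _ = A * δ := by rw [hA]; ring
    _ ≤ (A + 1) * (c / (A + 1)) := by gcongr; linarith; exact min_le_right _ _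
    _ = c := by field_simp

/-- The functional `M ∫ √(ε² + ‖a(τ | t, x) - b(τ)‖²) dμ + q(t)`. -/
noncomputable def testFunctional (hα : 0 < α) (hα₁ : α < 1) (ε M : ℝ) (b : ℝ →ᵇ Euc n)
    (q : ℝ → ℝ) (z : Icc (0 : ℝ) T × ACPath n T α) : ℝ :=
  M * potential α T ε (freePath hα hα₁ z - b) + q z.1

lemma hasCiDerivAt_testFunctional (hα : 0 < α) (hα₁ : α < 1) {ε : ℝ} (hε : 0 < ε) (M : ℝ)
    (b : ℝ →ᵇ Euc n) {q : ℝ → ℝ} {q' : ℝ} {t : Icc (0 : ℝ) T} (hq : HasDerivAt q q' t)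
    (ht : (t : ℝ) < T) (x : ACPath n T α) :
    HasCiDerivAt (testFunctional hα hα₁ ε M b q) t x q'
      (M • potentialGrad α T ε t (freePath hα hα₁ (t, x) - b)) := by
  intro y hy
  have h1 := (hasCiDerivAt_potential hα hα₁ hε b ht x y hy).const_mul_left M
  have h2 : (fun s : Icc (0 : ℝ) T => q s - q t - ((s : ℝ) - t) • q') =o[𝓝[>] t]
      fun s : Icc (0 : ℝ) T => (s : ℝ) - t :=
    hq.isLittleO.comp_tendsto (continuous_subtype_val.tendsto t |>.mono_left nhdsWithin_le_nhds)
  refine (h1.add h2).congr_left fun s => ?_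
  simp only [testFunctional, real_inner_smul_left, intervalIntegral.integral_const_mul,
    smul_eq_mul]
  ring

lemma isCiSmooth_testFunctional (hα : 0 < α) (hα₁ : α < 1) {ε : ℝ} (hε : 0 < ε) (M : ℝ)
    (b : ℝ →ᵇ Euc n) {q q' : ℝ → ℝ} (hq : ∀ s, HasDerivAt q (q' s) s) (hq' : Continuous q') :
    IsCiSmooth (testFunctional (T := T) hα hα₁ ε M b q) := by
  have hqc : Continuous q := continuous_iff_continuousAt.2 fun s => (hq s).continuousAt
  have hfree := continuous_freePath (n := n) (T := T) hα hα₁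
  refine ⟨?_, fun z => q' z.1, fun z => M • potentialGrad α T ε z.1 (freePath hα hα₁ z - b),
    fun t x ht => hasCiDerivAt_testFunctional hα hα₁ hε M b (hq t) ht x,
    by fun_prop, fun z hz => ?_⟩
  · exact (continuous_const.mul ((continuous_potential hα hε).comp
      (hfree.sub continuous_const))).add (by fun_prop)
  · refine Tendsto.const_smul (tendsto_potentialGrad_sub hα hε ⟨z.1.2.1, hz⟩
      (tendsto_nhdsWithin_iff.2 ⟨?_, ?_⟩) ?_) M
    · exact (continuous_subtype_val.comp continuous_fst).continuousAt.continuousWithinAt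
    · filter_upwards [self_mem_nhdsWithin] with w hw
      exact ⟨w.1.2.1, hw⟩
    · exact (hfree.sub continuous_const).continuousAt.continuousWithinAt

end CiDeriv
-- Doubling of variables and comparison.
section Comparison

variable {n : ℕ} {T : ℝ} {α : ℝ}

lemma continuous_integral_norm (hα : 0 < α) :
    Continuous fun v : ℝ →ᵇ Euc n => ∫ τ, ‖v τ‖ ∂(weightMeasure α T) := by
  have h : LipschitzWith ((weightMeasure α T).real univ).toNNReal
      fun v : ℝ →ᵇ Euc n => ∫ τ, ‖v τ‖ ∂(weightMeasure α T) :=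
    LipschitzWith.of_dist_le_mul fun u v => by
      rw [Real.dist_eq, Real.coe_toNNReal _ measureReal_nonneg, dist_eq_norm,
        ← integral_sub (integrable_norm_weightMeasure hα u) (integrable_norm_weightMeasure hα v),
        ← Real.norm_eq_abs]
      exact (norm_integral_le_of_norm_le (integrable_norm_weightMeasure hα (u - v))
        (Eventually.of_forall fun τ => abs_norm_sub_norm_le (u τ) (v τ))).trans
        (integral_norm_le hα (u - v))
  exact h.continuous

lemma tendsto_integral_abs_fracKernel_sub_sub (hα : 0 < α) {ι : Type*} {l : Filter ι} {t : ℝ}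
    (ht : t ∈ Ico 0 T) {r s : ι → ℝ} (hr : Tendsto r l (𝓝[Ico 0 T] t))
    (hs : Tendsto s l (𝓝[Ico 0 T] t)) :
    Tendsto (fun i => ∫ τ, |fracKernel α (τ - r i) - fracKernel α (τ - s i)| ∂(weightMeasure α T))
      l (𝓝 0) := by
  have h := ((tendsto_integral_abs_fracKernel_sub hα ht).comp hr).add
    ((tendsto_integral_abs_fracKernel_sub hα ht).comp hs)
  rw [add_zero] at h
  refine squeeze_zero' (Eventually.of_forall fun i => integral_nonneg fun τ => abs_nonneg _) ?_ h
  filter_upwards [hr.eventually self_mem_nhdsWithin, hs.eventually self_mem_nhdsWithin]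
    with i hi hi'
  have i0 := integrable_fracKernel_weightMeasure hα ht.2
  have i1 := integrable_fracKernel_weightMeasure hα hi.2
  have i2 := integrable_fracKernel_weightMeasure hα hi'.2
  simp only [Function.comp_apply]
  have j1 : Integrable (fun τ => |fracKernel α (τ - r i) - fracKernel α (τ - t)|)
    (weightMeasure α T) := (i1.sub i0).abs
  have j2 : Integrable (fun τ => |fracKernel α (τ - s i) - fracKernel α (τ - t)|)
    (weightMeasure α T) := (i2.sub i0).abs
  rw [← integral_add j1 j2]
  refine integral_mono (i1.sub i2).abs (j1.add j2) fun τ => ?_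
  rw [abs_sub_comm (fracKernel α (τ - s i))]
  exact abs_sub_le _ _ _

lemma tendsto_integral_fracKernel (hα : 0 < α) {ι : Type*} {l : Filter ι} {t : ℝ}
    (ht : t ∈ Ico 0 T) {r : ι → ℝ} (hr : Tendsto r l (𝓝[Ico 0 T] t)) :
    Tendsto (fun i => ∫ τ, fracKernel α (τ - r i) ∂(weightMeasure α T)) l
      (𝓝 (∫ τ, fracKernel α (τ - t) ∂(weightMeasure α T))) := by
  rw [tendsto_iff_norm_sub_tendsto_zero]
  refine squeeze_zero' (Eventually.of_forall fun i => norm_nonneg _) ?_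
    ((tendsto_integral_abs_fracKernel_sub hα ht).comp hr)
  filter_upwards [hr.eventually self_mem_nhdsWithin] with i hi
  have i0 := integrable_fracKernel_weightMeasure hα ht.2
  have i1 := integrable_fracKernel_weightMeasure hα hi.2
  rw [← integral_sub i1 i0]
  exact norm_integral_le_integral_norm _

variable [hT : Fact (0 < T)]

lemma integral_norm_weightMeasure (hα : 0 < α) (hα₁ : α < 1) (v : ℝ →ᵇ Euc n) :
    ∫ τ, ‖v τ‖ ∂(weightMeasure α T) = ‖v T‖ + ∫ τ in (0 : ℝ)..T, ‖v τ‖ / (T - τ) ^ (1 - α) := by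
  rw [integral_weightMeasure v.continuous.norm.stronglyMeasurable
    (integrable_norm_weightMeasure hα v), intervalIntegral.integral_of_le hT.out.le]
  congr 1
  refine setIntegral_congr_fun measurableSet_Ioc fun τ hτ => ?_
  rw [smul_eq_mul, ← inv_rpow_eq_fracKernel hα₁ (sub_nonneg.2 hτ.2), inv_mul_eq_div]

lemma ConditionL.exists_le_integral_norm (hα : 0 < α) (hα₁ : α < 1)
    {φ : Icc (0 : ℝ) T × ACPath n T α → ℝ} (h : ConditionL φ) {X : Set (ACPath n T α)}
    (hX : IsCompact X) :
    ∃ Λ : ℝ, 0 < Λ ∧ ∀ t : Icc (0 : ℝ) T, ∀ x ∈ X, ∀ y ∈ X, |φ (t, x) - φ (t, y)| ≤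
      Λ * ∫ τ, ‖(freePath hα hα₁ (t, x) - freePath hα hα₁ (t, y)) τ‖ ∂(weightMeasure α T) := by
  obtain ⟨Λ, hΛ0, hΛ⟩ := h X hX
  refine ⟨Λ, hΛ0, fun t x hx y hy => ?_⟩
  rw [integral_norm_weightMeasure hα hα₁]
  exact hΛ t x hx y hy

/-- The density of the weight measure is positive on `(0, T)`, so `v` vanishes almost everywhere
there, and everywhere on `[0, T]` by continuity. -/
lemma eqOn_zero_of_integral_norm_eq_zero (hα : 0 < α) (v : ℝ →ᵇ Euc n)
    (h : ∫ τ, ‖v τ‖ ∂(weightMeasure α T) = 0) : EqOn v 0 (Icc 0 T) := by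
  have hi := integrable_norm_weightMeasure (T := T) hα v
  have hi' := (integrable_weightMeasure_iff v.continuous.norm.stronglyMeasurable).1 hi
  rw [integral_weightMeasure v.continuous.norm.stronglyMeasurable hi] at h
  have hnn (τ : ℝ) : 0 ≤ fracKernel α (T - τ) • ‖v τ‖ :=
    mul_nonneg (fracKernel_nonneg _ _) (norm_nonneg _)
  have h0 : ∫ τ in Ioc 0 T, fracKernel α (T - τ) • ‖v τ‖ = 0 :=
    le_antisymm (by linarith [norm_nonneg (v T)]) (integral_nonneg hnn)
  rw [integral_eq_zero_iff_of_nonneg hnn hi', ← restrict_Ioo_eq_restrict_Ioc] at h0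
  refine Measure.eqOn_Icc_of_ae_eq volume hT.out.ne ?_ v.continuous.continuousOn
    continuousOn_const
  rw [← restrict_Ioo_eq_restrict_Icc]
  filter_upwards [h0, ae_restrict_mem measurableSet_Ioo] with τ h1 h2
  have h3 : 0 < T - τ := sub_pos.2 h2.2
  simp only [Pi.zero_apply, smul_eq_mul, mul_eq_zero, norm_eq_zero] at h1
  refine h1.resolve_left ?_
  rw [fracKernel_of_pos h3]
  exact (Real.rpow_pos_of_pos h3 _).ne'

lemma continuous_pathAt_eval :
    Continuous fun z : Icc (0 : ℝ) T × ACPath n T α => pathAt z.2 z.1 :=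
  continuous_IccExtend_apply.comp ((continuous_subtype_val.comp continuous_snd).prodMk
    (continuous_subtype_val.comp continuous_fst))

/-- Convergence along one ultrafilter replaces successive extraction of subsequences. -/
lemma exists_tendsto_of_eventually_mem {X ι : Type*} [TopologicalSpace X] {K : Set X}
    (hK : IsCompact K) (l : Ultrafilter ι) {u : ι → X} (hu : ∀ᶠ i in (l : Filter ι), u i ∈ K) :
    ∃ a ∈ K, Tendsto u l (𝓝 a) :=
  hK.ultrafilter_le_nhds (l.map u) (le_principal_iff.2 hu)

/-- The functional that is maximised in the doubling of variables. -/
noncomputable def doubling (hα : 0 < α) (hα₁ : α < 1)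
    (φ₁ φ₂ : Icc (0 : ℝ) T × ACPath n T α → ℝ) (M η ε : ℝ)
    (p : (Icc (0 : ℝ) T × ACPath n T α) × (Icc (0 : ℝ) T × ACPath n T α)) : ℝ :=
  φ₁ p.1 - φ₂ p.2 - M * potential α T ε (freePath hα hα₁ p.1 - freePath hα hα₁ p.2) -
    ((p.1.1 : ℝ) - p.2.1) ^ 2 / ε + η * ((p.1.1 : ℝ) + p.2.1)

lemma continuous_doubling (hα : 0 < α) (hα₁ : α < 1) {φ₁ φ₂ : Icc (0 : ℝ) T × ACPath n T α → ℝ}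
    (h₁ : Continuous φ₁) (h₂ : Continuous φ₂) (M η : ℝ) {ε : ℝ} (hε : 0 < ε) :
    Continuous (doubling hα hα₁ φ₁ φ₂ M η ε) := by
  have hfree := continuous_freePath (n := n) (T := T) hα hα₁
  have hp : Continuous fun p : (Icc (0 : ℝ) T × ACPath n T α) × (Icc (0 : ℝ) T × ACPath n T α) =>
      potential α T ε (freePath hα hα₁ p.1 - freePath hα hα₁ p.2) :=
    (continuous_potential hα hε).comp ((hfree.comp continuous_fst).sub (hfree.comp continuous_snd))
  unfold doubling
  fun_prop

lemma doubling_diag (hα : 0 < α) (hα₁ : α < 1) (φ₁ φ₂ : Icc (0 : ℝ) T × ACPath n T α → ℝ)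
    (M η : ℝ) {ε : ℝ} (hε : 0 ≤ ε) (z : Icc (0 : ℝ) T × ACPath n T α) :
    doubling hα hα₁ φ₁ φ₂ M η ε (z, z) =
      φ₁ z - φ₂ z - M * ((weightMeasure α T).real univ * ε) + 2 * η * z.1 := by
  simp only [doubling, sub_self, potential_zero hε]
  ring

/-- The viscosity inequalities at a maximum point of the doubling functional. -/
lemma two_mul_le_of_isMaxOn_doubling (hα : 0 < α) (hα₁ : α < 1) {c : ℝ}
    {H : Icc (0 : ℝ) T → Euc n → Euc n → ℝ} {σ : ACPath n T α → ℝ}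
    {φ₁ φ₂ : Icc (0 : ℝ) T × ACPath n T α → ℝ} (h₁ : IsViscositySolution c H σ φ₁)
    (h₂ : IsViscositySolution c H σ φ₂) {k : ℕ} (hk : 1 ≤ k) {M η ε : ℝ} (hε : 0 < ε)
    {z w : Icc (0 : ℝ) T × ACPath n T α} (hz : z.2 ∈ boundedPaths c k)
    (hw : w.2 ∈ boundedPaths c k) (hzT : (z.1 : ℝ) < T) (hwT : (w.1 : ℝ) < T)
    (hmax : IsMaxOn (doubling hα hα₁ φ₁ φ₂ M η ε)
      ((univ ×ˢ boundedPaths c k) ×ˢ (univ ×ˢ boundedPaths c k)) (z, w)) :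
    2 * η ≤ H z.1 (pathAt z.2 z.1)
        (M • potentialGrad α T ε z.1 (freePath hα hα₁ z - freePath hα hα₁ w)) -
      H w.1 (pathAt w.2 w.1)
        (M • potentialGrad α T ε w.1 (freePath hα hα₁ z - freePath hα hα₁ w)) := by
  have hq₁ (s : ℝ) : HasDerivAt (fun s : ℝ => (s - w.1) ^ 2 / ε - η * s)
      (2 * (s - w.1) / ε - η) s := by
    have h := ((((hasDerivAt_id s).sub_const (w.1 : ℝ)).pow 2).div_const ε).sub
      ((hasDerivAt_id s).const_mul η)
    refine h.congr_deriv ?_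
    simp
  have hq₂ (s : ℝ) : HasDerivAt (fun s : ℝ => -((s - z.1) ^ 2 / ε) + η * s)
      (-(2 * (s - z.1) / ε) + η) s := by
    have h := ((((hasDerivAt_id s).sub_const (z.1 : ℝ)).pow 2).div_const ε).neg.add
      ((hasDerivAt_id s).const_mul η)
    refine h.congr_deriv ?_
    simp
  have hzS : z ∈ (univ : Set (Icc (0 : ℝ) T)) ×ˢ boundedPaths (n := n) (α := α) c k :=
    ⟨mem_univ _, hz⟩
  have hwS : w ∈ (univ : Set (Icc (0 : ℝ) T)) ×ˢ boundedPaths (n := n) (α := α) c k :=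
    ⟨mem_univ _, hw⟩
  -- With `w` frozen, `φ₁` minus this test functional is maximal at `z`. Below, with `z` frozen,
  -- `φ₂` minus the functional with `-M` is minimal at `w`. Each contributes one `η`.
  have key₁ := h₁.sub (testFunctional hα hα₁ ε M (freePath hα hα₁ w)
      fun s => (s - w.1) ^ 2 / ε - η * s)
    (isCiSmooth_testFunctional hα hα₁ hε M _ hq₁ (by fun_prop)) k hk z.1 z.2 hzT hz
    (fun p hp => by
      have h := hmax (show (p, w) ∈ _ from ⟨hp, hwS⟩)
      simp only [mem_ofPred_eq, doubling, testFunctional] at h ⊢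
      linarith) _ _
    (hasCiDerivAt_testFunctional hα hα₁ hε M _ (hq₁ z.1) hzT z.2)
  have key₂ := h₂.super (testFunctional hα hα₁ ε (-M) (freePath hα hα₁ z)
      fun s => -((s - z.1) ^ 2 / ε) + η * s)
    (isCiSmooth_testFunctional hα hα₁ hε (-M) _ hq₂ (by fun_prop)) k hk w.1 w.2 hwT hw
    (fun p hp => by
      have h := hmax (show (z, p) ∈ _ from ⟨hzS, hp⟩)
      have e1 := potential_neg (α := α) (T := T) ε (freePath hα hα₁ z - freePath hα hα₁ p)
      have e2 := potential_neg (α := α) (T := T) ε (freePath hα hα₁ z - freePath hα hα₁ w)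
      rw [neg_sub] at e1 e2
      simp only [mem_ofPred_eq, doubling, testFunctional] at h ⊢
      rw [e1, e2]
      have e3 : ((z.1 : ℝ) - p.1) ^ 2 = ((p.1 : ℝ) - z.1) ^ 2 := by ring
      have e4 : ((z.1 : ℝ) - w.1) ^ 2 = ((w.1 : ℝ) - z.1) ^ 2 := by ring
      rw [e3, e4] at h
      linarith) _ _
    (hasCiDerivAt_testFunctional hα hα₁ hε (-M) _ (hq₂ w.1) hwT w.2)
  -- Oddness of the gradient in `v`: both gradients are built from the same difference `a(z) - a(w)`
  -- and differ only in the time. The derivatives of the quadratic time penalty cancel through `e5`.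
  have e := potentialGrad_neg (α := α) (T := T) ε w.1 (freePath hα hα₁ z - freePath hα hα₁ w)
  rw [neg_sub] at e
  rw [e, smul_neg, neg_smul, neg_neg] at key₂
  have e5 : 2 * ((z.1 : ℝ) - w.1) / ε = -(2 * ((w.1 : ℝ) - z.1) / ε) := by ring
  rw [e5] at key₁
  linarith

/-- The comparison argument; it is asymmetric, with (L) used for `φ₂`. Exchanging the roles of the
solutions gives equality. -/
lemma le_of_isViscositySolution (hα : 0 < α) (hα₁ : α < 1) {c : ℝ} (hc : 0 < c)
    {H : Icc (0 : ℝ) T → Euc n → Euc n → ℝ}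
    (hH : Continuous fun z : Icc (0 : ℝ) T × Euc n × Euc n => H z.1 z.2.1 z.2.2)
    {σ : ACPath n T α → ℝ} {φ₁ φ₂ : Icc (0 : ℝ) T × ACPath n T α → ℝ}
    (h₁ : IsViscositySolution c H σ φ₁) (h₂ : IsViscositySolution c H σ φ₂)
    (z' : Icc (0 : ℝ) T × ACPath n T α) : φ₁ z' ≤ φ₂ z' := by
  by_contra! hlt
  set θ := φ₁ z' - φ₂ z' with hθ
  have hθ0 : 0 < θ := sub_pos.2 hlt
  have hT0 : 0 < T := hT.out
  have hΓ := Real.Gamma_pos_of_pos hα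
  -- The term `η (t + s)` adds at most `2ηT = θ/2`, which is less than the assumed gap `θ`.
  set η := θ / (4 * T) with hη
  have hη0 : 0 < η := by positivity
  have hηT : 2 * η * T = θ / 2 := by rw [hη]; field_simp; norm_num
  obtain ⟨k, hk, hz'⟩ := exists_mem_boundedPaths hα hα₁ hc z'.2
  set X := boundedPaths (n := n) (T := T) (α := α) c k with hX
  have hXc : IsCompact X := isCompact_boundedPaths hα hα₁ hc.le k
  set S : Set (Icc (0 : ℝ) T × ACPath n T α) := univ ×ˢ X with hS
  have hSS : IsCompact (S ×ˢ S) := (isCompact_univ.prod hXc).prod (isCompact_univ.prod hXc)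
  have hz'S : z' ∈ S := ⟨mem_univ _, hz'⟩
  obtain ⟨Λ, hΛ0, hΛ⟩ := h₂.lipschitz.exists_le_integral_norm hα hα₁ hXc
  -- Exceeding the Lipschitz constant makes the penalty exact, so `M` need not tend to infinity and
  -- the gradients remain bounded.
  set M := Λ + 1 with hM
  have hM0 : 0 < M := by positivity
  set μ₀ := (weightMeasure α T).real univ with hμ₀
  set A := freePath (n := n) (T := T) hα hα₁ with hA
  have hAc : Continuous A := continuous_freePath hα hα₁
  set ε : ℕ → ℝ := fun m => 1 / ((m : ℝ) + 1) with hε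
  have hε0 (m : ℕ) : 0 < ε m := by positivity
  choose p hpS hp using fun m : ℕ => hSS.exists_isMaxOn ⟨(z', z'), hz'S, hz'S⟩
    (continuous_doubling hα hα₁ h₁.continuous h₂.continuous M η (hε0 m)).continuousOn
  set l : Ultrafilter ℕ := hyperfilter ℕ with hl
  have hεl : Tendsto ε l (𝓝 0) :=
    tendsto_one_div_add_atTop_nhds_zero_nat.mono_left Nat.hyperfilter_le_atTop
  obtain ⟨⟨z, w⟩, ⟨hzS, hwS⟩, hlim⟩ := exists_tendsto_of_eventually_mem hSS l
    (Eventually.of_forall hpS)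
  have hlz : Tendsto (fun m => (p m).1) l (𝓝 z) := (continuous_fst.tendsto _).comp hlim
  have hlw : Tendsto (fun m => (p m).2) l (𝓝 w) := (continuous_snd.tendsto _).comp hlim
  have hlzt : Tendsto (fun m => ((p m).1.1 : ℝ)) l (𝓝 z.1) :=
    ((continuous_subtype_val.comp continuous_fst).tendsto _).comp hlz
  have hlwt : Tendsto (fun m => ((p m).2.1 : ℝ)) l (𝓝 w.1) :=
    ((continuous_subtype_val.comp continuous_fst).tendsto _).comp hlw
  have hφ₁ := (h₁.continuous.tendsto z).comp hlz
  have hφ₂ := (h₂.continuous.tendsto w).comp hlw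
  have hφ₂z := (h₂.continuous.tendsto z).comp hlz
  have hD : Tendsto (fun m => A (p m).1 - A (p m).2) l (𝓝 (A z - A w)) :=
    ((hAc.tendsto z).comp hlz).sub ((hAc.tendsto w).comp hlw)
  have hN0 (m : ℕ) : ∫ τ, ‖(A (p m).1 - A (p m).2) τ‖ ∂(weightMeasure α T) ≤
      potential α T (ε m) (A (p m).1 - A (p m).2) := integral_norm_le_potential hα (hε0 m) _
  have hNnn (m : ℕ) : 0 ≤ potential α T (ε m) (A (p m).1 - A (p m).2) :=
    (integral_nonneg fun τ => norm_nonneg _).trans (hN0 m)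
  -- comparison with the diagonal point `(z', z')`
  have hcmp (m : ℕ) : θ - M * (μ₀ * ε m) + 2 * η * z'.1 ≤ φ₁ (p m).1 - φ₂ (p m).2 -
      M * potential α T (ε m) (A (p m).1 - A (p m).2) -
      (((p m).1.1 : ℝ) - (p m).2.1) ^ 2 / ε m + η * (((p m).1.1 : ℝ) + (p m).2.1) := by
    have h := hp m (show (z', z') ∈ S ×ˢ S from ⟨hz'S, hz'S⟩)
    simp only [mem_ofPred_eq] at h
    rwa [doubling_diag hα hα₁ _ _ _ _ (hε0 m).le] at h
  set B : ℕ → ℝ := fun m => φ₁ (p m).1 - φ₂ (p m).2 + η * (((p m).1.1 : ℝ) + (p m).2.1) -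
    (θ - M * (μ₀ * ε m) + 2 * η * z'.1) with hB
  have hBlim : Tendsto B l (𝓝 (φ₁ z - φ₂ w + η * ((z.1 : ℝ) + w.1) -
      (θ - M * (μ₀ * 0) + 2 * η * z'.1))) :=
    ((hφ₁.sub hφ₂).add ((hlzt.add hlwt).const_mul η)).sub
      ((tendsto_const_nhds.sub ((hεl.const_mul μ₀).const_mul M)).add tendsto_const_nhds)
  have hBle (m : ℕ) : (((p m).1.1 : ℝ) - (p m).2.1) ^ 2 / ε m ≤ B m := by
    have := hcmp m
    have := mul_nonneg hM0.le (hNnn m)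
    simp only [hB]
    linarith
  have hB0 : 0 ≤ φ₁ z - φ₂ w + η * ((z.1 : ℝ) + w.1) - (θ - M * (μ₀ * 0) + 2 * η * z'.1) :=
    ge_of_tendsto' hBlim fun m => (div_nonneg (sq_nonneg _) (hε0 m).le).trans (hBle m)
  have ht : z.1 = w.1 := by
    have h1 : Tendsto (fun m => (((p m).1.1 : ℝ) - (p m).2.1) ^ 2) l
      (𝓝 (((z.1 : ℝ) - w.1) ^ 2)) := (hlzt.sub hlwt).pow 2
    have h2 := hBlim.mul hεl
    rw [mul_zero] at h2
    -- The squared time gap is at most `ε m * B m`, and `B` converges.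
    have h3 : ((z.1 : ℝ) - w.1) ^ 2 ≤ 0 :=
      le_of_tendsto_of_tendsto' h1 h2 fun m => (div_le_iff₀ (hε0 m)).1 (hBle m)
    exact Subtype.ext (sub_eq_zero.1 (pow_eq_zero_iff two_ne_zero |>.1
      (le_antisymm h3 (sq_nonneg _))))
  -- comparison with the diagonal point `(z m, z m)`
  have hcmp' (m : ℕ) : M * ∫ τ, ‖(A (p m).1 - A (p m).2) τ‖ ∂(weightMeasure α T) ≤
      φ₂ (p m).1 - φ₂ (p m).2 + M * (μ₀ * ε m) + η * (((p m).2.1 : ℝ) - (p m).1.1) := by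
    have h := hp m (show ((p m).1, (p m).1) ∈ S ×ˢ S from ⟨(hpS m).1, (hpS m).1⟩)
    simp only [mem_ofPred_eq] at h
    rw [doubling_diag hα hα₁ _ _ _ _ (hε0 m).le, doubling] at h
    have h3 := mul_le_mul_of_nonneg_left (hN0 m) hM0.le
    have h4 := div_nonneg (sq_nonneg (((p m).1.1 : ℝ) - (p m).2.1)) (hε0 m).le
    linarith
  obtain ⟨t, x⟩ := z
  obtain ⟨t', y⟩ := w
  obtain rfl : t = t' := ht
  have hDle : M * ∫ τ, ‖(A (t, x) - A (t, y)) τ‖ ∂(weightMeasure α T) ≤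
      φ₂ (t, x) - φ₂ (t, y) := by
    have h1 := (((continuous_integral_norm (T := T) hα).tendsto _).comp hD).const_mul M
    have h2 := (((hφ₂z.sub hφ₂).add ((hεl.const_mul μ₀).const_mul M)).add
      ((hlwt.sub hlzt).const_mul η))
    have h3 := le_of_tendsto_of_tendsto' h1 h2 hcmp'
    simpa using h3
  have hφle := hΛ t x hzS.2 y hwS.2
  have hDnn : 0 ≤ ∫ τ, ‖(A (t, x) - A (t, y)) τ‖ ∂(weightMeasure α T) :=
    integral_nonneg fun τ => norm_nonneg _
  -- `(Λ + 1) N ≤ φ₂(t, x) - φ₂(t, y) ≤ Λ N` with `N ≥ 0` forces `N = 0`.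
  have hD0 : ∫ τ, ‖(A (t, x) - A (t, y)) τ‖ ∂(weightMeasure α T) = 0 := by
    refine le_antisymm ?_ hDnn
    have := (le_abs_self _).trans hφle
    rw [hM] at hDle
    linarith
  rw [hD0, mul_zero] at hφle
  have hφeq : φ₂ (t, x) = φ₂ (t, y) := sub_eq_zero.1 (abs_nonpos_iff.1 hφle)
  -- At `t = T` the boundary values cancel, and `hB0` would give `θ ≤ 2ηT = θ/2`.
  have htT : (t : ℝ) < T := by
    refine lt_of_le_of_ne t.2.2 fun h => ?_
    obtain rfl : t = ⟨T, right_mem_Icc.2 hT0.le⟩ := Subtype.ext h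
    rw [← hφeq, h₁.boundary, h₂.boundary] at hB0
    have := mul_nonneg hη0.le z'.1.2.1
    simp only at hB0
    linarith
  have hpath : pathAt x t = pathAt y t := by
    have h := eqOn_zero_of_integral_norm_eq_zero hα _ hD0 t.2
    have h' : freeContinuation t x t - freeContinuation t y t = 0 := h
    rwa [freeContinuation_of_le le_rfl, freeContinuation_of_le le_rfl, sub_eq_zero] at h'
  have htI : (t : ℝ) ∈ Ico 0 T := ⟨t.2.1, htT⟩
  have hzlt : ∀ᶠ m in (l : Filter ℕ), ((p m).1.1 : ℝ) < T := hlzt.eventually (gt_mem_nhds htT)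
  have hwlt : ∀ᶠ m in (l : Filter ℕ), ((p m).2.1 : ℝ) < T := hlwt.eventually (gt_mem_nhds htT)
  have hlzI : Tendsto (fun m => ((p m).1.1 : ℝ)) l (𝓝[Ico 0 T] (t : ℝ)) :=
    tendsto_nhdsWithin_iff.2 ⟨hlzt, hzlt.mono fun m hm => ⟨(p m).1.1.2.1, hm⟩⟩
  have hlwI : Tendsto (fun m => ((p m).2.1 : ℝ)) l (𝓝[Ico 0 T] (t : ℝ)) :=
    tendsto_nhdsWithin_iff.2 ⟨hlwt, hwlt.mono fun m hm => ⟨(p m).2.1.2.1, hm⟩⟩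
  set s₁ : ℕ → Euc n := fun m => M • potentialGrad α T (ε m) (p m).1.1 (A (p m).1 - A (p m).2)
    with hs₁
  set s₂ : ℕ → Euc n := fun m => M • potentialGrad α T (ε m) (p m).2.1 (A (p m).1 - A (p m).2)
    with hs₂
  set m₀ := ∫ τ, fracKernel α (τ - t) ∂(weightMeasure α T) with hm₀
  have hbdd : ∀ᶠ m in (l : Filter ℕ),
      s₁ m ∈ Metric.closedBall 0 (M * ((Real.Gamma α)⁻¹ * (m₀ + 1))) := by
    filter_upwards [hzlt, (tendsto_integral_fracKernel hα htI hlzI).eventually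
      (gt_mem_nhds (lt_add_one m₀))] with m hm1 hm2
    rw [mem_closedBall_zero_iff, hs₁, norm_smul, Real.norm_of_nonneg hM0.le]
    refine mul_le_mul_of_nonneg_left ((norm_potentialGrad_le hα (hε0 m) hm1 _).trans ?_) hM0.le
    exact mul_le_mul_of_nonneg_left hm2.le (inv_nonneg.2 hΓ.le)
  -- The gradient formula degenerates as `ε → 0`, but only some limit `s` common to both gradients
  -- is needed, and boundedness supplies it.
  obtain ⟨s, -, hlim₁⟩ := exists_tendsto_of_eventually_mem (isCompact_closedBall _ _) l hbdd
  have hdiff : Tendsto (fun m => s₁ m - s₂ m) l (𝓝 0) := by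
    rw [tendsto_zero_iff_norm_tendsto_zero]
    have h := ((tendsto_integral_abs_fracKernel_sub_sub hα htI hlzI hlwI).const_mul
      (Real.Gamma α)⁻¹).const_mul M
    simp only [mul_zero] at h
    refine squeeze_zero' (Eventually.of_forall fun m => norm_nonneg _) ?_ h
    filter_upwards [hzlt, hwlt] with m hm1 hm2
    rw [hs₁, hs₂, ← smul_sub, norm_smul, Real.norm_of_nonneg hM0.le]
    exact mul_le_mul_of_nonneg_left (norm_potentialGrad_sub_time_le hα (hε0 m) hm1 hm2 _) hM0.le
  have hlim₂ : Tendsto s₂ l (𝓝 s) := by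
    have h := hlim₁.sub hdiff
    simpa using h
  have hH₁ : Tendsto (fun m => H (p m).1.1 (pathAt (p m).1.2 (p m).1.1) (s₁ m)) l
      (𝓝 (H t (pathAt x t) s)) :=
    (hH.tendsto (t, pathAt x t, s)).comp ((((continuous_fst.tendsto _).comp hlz)).prodMk_nhds
      (((continuous_pathAt_eval.tendsto _).comp hlz).prodMk_nhds hlim₁))
  have hH₂ : Tendsto (fun m => H (p m).2.1 (pathAt (p m).2.2 (p m).2.1) (s₂ m)) l
      (𝓝 (H t (pathAt y t) s)) :=
    (hH.tendsto (t, pathAt y t, s)).comp ((((continuous_fst.tendsto _).comp hlw)).prodMk_nhds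
      (((continuous_pathAt_eval.tendsto _).comp hlw).prodMk_nhds hlim₂))
  have hfin : 2 * η ≤ H t (pathAt x t) s - H t (pathAt y t) s := by
    refine ge_of_tendsto (hH₁.sub hH₂) ?_
    filter_upwards [hzlt, hwlt] with m hm1 hm2
    exact two_mul_le_of_isMaxOn_doubling hα hα₁ h₁ h₂ hk (hε0 m) (hpS m).1.2 (hpS m).2.2 hm1 hm2
      (hp m)
  rw [hpath, sub_self] at hfin
  linarith

end Comparison
end FracHJ

theorem mainTheorem1 (n : ℕ) (T : ℝ) [Fact (0 < T)] (α : ℝ) (hα₀ : 0 < α) (hα₁ : α < 1)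
    (c : ℝ) (hc : 0 < c)
    (H : Set.Icc (0 : ℝ) T → FracHJ.Euc n → FracHJ.Euc n → ℝ)
    (hj : Continuous fun z : Set.Icc (0 : ℝ) T × FracHJ.Euc n × FracHJ.Euc n =>
      H z.1 z.2.1 z.2.2)
    (hjj : ∀ (t : Set.Icc (0 : ℝ) T) (x s r : FracHJ.Euc n),
      |H t x s - H t x r| ≤ c * (1 + ‖x‖) * ‖s - r‖)
    (σ : FracHJ.ACPath n T α → ℝ)
    (φ₁ φ₂ : Set.Icc (0 : ℝ) T × FracHJ.ACPath n T α → ℝ)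
    (h₁ : FracHJ.IsViscositySolution c H σ φ₁)
    (h₂ : FracHJ.IsViscositySolution c H σ φ₂) :
    φ₁ = φ₂ := by
  funext z
  exact le_antisymm (FracHJ.le_of_isViscositySolution hα₀ hα₁ hc hj h₁ h₂ z)
    (FracHJ.le_of_isViscositySolution hα₀ hα₁ hc hj h₂ h₁ z)
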